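/- Let $d\ge 1$, let $p_{\rm data}$ be a probability measure on $\mathbb R^d$ with $\int\|x\|^2\,dp_{\rm data}=m_2^2<\infty$ ($m_2\ge 0$), and let $p_t$ be the law at time $t$ of the Ornstein–Uhlenbeck process $dx_t=-x_t\,dt+\sqrt2\,dw_t$, $x_0\sim p_{\rm data}$, that is, the law of $e^{-t}x_0+\sqrt{1-e^{-2t}}\,\xi$ with $\xi\sim N(0,I_d)$ independent of $x_0$; for $t>0$ it has a smooth positive density, also written $p_t$. Let $s_\phi(x,t)$ (measurable in $x$) and $f_\theta(x,t)$ be $\mathbb R^d$-valued, let $\varepsilon_{sc},\varepsilon_{cm}\ge 0$, and assume: (1) for all $t\in(0,T]$ the score $\nabla\log p_t$ is $L_s$-Lipschitz, where $L_s\ge 1$; (2) two-stage schedule: $0<\delta=t_1<t_2<\dots<t_N=T$, and there are $h$ and $1\le N_1\le N$ with $t_{k+1}-t_k=h$ for $N_1\le k\le N-1$ and $(N-N_1)h<T\le(N-N_1+1)h$ (so $0<t_{N_1}\le h$), with $t_{k+1}-t_k=2^{-(N_1-k)}h$ for $2\le k\le N_1-1$, and with $2^{-(N_1-2)}h\le 2\delta$;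 (3) $\mathbb E_{x\sim p_{t_n}}\|s_\phi(x,t_n)-\nabla\log p_{t_n}(x)\|^2\le\varepsilon_{sc}^2$ for $1\le n\le N$; (4) $f_\theta(x,\delta)=x$ for all $x$, and $\mathbb E_{x\sim p_{t_{n+1}}}\|f_\theta(x,t_{n+1})-f_\theta(\hat x_n,t_n)\|^2\le\varepsilon_{cm}^2(t_{n+1}-t_n)^2$ for $1\le n\le N-1$, where $\hat x_n=e^{t_{n+1}-t_n}x+(e^{t_{n+1}-t_n}-1)s_\phi(x,t_{n+1})$; (5) $f_\theta(\cdot,t_n)$ is $L_f$-Lipschitz for $1\le n\le N$, where $L_f>1$; (6) $T>L_s^{-1}$ and $h\le h_0$. Write $a\vee b=\max(a,b)$, let $W_2$ be the Wasserstein-2 distance, and let $f_{\theta,T}\sharp N(0,I_d)$ be the law of $f_\theta(\xi,T)$, $\xi\sim N(0,I_d)$. Then, for every $h_0>0$: (a) There is a constant $C$ depending only on $h_0$ such that, whenever (1)–(6) hold, $$W_2\big(f_{\theta,T}\sharp N(0,I_d),\,p_{\rm data}\big)\le C\Big[(\sqrt d\vee m_2)L_fe^{-T}+T\big(\varepsilon_{cm}+L_f\varepsilon_{sc}+L_fL_s^{3/2}d^{1/2}h\big)+(\sqrt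 d\vee m_2)\delta^{1/2}\Big].$$ (b) For every $K>0$ there is a constant $C$ depending only on $h_0$ and $K$ such that, whenever (1)–(6) hold, for every $\varepsilon>0$: if $$\delta\le K\frac{\varepsilon^2}{d\vee m_2^2},\quad T\ge\log\frac{L_f(\sqrt d\vee m_2)}{\varepsilon},\quad h\le K\frac{\varepsilon}{TL_fL_s^{3/2}d^{1/2}},\quad \varepsilon_{cm}\le K\frac{\varepsilon}{T},\quad \varepsilon_{sc}\le K\frac{\varepsilon}{L_fT},$$ then $W_2\big(f_{\theta,T}\sharp N(0,I_d),\,p_{\rm data}\big)\le C\varepsilon$. -/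

import Mathlib

open MeasureTheory ProbabilityTheory
open scoped ENNReal NNReal

namespace CMError

/-- The state space `ℝᵈ` with its Euclidean norm. -/
abbrev Space (d : ℕ) : Type := EuclideanSpace ℝ (Fin d)

/-- The Wasserstein-2 distance, with values in `[0, ∞]`: the square root of the infimum over all
couplings `γ` of `μ` and `ν` of `∫ ‖x - y‖² dγ(x, y)`. -/
noncomputable def W2 {d : ℕ} (μ ν : Measure (Space d)) : ℝ≥0∞ :=
  (⨅ γ ∈ {γ : Measure (Space d × Space d) | γ.map Prod.fst = μ ∧ γ.map Prod.snd = ν},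
    ∫⁻ z, ‖z.1 - z.2‖ₑ ^ 2 ∂γ) ^ ((1 : ℝ) / 2)

/-- The law `p_t` at time `t` of the Ornstein-Uhlenbeck process `dx_t = -x_t dt + √2 dw_t` with
`x_0 ∼ pdata`: the law of `e^{-t} x_0` convolved with `N(0, (1 - e^{-2t}) I)`. -/
noncomputable def ouLaw {d : ℕ} (pdata : Measure (Space d)) (t : ℝ) : Measure (Space d) :=
  (pdata.map fun x => Real.exp (-t) • x).conv
    ((stdGaussian (Space d)).map fun z => √(1 - Real.exp (-2 * t)) • z)

/-- The density of `N(0, v I)` on `ℝᵈ`, for `v > 0`. -/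
noncomputable def gaussianDensity (d : ℕ) (v : ℝ) (z : Space d) : ℝ :=
  (2 * Real.pi * v) ^ (-(d : ℝ) / 2) * Real.exp (-‖z‖ ^ 2 / (2 * v))

/-- For `t > 0`, the (smooth, positive) density of `ouLaw pdata t` with respect to Lebesgue
measure. -/
noncomputable def ouDensity {d : ℕ} (pdata : Measure (Space d)) (t : ℝ) (x : Space d) : ℝ :=
  ∫ y, gaussianDensity d (1 - Real.exp (-2 * t)) (x - Real.exp (-t) • y) ∂pdata

/-- The score function `∇ log p_t`, for `t > 0`. -/
noncomputable def score {d : ℕ} (pdata : Measure (Space d)) (t : ℝ) (x : Space d) : Space d :=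
  gradient (fun z => Real.log (ouDensity pdata t z)) x

/-- One step of the exponential integrator for the empirical probability flow ODE
`dx_t = (-x_t - s(x_t, t)) dt`, from time `b`, state `x`, back to time `a`.
Here `s t x` stands for `s(x, t)`. -/
noncomputable def expIntegrator {d : ℕ} (s : ℝ → Space d → Space d) (a b : ℝ) (x : Space d) :
    Space d :=
  Real.exp (b - a) • x + (Real.exp (b - a) - 1) • s b x

/-- The two-stage time schedule `0 < δ = t 1 < t 2 < ⋯ < t N = T`: steps of constant size `h` from
the index `N₁` on, where `t N₁ ∈ (0, h]`, and before that steps that halve towards `δ`. The very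
first step is the positive remainder. -/
structure IsTwoStageSchedule (t : ℕ → ℝ) (N N₁ : ℕ) (h δ T : ℝ) : Prop where
  one_le : 1 ≤ N₁
  le_last : N₁ ≤ N
  delta_pos : 0 < δ
  first : t 1 = δ
  last : t N = T
  increasing : ∀ k, 1 ≤ k → k < N → t k < t (k + 1)
  constant_step : ∀ k, N₁ ≤ k → k < N → t (k + 1) - t k = h
  constant_lower : ((N : ℝ) - N₁) * h < T
  constant_upper : T ≤ ((N : ℝ) - N₁ + 1) * h
  geometric_step : ∀ k, 2 ≤ k → k < N₁ → t (k + 1) - t k = h / 2 ^ (N₁ - k)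
  geometric_end : (2 : ℝ) ^ (-((N₁ : ℤ) - 2)) * h ≤ 2 * δ

/-- The standing assumptions. `s t x` is the score model `s_φ(x, t)` and `f t x` is the consistency
model `f_θ(x, t)`. -/
structure Assumptions {d : ℕ} (pdata : Measure (Space d)) (m₂ : ℝ) (Ls Lf : ℝ≥0)
    (s f : ℝ → Space d → Space d) (εsc εcm : ℝ) (t : ℕ → ℝ) (N N₁ : ℕ) (h δ T : ℝ) : Prop where
  /-- `pdata` has finite second moment `m₂²`. -/
  m₂_nonneg : 0 ≤ m₂
  integrable_sq : Integrable (fun x => ‖x‖ ^ 2) pdata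
  second_moment : ∫ x, ‖x‖ ^ 2 ∂pdata = m₂ ^ 2
  /-- The score is `Ls`-Lipschitz with `Ls ≥ 1`. -/
  one_le_Ls : 1 ≤ Ls
  score_lipschitz : ∀ τ : ℝ, 0 < τ → τ ≤ T → LipschitzWith Ls (score pdata τ)
  /-- The score model has `L²` error at most `εsc`. -/
  εsc_nonneg : 0 ≤ εsc
  score_model_measurable : ∀ n, 1 ≤ n → n ≤ N → Measurable (s (t n))
  score_error : ∀ n, 1 ≤ n → n ≤ N →
    ∫⁻ x, ‖s (t n) x - score pdata (t n) x‖ₑ ^ 2 ∂(ouLaw pdata (t n)) ≤ ENNReal.ofReal (εsc ^ 2)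
  /-- The consistency model satisfies the boundary condition at the early-stopping time. -/
  boundary : ∀ x, f δ x = x
  /-- The consistency model has `L²` consistency error at most `εcm` per unit of time. -/
  εcm_nonneg : 0 ≤ εcm
  consistency_error : ∀ n, 1 ≤ n → n < N →
    ∫⁻ x, ‖f (t (n + 1)) x - f (t n) (expIntegrator s (t n) (t (n + 1)) x)‖ₑ ^ 2
      ∂(ouLaw pdata (t (n + 1))) ≤ ENNReal.ofReal (εcm ^ 2 * (t (n + 1) - t n) ^ 2)
  /-- The consistency model is `Lf`-Lipschitz with `Lf > 1`. -/
  one_lt_Lf : 1 < Lf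
  model_lipschitz : ∀ n, 1 ≤ n → n ≤ N → LipschitzWith Lf (f (t n))
  schedule : IsTwoStageSchedule t N N₁ h δ T

theorem integrable_gaussianDensity (d : ℕ) {v : ℝ} (hv : 0 < v) :
    Integrable (gaussianDensity d v) := by
  have h := (GaussianFourier.integrable_cexp_neg_mul_sq_norm_add (V := Space d)
    (b := ((1 / (2 * v) : ℝ) : ℂ)) (by rw [Complex.ofReal_re]; positivity) 0 0).norm
  unfold gaussianDensity
  refine (h.congr (.of_forall fun x => ?_)).const_mul _
  simp only [Complex.norm_exp]
  congr 1
  simp [← Complex.ofReal_pow, ← Complex.ofReal_mul]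
  ring

theorem gaussianDensity_nonneg (d : ℕ) {v : ℝ} (hv : 0 < v) (z : Space d) :
    0 ≤ gaussianDensity d v z := by unfold gaussianDensity; positivity

theorem continuous_gaussianDensity (d : ℕ) (v : ℝ) : Continuous (gaussianDensity d v) := by
  unfold gaussianDensity; fun_prop

theorem map_stdGaussian_eq (d : ℕ) {v : ℝ} (hv : 0 < v) :
    (stdGaussian (Space d)).map (fun z => √v • z) =
      volume.withDensity (fun z => ENNReal.ofReal (gaussianDensity d v z)) := by
  have : IsFiniteMeasure
      ((volume : Measure (Space d)).withDensity fun z => ENNReal.ofReal (gaussianDensity d v z)) :=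
    isFiniteMeasure_withDensity_ofReal (integrable_gaussianDensity d hv).2
  refine Measure.ext_of_charFun ?_
  ext s
  rw [charFun_map_smul, charFun_stdGaussian, charFun_apply,
    integral_withDensity_eq_integral_toReal_smul (by
      have := (continuous_gaussianDensity d v).measurable; fun_prop) (by simp)]
  have key := GaussianFourier.integral_cexp_neg_mul_sq_norm_add (V := Space d)
    (b := ((1 / (2 * v) : ℝ) : ℂ)) (by rw [Complex.ofReal_re]; positivity) Complex.I s
  have h2 : ∀ x : Space d, (ENNReal.ofReal (gaussianDensity d v x)).toReal •
      Complex.exp (inner ℝ x s * Complex.I) = (((2 * Real.pi * v) ^ (-(d : ℝ) / 2) : ℝ) : ℂ) *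
        Complex.exp (-((1 / (2 * v) : ℝ) : ℂ) * ‖x‖ ^ 2 + Complex.I * inner ℝ s x) := by
    intro x
    rw [ENNReal.toReal_ofReal (gaussianDensity_nonneg d hv x), Complex.real_smul, gaussianDensity,
      Complex.ofReal_mul, mul_assoc, Complex.ofReal_exp, ← Complex.exp_add, real_inner_comm]
    congr 2
    push_cast
    ring
  simp_rw [h2]
  rw [integral_const_mul, key]
  have hpos : (0 : ℝ) < 2 * Real.pi * v := by positivity
  have h3 : ((Real.pi : ℂ) / ((1 / (2 * v) : ℝ) : ℂ)) ^ ((Module.finrank ℝ (Space d) : ℂ) / 2)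
      = (((2 * Real.pi * v) ^ ((d : ℝ) / 2) : ℝ) : ℂ) := by
    rw [Complex.ofReal_cpow hpos.le]
    congr 1
    · push_cast; field_simp
    · simp
  rw [h3, ← mul_assoc, ← Complex.ofReal_mul, ← Real.rpow_add hpos]
  rw [show -(d : ℝ) / 2 + d / 2 = 0 by ring, Real.rpow_zero, Complex.ofReal_one, one_mul]
  congr 1
  have hv' : (v : ℂ) ≠ 0 := by exact_mod_cast hv.ne'
  have hn : ‖√v • s‖ ^ 2 = v * ‖s‖ ^ 2 := by
    rw [norm_smul, mul_pow, Real.norm_eq_abs, sq_abs, Real.sq_sqrt hv.le]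
  rw [← Complex.ofReal_pow, hn, Complex.I_sq]
  push_cast
  field_simp
  ring

/-- For `t > 0`, `ouDensity pdata t` is indeed the density of `ouLaw pdata t`. -/
theorem ouLaw_eq_withDensity {d : ℕ} (pdata : Measure (Space d)) [IsProbabilityMeasure pdata]
    {t : ℝ} (ht : 0 < t) :
    ouLaw pdata t = volume.withDensity (fun x => ENNReal.ofReal (ouDensity pdata t x)) := by
  have hv : 0 < 1 - Real.exp (-2 * t) := by
    have : Real.exp (-2 * t) < 1 := Real.exp_lt_one_iff.2 (by linarith)
    linarith
  set v := 1 - Real.exp (-2 * t) with hvdef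
  have hc := continuous_gaussianDensity d v
  have hm : Measurable (gaussianDensity d v) := hc.measurable
  have hint : ∀ x, Integrable
      (fun y => gaussianDensity d v (x - Real.exp (-t) • y)) pdata := by
    intro x
    refine Integrable.of_bound (C := (2 * Real.pi * v) ^ (-(d : ℝ) / 2))
      (hc.comp (by fun_prop)).aestronglyMeasurable (.of_forall fun y => ?_)
    rw [Real.norm_of_nonneg (gaussianDensity_nonneg d hv _)]
    unfold gaussianDensity
    refine mul_le_of_le_one_right (by positivity) (Real.exp_le_one_iff.2 ?_)
    rw [neg_div]; simp only [Left.neg_nonpos_iff]; positivity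
  have hd : ∀ x, ENNReal.ofReal (ouDensity pdata t x) =
      ∫⁻ y, ENNReal.ofReal (gaussianDensity d v (x - Real.exp (-t) • y)) ∂pdata := fun x =>
    ofReal_integral_eq_lintegral_ofReal (hint x) (.of_forall fun y => gaussianDensity_nonneg d hv _)
  refine Measure.ext_of_lintegral _ fun g hg => ?_
  rw [ouLaw, ← hvdef, map_stdGaussian_eq d hv, Measure.lintegral_conv hg,
    lintegral_map (by fun_prop) (by fun_prop),
    lintegral_withDensity_eq_lintegral_mul _ (by simp_rw [hd]; fun_prop) hg]
  simp only [Pi.mul_apply, hd]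
  have : ∀ y : Space d, ∫⁻ z, g (Real.exp (-t) • y + z)
      ∂(volume.withDensity fun z => ENNReal.ofReal (gaussianDensity d v z)) =
      ∫⁻ x, ENNReal.ofReal (gaussianDensity d v (x - Real.exp (-t) • y)) * g x := by
    intro y
    rw [lintegral_withDensity_eq_lintegral_mul _ (by fun_prop) (by fun_prop),
      ← lintegral_add_right_eq_self
        (fun x => ENNReal.ofReal (gaussianDensity d v (x - Real.exp (-t) • y)) * g x)
        (Real.exp (-t) • y)]
    simp [add_comm]
  simp_rw [this]
  rw [lintegral_lintegral_swap (by fun_prop)]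
  refine lintegral_congr fun x => ?_
  rw [lintegral_mul_const _ (by fun_prop)]
end CMError

namespace CMError
open Set Filter Topology

/-- Polynomial multiples of the heat kernel on space-time `ℝ × ℝᵈ`. -/
inductive IsKernel (d : ℕ) : (ℝ × Space d → ℝ) → Prop
  | gauss : IsKernel d fun p => gaussianDensity d p.1 p.2
  | coord (i : Fin d) {F : ℝ × Space d → ℝ} : IsKernel d F → IsKernel d fun p => p.2 i * F p
  | inv_time {F : ℝ × Space d → ℝ} : IsKernel d F → IsKernel d fun p => p.1⁻¹ * F p
  | const_mul (c : ℝ) {F : ℝ × Space d → ℝ} : IsKernel d F → IsKernel d fun p => c * F p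
  | add {F F' : ℝ × Space d → ℝ} : IsKernel d F → IsKernel d F' → IsKernel d fun p => F p + F' p
  | congr {F F' : ℝ × Space d → ℝ} : IsKernel d F → (∀ p, 0 < p.1 → F' p = F p) → IsKernel d F'

variable {d : ℕ}

theorem IsKernel.zero : IsKernel d fun _ => 0 :=
  (IsKernel.gauss.const_mul 0).congr fun p _ => by simp

theorem IsKernel.sum {ι : Type*} (s : Finset ι) {F : ι → ℝ × Space d → ℝ}
    (h : ∀ i ∈ s, IsKernel d (F i)) : IsKernel d fun p => ∑ i ∈ s, F i p := by
  classical
  induction s using Finset.induction_on with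
  | empty => simpa using IsKernel.zero
  | insert a s ha ih =>
    simp_rw [Finset.sum_insert ha]
    exact (h a (by simp)).add (ih fun i hi => h i (by simp [hi]))

theorem gaussianDensity_eq_exp (d : ℕ) {v : ℝ} (hv : 0 < v) (z : Space d) :
    gaussianDensity d v z =
      Real.exp (Real.log (2 * Real.pi * v) * (-(d : ℝ) / 2) + -‖z‖ ^ 2 / (2 * v)) := by
  rw [gaussianDensity, Real.rpow_def_of_pos (by positivity), Real.exp_add]

theorem gaussianDensity_pos (d : ℕ) {v : ℝ} (hv : 0 < v) (z : Space d) :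
    0 < gaussianDensity d v z := by rw [gaussianDensity_eq_exp d hv]; positivity

theorem hasFDerivAt_gaussianDensity (p : ℝ × Space d) (hp : 0 < p.1) :
    HasFDerivAt (fun q : ℝ × Space d => gaussianDensity d q.1 q.2)
      (gaussianDensity d p.1 p.2 •
        ((‖p.2‖ ^ 2 / (2 * p.1 ^ 2) - d / (2 * p.1)) • ContinuousLinearMap.fst ℝ ℝ (Space d)
          - p.1⁻¹ • (innerSL ℝ p.2).comp (ContinuousLinearMap.snd ℝ ℝ (Space d)))) p := by
  have h1 : HasFDerivAt (fun q : ℝ × Space d => q.1) (ContinuousLinearMap.fst ℝ ℝ (Space d)) p :=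
    hasFDerivAt_fst
  have h2 : HasFDerivAt (fun q : ℝ × Space d => q.2) (ContinuousLinearMap.snd ℝ ℝ (Space d)) p :=
    hasFDerivAt_snd
  have h3 := ((h1.const_mul (2 * Real.pi)).log (by positivity)).mul_const (-(d : ℝ) / 2)
  have h4 := h2.norm_sq.neg.mul ((hasDerivAt_inv (x := 2 * p.1) (by positivity)).comp_hasFDerivAt p
    (h1.const_mul 2))
  have h5 := (h3.add h4).exp
  have heq : (fun q : ℝ × Space d => gaussianDensity d q.1 q.2) =ᶠ[𝓝 p] fun q =>
      Real.exp (Real.log (2 * Real.pi * q.1) * (-(d : ℝ) / 2) + -‖q.2‖ ^ 2 * (2 * q.1)⁻¹) := by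
    have : ∀ᶠ q : ℝ × Space d in 𝓝 p, 0 < q.1 := continuous_fst.continuousAt.eventually (lt_mem_nhds hp)
    filter_upwards [this] with q hq
    rw [gaussianDensity_eq_exp d hq, div_eq_mul_inv (-‖q.2‖ ^ 2)]
  refine (h5.congr_of_eventuallyEq heq).congr_fderiv ?_
  rw [heq.eq_of_nhds]
  ext v
  · simp
    field_simp
    ring
  · simp
    field_simp

theorem norm_sq_eq_sum (w : Space d) : ‖w‖ ^ 2 = ∑ i, w i * w i := by
  rw [EuclideanSpace.norm_sq_eq]
  simp [sq]

theorem inner_eq_sum (w v : Space d) : inner ℝ w v = ∑ i, v i * w i := by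
  simp [PiLp.inner_apply]

theorem IsKernel.differentiableAt_and_fderiv {F : ℝ × Space d → ℝ} (hF : IsKernel d F) :
    (∀ p, 0 < p.1 → DifferentiableAt ℝ F p) ∧ ∀ v, IsKernel d fun p => fderiv ℝ F p v := by
  induction hF with
  | gauss =>
    refine ⟨fun p hp => (hasFDerivAt_gaussianDensity p hp).differentiableAt, fun v => ?_⟩
    have hg : IsKernel d fun p => gaussianDensity d p.1 p.2 := .gauss
    have k1 := (IsKernel.sum Finset.univ fun i _ => (hg.coord i).coord i).inv_time.inv_time.const_mul
      (v.1 / 2)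
    have k2 := hg.inv_time.const_mul (-(v.1 * d / 2))
    have k3 := (IsKernel.sum Finset.univ fun i _ => (hg.coord i).const_mul (v.2 i)).inv_time.const_mul
      (-1)
    refine ((k1.add k2).add k3).congr fun p hp => ?_
    rw [(hasFDerivAt_gaussianDensity p hp).fderiv]
    simp only [norm_sq_eq_sum, inner_eq_sum, smul_apply,
      sub_apply, ContinuousLinearMap.comp_apply, ContinuousLinearMap.coe_fst',
      ContinuousLinearMap.coe_snd', innerSL_apply_apply, smul_eq_mul]
    simp_rw [← mul_assoc, ← Finset.sum_mul]
    field_simp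
    ring
  | coord i hF ih =>
    obtain ⟨ih1, ih2⟩ := ih
    have hc : ∀ p : ℝ × Space d, HasFDerivAt (fun q : ℝ × Space d => q.2 i)
        ((EuclideanSpace.proj i).comp (ContinuousLinearMap.snd ℝ ℝ (Space d))) p := fun p =>
      ((EuclideanSpace.proj i).comp (ContinuousLinearMap.snd ℝ ℝ (Space d))).hasFDerivAt
    refine ⟨fun p hp => (hc p).differentiableAt.mul (ih1 p hp), fun v => ?_⟩
    refine (((ih2 v).coord i).add (hF.const_mul (v.2 i))).congr fun p hp => ?_
    rw [((hc p).fun_mul (ih1 p hp).hasFDerivAt).fderiv]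
    simp
    ring
  | @inv_time F hF ih =>
    obtain ⟨ih1, ih2⟩ := ih
    have hc : ∀ p : ℝ × Space d, 0 < p.1 → HasFDerivAt (fun q : ℝ × Space d => q.1⁻¹)
        (-(p.1 ^ 2)⁻¹ • (ContinuousLinearMap.fst ℝ ℝ (Space d))) p := fun p hp =>
      (hasDerivAt_inv hp.ne').comp_hasFDerivAt p hasFDerivAt_fst
    refine ⟨fun p hp => (hc p hp).differentiableAt.mul (ih1 p hp), fun v => ?_⟩
    refine ((ih2 v).inv_time.add (hF.inv_time.inv_time.const_mul (-v.1))).congr fun p hp => ?_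
    rw [((hc p hp).fun_mul (ih1 p hp).hasFDerivAt).fderiv]
    simp
    field_simp
  | const_mul c hF ih =>
    refine ⟨fun p hp => (ih.1 p hp).const_mul c, fun v => ((ih.2 v).const_mul c).congr fun p hp => ?_⟩
    rw [((ih.1 p hp).hasFDerivAt.const_mul c).fderiv]
    simp
  | add hF hF' ih ih' =>
    refine ⟨fun p hp => (ih.1 p hp).add (ih'.1 p hp), fun v => ((ih.2 v).add (ih'.2 v)).congr
      fun p hp => ?_⟩
    rw [((ih.1 p hp).hasFDerivAt.fun_add (ih'.1 p hp).hasFDerivAt).fderiv]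
    simp
  | @congr F F' hF h ih =>
    have he : ∀ p : ℝ × Space d, 0 < p.1 → F' =ᶠ[𝓝 p] F := fun p hp => by
      have : ∀ᶠ q : ℝ × Space d in 𝓝 p, 0 < q.1 :=
        continuous_fst.continuousAt.eventually (lt_mem_nhds hp)
      filter_upwards [this] with q hq using h q hq
    refine ⟨fun p hp => (he p hp).differentiableAt_iff.2 (ih.1 p hp), fun v => (ih.2 v).congr
      fun p hp => ?_⟩
    rw [(he p hp).fderiv_eq]

theorem IsKernel.differentiableAt {F : ℝ × Space d → ℝ} (hF : IsKernel d F) {p : ℝ × Space d}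
    (hp : 0 < p.1) : DifferentiableAt ℝ F p := hF.differentiableAt_and_fderiv.1 p hp

theorem IsKernel.fderiv {F : ℝ × Space d → ℝ} (hF : IsKernel d F) (v : ℝ × Space d) :
    IsKernel d fun p => fderiv ℝ F p v := hF.differentiableAt_and_fderiv.2 v

theorem IsKernel.continuous_slice {F : ℝ × Space d → ℝ} (hF : IsKernel d F) {τ : ℝ} (hτ : 0 < τ) :
    Continuous fun w => F (τ, w) :=
  continuous_iff_continuousAt.2 fun w =>
    (hF.differentiableAt (p := (τ, w)) hτ).continuousAt.comp (by fun_prop)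

theorem IsKernel.exists_bound {F : ℝ × Space d → ℝ} (hF : IsKernel d F) {a b : ℝ} (ha : 0 < a) :
    ∃ C : ℝ, ∃ k : ℕ, 0 ≤ C ∧ ∀ τ ∈ Icc a b, ∀ w,
      |F (τ, w)| ≤ C * (1 + ‖w‖) ^ k * gaussianDensity d τ w := by
  have hg : ∀ τ ∈ Icc a b, ∀ w : Space d, 0 ≤ gaussianDensity d τ w := fun τ hτ w =>
    gaussianDensity_nonneg d (ha.trans_le hτ.1) w
  induction hF with
  | gauss => exact ⟨1, 0, zero_le_one, fun τ hτ w => by simp [abs_of_nonneg (hg τ hτ w)]⟩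
  | coord i hF ih =>
    obtain ⟨C, k, hC, h⟩ := ih
    refine ⟨C, k + 1, hC, fun τ hτ w => ?_⟩
    rw [abs_mul]
    have h1 : |w i| ≤ 1 + ‖w‖ := by
      have := PiLp.norm_apply_le w i
      rw [Real.norm_eq_abs] at this
      linarith
    calc |w i| * |_| ≤ (1 + ‖w‖) * (C * (1 + ‖w‖) ^ k * gaussianDensity d τ w) := by
          have := h τ hτ w
          gcongr
      _ = _ := by ring
  | inv_time hF ih =>
    obtain ⟨C, k, hC, h⟩ := ih
    refine ⟨a⁻¹ * C, k, by positivity, fun τ hτ w => ?_⟩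
    have hτ0 : 0 < τ := ha.trans_le hτ.1
    have h1 : |τ⁻¹| ≤ a⁻¹ := by
      rw [abs_of_pos (by positivity)]
      exact inv_anti₀ ha hτ.1
    rw [abs_mul]
    calc |τ⁻¹| * |_| ≤ a⁻¹ * (C * (1 + ‖w‖) ^ k * gaussianDensity d τ w) := by
          have := h τ hτ w
          gcongr
      _ = _ := by ring
  | const_mul c hF ih =>
    obtain ⟨C, k, hC, h⟩ := ih
    refine ⟨|c| * C, k, by positivity, fun τ hτ w => ?_⟩
    rw [abs_mul]
    have := mul_le_mul_of_nonneg_left (h τ hτ w) (abs_nonneg c)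
    linarith
  | add hF hF' ih ih' =>
    obtain ⟨C, k, hC, h⟩ := ih
    obtain ⟨C', k', hC', h'⟩ := ih'
    refine ⟨C + C', max k k', by positivity, fun τ hτ w => (abs_add_le _ _).trans ?_⟩
    have hw : (1 : ℝ) ≤ 1 + ‖w‖ := by linarith [norm_nonneg w]
    have e1 := pow_le_pow_right₀ hw (le_max_left k k')
    have e2 := pow_le_pow_right₀ hw (le_max_right k k')
    have h0 := hg τ hτ w
    calc _ ≤ C * (1 + ‖w‖) ^ k * gaussianDensity d τ w + C' * (1 + ‖w‖) ^ k' * gaussianDensity d τ w :=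
          add_le_add (h τ hτ w) (h' τ hτ w)
      _ ≤ C * (1 + ‖w‖) ^ max k k' * gaussianDensity d τ w
          + C' * (1 + ‖w‖) ^ max k k' * gaussianDensity d τ w := by gcongr
      _ = _ := by ring
  | congr hF h ih =>
    obtain ⟨C, k, hC, h'⟩ := ih
    exact ⟨C, k, hC, fun τ hτ w => by rw [h _ (ha.trans_le hτ.1)]; exact h' τ hτ w⟩

theorem pow_mul_gaussianDensity_le (d m : ℕ) {a b : ℝ} (ha : 0 < a) (hab : a ≤ b) :
    ∃ C : ℝ, 0 ≤ C ∧ ∀ τ ∈ Icc a b, ∀ w : Space d,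
      (1 + ‖w‖) ^ m * gaussianDensity d τ w ≤ C * gaussianDensity d (2 * b) w := by
  refine ⟨m.factorial * Real.exp (1 + b) * ((2 * Real.pi * a) ^ (-(d : ℝ) / 2)
    / (2 * Real.pi * (2 * b)) ^ (-(d : ℝ) / 2)), ?_, fun τ hτ w => ?_⟩
  · have hb : 0 < b := ha.trans_le hab
    positivity
  have hτ0 : 0 < τ := ha.trans_le hτ.1
  have hb : 0 < b := hτ0.trans_le hτ.2
  have h1 : (1 + ‖w‖) ^ m ≤ m.factorial * Real.exp (1 + ‖w‖) := by
    have := Real.pow_div_factorial_le_exp (1 + ‖w‖) (by positivity) m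
    rw [div_le_iff₀ (by positivity)] at this
    linarith
  have h2 : Real.exp (1 + ‖w‖) * Real.exp (-‖w‖ ^ 2 / (2 * τ)) ≤
      Real.exp (1 + b) * Real.exp (-‖w‖ ^ 2 / (2 * (2 * b))) := by
    rw [← Real.exp_add, ← Real.exp_add]
    refine Real.exp_le_exp.2 ?_
    have e1 : -‖w‖ ^ 2 / (2 * τ) ≤ -‖w‖ ^ 2 / (2 * b) := by
      rw [neg_div, neg_div, neg_le_neg_iff]
      have := hτ.2
      gcongr
    have e2 : ‖w‖ ≤ b + ‖w‖ ^ 2 / (4 * b) := by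
      rw [← sub_nonneg]
      have : b + ‖w‖ ^ 2 / (4 * b) - ‖w‖ = (2 * b - ‖w‖) ^ 2 / (4 * b) := by field_simp; ring
      rw [this]; positivity
    have e3 : -‖w‖ ^ 2 / (2 * b) + ‖w‖ ^ 2 / (4 * b) = -‖w‖ ^ 2 / (2 * (2 * b)) := by field_simp; ring
    linarith
  have h3 : (2 * Real.pi * τ) ^ (-(d : ℝ) / 2) ≤ (2 * Real.pi * a) ^ (-(d : ℝ) / 2) := by
    refine Real.rpow_le_rpow_of_nonpos (by positivity) ?_ ?_
    · have := hτ.1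
      gcongr
    · rw [neg_div]; simp only [Left.neg_nonpos_iff]; positivity
  unfold gaussianDensity
  have hne : (2 * Real.pi * (2 * b)) ^ (-(d : ℝ) / 2) ≠ 0 := by positivity
  calc _ = (2 * Real.pi * τ) ^ (-(d : ℝ) / 2) * ((1 + ‖w‖) ^ m * Real.exp (-‖w‖ ^ 2 / (2 * τ))) := by ring
    _ ≤ (2 * Real.pi * a) ^ (-(d : ℝ) / 2) *
        (m.factorial * Real.exp (1 + ‖w‖) * Real.exp (-‖w‖ ^ 2 / (2 * τ))) := by gcongr
    _ ≤ (2 * Real.pi * a) ^ (-(d : ℝ) / 2) *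
        (m.factorial * (Real.exp (1 + b) * Real.exp (-‖w‖ ^ 2 / (2 * (2 * b))))) := by
      rw [mul_assoc (m.factorial : ℝ)]; gcongr
    _ = _ := by field_simp

theorem IsKernel.exists_gaussian_bound {F : ℝ × Space d → ℝ} (hF : IsKernel d F) {a b : ℝ}
    (ha : 0 < a) (hab : a ≤ b) :
    ∃ C : ℝ, 0 ≤ C ∧ ∀ τ ∈ Icc a b, ∀ w, |F (τ, w)| ≤ C * gaussianDensity d (2 * b) w := by
  obtain ⟨C, k, hC, h⟩ := hF.exists_bound (b := b) ha
  obtain ⟨C', hC', h'⟩ := pow_mul_gaussianDensity_le d k ha hab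
  refine ⟨C * C', by positivity, fun τ hτ w => (h τ hτ w).trans ?_⟩
  rw [mul_assoc, mul_assoc]
  exact mul_le_mul_of_nonneg_left (h' τ hτ w) hC

theorem gaussianDensity_le (d : ℕ) {v : ℝ} (hv : 0 < v) (z : Space d) :
    gaussianDensity d v z ≤ (2 * Real.pi * v) ^ (-(d : ℝ) / 2) := by
  unfold gaussianDensity
  refine mul_le_of_le_one_right (by positivity) (Real.exp_le_one_iff.2 ?_)
  rw [neg_div]; simp only [Left.neg_nonpos_iff]; positivity

theorem IsKernel.exists_const_bound {F : ℝ × Space d → ℝ} (hF : IsKernel d F) {a b : ℝ}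
    (ha : 0 < a) (hab : a ≤ b) :
    ∃ C : ℝ, 0 ≤ C ∧ ∀ τ ∈ Icc a b, ∀ w, |F (τ, w)| ≤ C := by
  obtain ⟨C, hC, h⟩ := hF.exists_gaussian_bound ha hab
  have hb : 0 < 2 * b := by linarith
  exact ⟨C * (2 * Real.pi * (2 * b)) ^ (-(d : ℝ) / 2), by positivity, fun τ hτ w =>
    (h τ hτ w).trans (mul_le_mul_of_nonneg_left (gaussianDensity_le d hb w) hC)⟩

theorem IsKernel.exists_fderiv_bound {F : ℝ × Space d → ℝ} (hF : IsKernel d F) {a b : ℝ}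
    (ha : 0 < a) (hab : a ≤ b) :
    ∃ C : ℝ, 0 ≤ C ∧ ∀ τ ∈ Icc a b, ∀ w, ‖_root_.fderiv ℝ F (τ, w)‖ ≤ C := by
  let B := Module.finBasis ℝ (ℝ × Space d)
  obtain ⟨K, hK, hB⟩ := B.exists_opNorm_le (F := ℝ)
  choose C hC h using fun i => (hF.fderiv (B i)).exists_const_bound ha hab
  refine ⟨K * ∑ i, C i, mul_nonneg hK.le (Finset.sum_nonneg fun i _ => hC i), fun τ hτ w => ?_⟩
  refine hB (Finset.sum_nonneg fun i _ => hC i) fun i => ?_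
  exact (h i τ hτ w).trans (Finset.single_le_sum (f := C) (fun i _ => hC i) (Finset.mem_univ i))

/-- The integral of the weight `φ` against a space-time kernel. -/
noncomputable def kernelIntegral (P : Measure (Space d)) (φ : Space d → ℝ)
    (F : ℝ × Space d → ℝ) (p : ℝ × Space d) : ℝ :=
  ∫ y, φ y * F (p.1, p.2 - y) ∂P

theorem IsKernel.integrable_mul {F : ℝ × Space d → ℝ} (hF : IsKernel d F) {P : Measure (Space d)}
    {φ : Space d → ℝ} (hφ : Integrable φ P) {τ : ℝ} (hτ : 0 < τ) (z : Space d) :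
    Integrable (fun y => φ y * F (τ, z - y)) P := by
  obtain ⟨C, hC, h⟩ := hF.exists_const_bound hτ le_rfl
  exact hφ.mul_bdd (c := C)
    ((hF.continuous_slice hτ).comp (by fun_prop : Continuous fun y => z - y)).aestronglyMeasurable
    (.of_forall fun y => h τ ⟨le_rfl, le_rfl⟩ _)

theorem hasFDerivAt_kernelIntegral {F : ℝ × Space d → ℝ} (hF : IsKernel d F)
    {P : Measure (Space d)} {φ : Space d → ℝ} (hφ : Integrable φ P) {p : ℝ × Space d}
    (hp : 0 < p.1) :
    HasFDerivAt (kernelIntegral P φ F) (∫ y, φ y • fderiv ℝ F (p.1, p.2 - y) ∂P) p := by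
  have ha : 0 < p.1 / 2 := by positivity
  obtain ⟨C, hC, h⟩ := hF.exists_fderiv_bound (b := 2 * p.1) ha (by linarith)
  have hs : {q : ℝ × Space d | q.1 ∈ Ioo (p.1 / 2) (2 * p.1)} ∈ 𝓝 p :=
    continuous_fst.continuousAt.preimage_mem_nhds (Ioo_mem_nhds (by linarith) (by linarith))
  have hpos : ∀ᶠ q : ℝ × Space d in 𝓝 p, 0 < q.1 :=
    continuous_fst.continuousAt.eventually (lt_mem_nhds hp)
  refine hasFDerivAt_integral_of_dominated_of_fderiv_le (bound := fun y => ‖φ y‖ * C)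
    (F' := fun q y => φ y • fderiv ℝ F (q.1, q.2 - y)) hs
    (hpos.mono fun q hq => (hF.integrable_mul hφ hq q.2).aestronglyMeasurable)
    (hF.integrable_mul hφ hp p.2) ?_ ?_ (hφ.norm.mul_const C) ?_
  · refine hφ.aestronglyMeasurable.smul (Measurable.aestronglyMeasurable ?_)
    exact (measurable_fderiv ℝ F).comp (by fun_prop)
  · refine .of_forall fun y q hq => ?_
    rw [norm_smul]
    exact mul_le_mul_of_nonneg_left (h q.1 ⟨hq.1.le, hq.2.le⟩ _) (norm_nonneg _)
  · refine .of_forall fun y q hq => ?_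
    have hq0 : 0 < q.1 := ha.trans hq.1
    have h1 : HasFDerivAt (fun q : ℝ × Space d => (q.1, q.2 - y))
        (ContinuousLinearMap.id ℝ (ℝ × Space d)) q := by
      have := (hasFDerivAt_id (𝕜 := ℝ) q).sub_const ((0 : ℝ), y)
      simpa [Prod.mk_sub_mk, Prod.sub_def] using! this
    have h2 := (hF.differentiableAt (p := (q.1, q.2 - y)) hq0).hasFDerivAt.comp q h1
    simpa using! h2.const_mul (φ y)

theorem fderiv_kernelIntegral {F : ℝ × Space d → ℝ} (hF : IsKernel d F)
    {P : Measure (Space d)} {φ : Space d → ℝ} (hφ : Integrable φ P) {p : ℝ × Space d}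
    (hp : 0 < p.1) (v : ℝ × Space d) :
    fderiv ℝ (kernelIntegral P φ F) p v = kernelIntegral P φ (fun q => fderiv ℝ F q v) p := by
  rw [(hasFDerivAt_kernelIntegral hF hφ hp).fderiv, ContinuousLinearMap.integral_apply, kernelIntegral]
  · simp
  · obtain ⟨C, hC, h⟩ := hF.exists_fderiv_bound hp le_rfl
    refine (hφ.norm.mul_const C).mono' (hφ.aestronglyMeasurable.smul
      (Measurable.aestronglyMeasurable ((measurable_fderiv ℝ F).comp (by fun_prop))))
      (.of_forall fun y => ?_)
    rw [norm_smul]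
    exact mul_le_mul_of_nonneg_left (h p.1 ⟨le_rfl, le_rfl⟩ _) (norm_nonneg _)

theorem isOpen_pos_time : IsOpen {p : ℝ × Space d | 0 < p.1} :=
  isOpen_lt continuous_const continuous_fst

theorem contDiffOn_kernelIntegral {F : ℝ × Space d → ℝ} (hF : IsKernel d F)
    {P : Measure (Space d)} {φ : Space d → ℝ} (hφ : Integrable φ P) :
    ContDiffOn ℝ (⊤ : ℕ∞) (kernelIntegral P φ F) {p | 0 < p.1} := by
  rw [contDiffOn_infty]
  intro n
  induction n generalizing F with
  | zero =>
    rw [Nat.cast_zero, contDiffOn_zero]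
    exact fun p hp => (hasFDerivAt_kernelIntegral hF hφ hp).continuousAt.continuousWithinAt
  | succ n ih =>
    rw [Nat.cast_succ, contDiffOn_succ_iff_fderiv_of_isOpen isOpen_pos_time]
    refine ⟨fun p hp =>
      (hasFDerivAt_kernelIntegral hF hφ hp).differentiableAt.differentiableWithinAt, by simp, ?_⟩
    rw [contDiffOn_clm_apply]
    exact fun v => (ih (hF.fderiv v)).congr fun p hp => fderiv_kernelIntegral hF hφ hp v

end CMError

namespace CMError
open Set Filter Topology
variable {d : ℕ}

/-- The density of `P * N(0, τ I)` as a function of time `τ` and space. -/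
noncomputable def heatDensity (P : Measure (Space d)) : ℝ × Space d → ℝ :=
  kernelIntegral P (fun _ => 1) fun p => gaussianDensity d p.1 p.2

/-- The law `P * N(0, τ I)`, given by its density. -/
noncomputable def heatLaw (P : Measure (Space d)) (τ : ℝ) : Measure (Space d) :=
  volume.withDensity fun z => ENNReal.ofReal (heatDensity P (τ, z))

/-- The heat time `e^{2t} - 1` of the Ornstein-Uhlenbeck time `t`. -/
noncomputable def heatTime (t : ℝ) : ℝ := Real.exp (2 * t) - 1

theorem heatTime_pos {t : ℝ} (ht : 0 < t) : 0 < heatTime t := by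
  have : 1 < Real.exp (2 * t) := Real.one_lt_exp_iff.2 (by linarith)
  unfold heatTime; linarith

theorem gaussianDensity_scale (d : ℕ) {c : ℝ} (hc : 0 < c) {v : ℝ} (hv : 0 < v) (w : Space d) :
    gaussianDensity d ((c ^ 2)⁻¹ * v) (c⁻¹ • w) = c ^ d * gaussianDensity d v w := by
  unfold gaussianDensity
  have h1 : (2 * Real.pi * ((c ^ 2)⁻¹ * v)) ^ (-(d : ℝ) / 2) =
      c ^ d * (2 * Real.pi * v) ^ (-(d : ℝ) / 2) := by
    rw [show 2 * Real.pi * ((c ^ 2)⁻¹ * v) = (c ^ 2)⁻¹ * (2 * Real.pi * v) by ring,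
      Real.mul_rpow (by positivity) (by positivity)]
    congr 1
    rw [← Real.rpow_natCast c 2, ← Real.rpow_neg hc.le, ← Real.rpow_mul hc.le, ← Real.rpow_natCast]
    congr 1
    push_cast
    ring
  rw [h1, mul_assoc]
  congr 3
  rw [norm_smul, mul_pow, Real.norm_eq_abs, sq_abs]
  field_simp

theorem ouDensity_eq (P : Measure (Space d)) {t : ℝ} (ht : 0 < t) (x : Space d) :
    ouDensity P t x = Real.exp t ^ d * heatDensity P (heatTime t, Real.exp t • x) := by
  rw [ouDensity, heatDensity, kernelIntegral, ← integral_const_mul]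
  congr 1
  ext y
  rw [one_mul, ← gaussianDensity_scale d (Real.exp_pos t) (heatTime_pos ht)]
  congr 1
  · rw [heatTime, ← Real.exp_nat_mul, ← Real.exp_neg, mul_sub, ← Real.exp_add]
    simp [neg_mul]
  · rw [smul_sub, smul_smul, Real.exp_neg, inv_mul_cancel₀ (Real.exp_pos t).ne', one_smul]

theorem integrable_one (P : Measure (Space d)) [IsFiniteMeasure P] :
    Integrable (fun _ : Space d => (1 : ℝ)) P := integrable_const 1

theorem contDiffOn_heatDensity (P : Measure (Space d)) [IsFiniteMeasure P] :
    ContDiffOn ℝ (⊤ : ℕ∞) (heatDensity P) {p | 0 < p.1} :=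
  contDiffOn_kernelIntegral .gauss (integrable_one P)

theorem heatDensity_pos (P : Measure (Space d)) [IsProbabilityMeasure P] {p : ℝ × Space d}
    (hp : 0 < p.1) : 0 < heatDensity P p := by
  rw [heatDensity, kernelIntegral]
  refine (integral_pos_iff_support_of_nonneg (fun y => ?_)
    (IsKernel.gauss.integrable_mul (integrable_one P) hp p.2)).2 ?_
  · simpa using gaussianDensity_nonneg d hp _
  · have : Function.support (fun y : Space d => 1 * gaussianDensity d p.1 (p.2 - y)) = univ := by
      ext y
      simpa using (gaussianDensity_pos d hp _).ne'
    rw [this]; simp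

theorem continuous_slice_of_continuousOn {f : ℝ × Space d → ℝ}
    (hf : ContinuousOn f {p | 0 < p.1}) {τ : ℝ} (hτ : 0 < τ) : Continuous fun z => f (τ, z) :=
  continuous_iff_continuousAt.2 fun z =>
    (hf.continuousAt (isOpen_pos_time.mem_nhds (x := (τ, z)) hτ)).comp (by fun_prop)

theorem continuous_heatDensity_slice (P : Measure (Space d)) [IsFiniteMeasure P] {τ : ℝ}
    (hτ : 0 < τ) : Continuous fun z => heatDensity P (τ, z) :=
  continuous_slice_of_continuousOn (contDiffOn_heatDensity P).continuousOn hτ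

theorem map_smul_ouLaw (P : Measure (Space d)) [IsProbabilityMeasure P] {t : ℝ} (ht : 0 < t) :
    (ouLaw P t).map (fun x => Real.exp t • x) = heatLaw P (heatTime t) := by
  have hm : Measurable fun z => heatDensity P (heatTime t, z) :=
    (continuous_heatDensity_slice P (heatTime_pos ht)).measurable
  have hm' : Measurable fun x => heatDensity P (heatTime t, Real.exp t • x) :=
    hm.comp (measurable_const_smul _)
  refine Measure.ext_of_lintegral _ fun f hf => ?_
  rw [lintegral_map hf (by fun_prop), ouLaw_eq_withDensity P ht, heatLaw]
  simp_rw [ouDensity_eq P ht]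
  rw [lintegral_withDensity_eq_lintegral_mul _ (hm'.const_mul _).ennreal_ofReal (by fun_prop),
    lintegral_withDensity_eq_lintegral_mul _ (by fun_prop) hf]
  have h1 := Measure.map_addHaar_smul (volume : Measure (Space d)) (Real.exp_pos t).ne'
  have h2 : ∫⁻ x, ENNReal.ofReal (heatDensity P (heatTime t, Real.exp t • x)) * f (Real.exp t • x)
      = ENNReal.ofReal |(Real.exp t ^ d)⁻¹| *
        ∫⁻ z, ENNReal.ofReal (heatDensity P (heatTime t, z)) * f z := by
    rw [← lintegral_map (f := fun z => ENNReal.ofReal (heatDensity P (heatTime t, z)) * f z)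
      (g := fun x => Real.exp t • x) (by fun_prop) (by fun_prop), h1, lintegral_smul_measure]
    simp
  simp only [Pi.mul_apply]
  have h3 : ∀ x, ENNReal.ofReal (Real.exp t ^ d * heatDensity P (heatTime t, Real.exp t • x)) *
      f (Real.exp t • x) = ENNReal.ofReal (Real.exp t ^ d) *
        (ENNReal.ofReal (heatDensity P (heatTime t, Real.exp t • x)) * f (Real.exp t • x)) := by
    intro x
    rw [ENNReal.ofReal_mul (by positivity), mul_assoc]
  simp_rw [h3]
  rw [lintegral_const_mul' _ _ (by simp), h2, ← mul_assoc, ← ENNReal.ofReal_mul (by positivity),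
    abs_of_pos (by positivity), mul_inv_cancel₀ (by positivity)]
  simp

instance isProbabilityMeasure_ouLaw (P : Measure (Space d)) [IsProbabilityMeasure P] (t : ℝ) :
    IsProbabilityMeasure (ouLaw P t) := by
  unfold ouLaw
  have h1 := Measure.isProbabilityMeasure_map (μ := P) (f := fun x => Real.exp (-t) • x)
    (by fun_prop)
  have h2 := Measure.isProbabilityMeasure_map (μ := stdGaussian (Space d))
    (f := fun x => √(1 - Real.exp (-2 * t)) • x) (by fun_prop)
  infer_instance

theorem isProbabilityMeasure_heatLaw (P : Measure (Space d)) [IsProbabilityMeasure P] {τ : ℝ}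
    (hτ : 0 < τ) : IsProbabilityMeasure (heatLaw P τ) := by
  have h1 : heatTime (Real.log (1 + τ) / 2) = τ := by
    rw [heatTime, mul_div_cancel₀ _ two_ne_zero, Real.exp_log (by linarith)]; ring
  have h2 : 0 < Real.log (1 + τ) / 2 := by
    have := Real.log_pos (show 1 < 1 + τ by linarith)
    linarith
  have h3 := map_smul_ouLaw P h2
  rw [h1] at h3
  rw [← h3]
  exact Measure.isProbabilityMeasure_map (by fun_prop)

theorem integrable_heatDensity (P : Measure (Space d)) [IsProbabilityMeasure P] {τ : ℝ}
    (hτ : 0 < τ) : Integrable fun z => heatDensity P (τ, z) := by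
  refine ⟨(continuous_heatDensity_slice P hτ).aestronglyMeasurable, ?_⟩
  have h := isProbabilityMeasure_heatLaw P hτ
  have h1 := h.measure_univ
  rw [heatLaw, withDensity_apply _ MeasurableSet.univ, Measure.restrict_univ] at h1
  rw [hasFiniteIntegral_iff_ofReal (.of_forall fun z => (heatDensity_pos P hτ).le), h1]
  exact ENNReal.one_lt_top

theorem integrable_heatLaw_iff (P : Measure (Space d)) [IsProbabilityMeasure P] {τ : ℝ}
    (hτ : 0 < τ) {f : Space d → ℝ} :
    Integrable f (heatLaw P τ) ↔ Integrable fun z => heatDensity P (τ, z) * f z := by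
  rw [heatLaw, integrable_withDensity_iff_integrable_smul₀'
    (continuous_heatDensity_slice P hτ).measurable.ennreal_ofReal.aemeasurable (by simp)]
  simp_rw [ENNReal.toReal_ofReal (heatDensity_pos P (p := (τ, _)) hτ).le, smul_eq_mul]

theorem integral_heatLaw (P : Measure (Space d)) [IsProbabilityMeasure P] {τ : ℝ}
    (hτ : 0 < τ) (f : Space d → ℝ) :
    ∫ z, f z ∂(heatLaw P τ) = ∫ z, heatDensity P (τ, z) * f z := by
  rw [heatLaw, integral_withDensity_eq_integral_toReal_smul₀
    (continuous_heatDensity_slice P hτ).measurable.ennreal_ofReal.aemeasurable (by simp)]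
  simp_rw [ENNReal.toReal_ofReal (heatDensity_pos P (p := (τ, _)) hτ).le, smul_eq_mul]

theorem jensen_weighted_pow {α : Type*} [MeasurableSpace α] {P : Measure α} {g m : α → ℝ} (n : ℕ)
    (hg : ∀ y, 0 ≤ g y) (hm : ∀ y, 0 ≤ m y) (hgi : Integrable g P) (hpos : 0 < ∫ y, g y ∂P)
    (h1 : Integrable (fun y => m y * g y) P) (hn : Integrable (fun y => m y ^ n * g y) P) :
    ((∫ y, m y * g y ∂P) / ∫ y, g y ∂P) ^ n * ∫ y, g y ∂P ≤ ∫ y, m y ^ n * g y ∂P := by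
  set b := (∫ y, m y * g y ∂P) / ∫ y, g y ∂P with hb
  have hb0 : 0 ≤ b := div_nonneg (integral_nonneg fun y => mul_nonneg (hm y) (hg y)) hpos.le
  have hbm : ∫ y, m y * g y ∂P = b * ∫ y, g y ∂P := by rw [hb]; field_simp
  rcases hb0.eq_or_lt with h0 | h0
  · rcases n with _ | n
    · simp
    · rw [← h0]
      simpa using integral_nonneg fun y => mul_nonneg (pow_nonneg (hm y) _) (hg y)
  have key : ∀ y, (b ^ n * (1 - n)) * g y + (n * b ^ n / b) * (m y * g y) ≤ m y ^ n * g y := by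
    intro y
    have h2 := one_add_mul_le_pow (a := m y / b - 1)
      (by have := div_nonneg (hm y) hb0; linarith) n
    rw [add_sub_cancel, div_pow, le_div_iff₀ (by positivity)] at h2
    have := mul_le_mul_of_nonneg_right h2 (hg y)
    refine le_trans (le_of_eq ?_) this
    field_simp
    ring
  have := integral_mono ((hgi.const_mul _).add (h1.const_mul _)) hn key
  simp only [Pi.add_apply] at this
  rw [integral_add (hgi.const_mul _) (h1.const_mul _), integral_const_mul, integral_const_mul,
    hbm] at this
  refine le_trans (le_of_eq ?_) this
  field_simp
  ring

theorem memLp_kernelIntegral_div (P : Measure (Space d)) [IsProbabilityMeasure P]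
    {F : ℝ × Space d → ℝ} (hF : IsKernel d F) {τ : ℝ} (hτ : 0 < τ) (n : ℕ) :
    MemLp (fun z => kernelIntegral P (fun _ => 1) F (τ, z) / heatDensity P (τ, z)) n
      (heatLaw P τ) := by
  have hcont : Continuous fun z =>
      kernelIntegral P (fun _ => 1) F (τ, z) / heatDensity P (τ, z) :=
    (continuous_slice_of_continuousOn
      (contDiffOn_kernelIntegral hF (integrable_one P)).continuousOn hτ).div
      (continuous_heatDensity_slice P hτ) fun z => (heatDensity_pos P hτ).ne'
  rcases Nat.eq_zero_or_pos n with rfl | hn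
  · simpa using hcont.aestronglyMeasurable
  obtain ⟨C, k, hC, hb⟩ := hF.exists_bound (b := τ) hτ
  obtain ⟨C', hC', hb'⟩ := pow_mul_gaussianDensity_le d (k * n) hτ le_rfl
  obtain ⟨C₁, hC₁, hb₁⟩ := pow_mul_gaussianDensity_le d k hτ le_rfl
  have hτm : τ ∈ Icc τ τ := ⟨le_rfl, le_rfl⟩
  have h2τ : 0 < 2 * τ := by linarith
  rw [← integrable_norm_rpow_iff hcont.aestronglyMeasurable (by simpa using hn.ne') (by simp)]
  simp only [ENNReal.toReal_natCast, Real.rpow_natCast]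
  rw [integrable_heatLaw_iff P hτ]
  refine ((integrable_heatDensity P h2τ).const_mul (C ^ n * C')).mono' ?_ (.of_forall fun z => ?_)
  · exact ((continuous_heatDensity_slice P hτ).mul (hcont.norm.pow n)).aestronglyMeasurable
  have hU := heatDensity_pos P (p := (τ, z)) hτ
  rw [Real.norm_of_nonneg (by positivity)]
  have hgi : ∀ {v : ℝ}, 0 < v → Integrable (fun y => gaussianDensity d v (z - y)) P := fun hv => by
    simpa using IsKernel.gauss.integrable_mul (integrable_one P) hv z
  have hdom : ∀ (m : ℕ) (D : ℝ), 0 ≤ D →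
      (∀ t ∈ Icc τ τ, ∀ w : Space d,
        (1 + ‖w‖) ^ m * gaussianDensity d t w ≤ D * gaussianDensity d (2 * τ) w) →
      Integrable (fun y => (1 + ‖z - y‖) ^ m * gaussianDensity d τ (z - y)) P := by
    intro m D hD h
    refine ((hgi h2τ).const_mul D).mono' ?_ (.of_forall fun y => ?_)
    · have := continuous_gaussianDensity d τ
      exact Continuous.aestronglyMeasurable (by fun_prop)
    · rw [Real.norm_of_nonneg (mul_nonneg (by positivity) (gaussianDensity_nonneg d hτ _))]
      exact h τ hτm _
  have hUe : heatDensity P (τ, z) = ∫ y, gaussianDensity d τ (z - y) ∂P := by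
    simp [heatDensity, kernelIntegral]
  have hm1 : Integrable (fun y => (C * (1 + ‖z - y‖) ^ k) * gaussianDensity d τ (z - y)) P := by
    simpa [mul_assoc] using (hdom k C₁ hC₁ hb₁).const_mul C
  have hmn : ∀ y, (C * (1 + ‖z - y‖) ^ k) ^ n * gaussianDensity d τ (z - y) =
      C ^ n * ((1 + ‖z - y‖) ^ (k * n) * gaussianDensity d τ (z - y)) := fun y => by
    rw [mul_pow, ← pow_mul, mul_assoc]
  have hmn' : Integrable (fun y => (C * (1 + ‖z - y‖) ^ k) ^ n * gaussianDensity d τ (z - y)) P := by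
    simp_rw [hmn]
    exact (hdom (k * n) C' hC' hb').const_mul _
  have hJ := jensen_weighted_pow (P := P) n (fun y => gaussianDensity_nonneg d hτ (z - y))
    (fun y => by positivity) (hgi hτ) (by rw [← hUe]; exact hU) hm1 hmn'
  rw [← hUe] at hJ
  have hnum : ‖kernelIntegral P (fun _ => 1) F (τ, z) / heatDensity P (τ, z)‖ ≤
      (∫ y, (C * (1 + ‖z - y‖) ^ k) * gaussianDensity d τ (z - y) ∂P) / heatDensity P (τ, z) := by
    rw [norm_div, Real.norm_of_nonneg hU.le]
    gcongr
    rw [kernelIntegral]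
    refine norm_integral_le_of_norm_le hm1 (.of_forall fun y => ?_)
    simpa using hb τ hτm (z - y)
  calc _ ≤ heatDensity P (τ, z) * ((∫ y, (C * (1 + ‖z - y‖) ^ k) * gaussianDensity d τ (z - y) ∂P)
        / heatDensity P (τ, z)) ^ n := by gcongr
    _ ≤ ∫ y, (C * (1 + ‖z - y‖) ^ k) ^ n * gaussianDensity d τ (z - y) ∂P := by linarith
    _ ≤ ∫ y, C ^ n * C' * gaussianDensity d (2 * τ) (z - y) ∂P := by
      refine integral_mono hmn' ((hgi h2τ).const_mul _) fun y => ?_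
      simp only [hmn, mul_assoc]
      exact mul_le_mul_of_nonneg_left (hb' τ hτm _) (by positivity)
    _ = _ := by simp [heatDensity, kernelIntegral, integral_const_mul]

/-- The algebra generated by the ratios of a kernel integral and the heat density. -/
inductive IsRatio (P : Measure (Space d)) : (ℝ × Space d → ℝ) → Prop
  | base {F : ℝ × Space d → ℝ} : IsKernel d F →
      IsRatio P fun p => kernelIntegral P (fun _ => 1) F p / heatDensity P p
  | const_mul (c : ℝ) {f : ℝ × Space d → ℝ} : IsRatio P f → IsRatio P fun p => c * f p
  | add {f g : ℝ × Space d → ℝ} : IsRatio P f → IsRatio P g → IsRatio P fun p => f p + g p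
  | mul {f g : ℝ × Space d → ℝ} : IsRatio P f → IsRatio P g → IsRatio P fun p => f p * g p
  | congr {f g : ℝ × Space d → ℝ} : IsRatio P f → (∀ p, 0 < p.1 → g p = f p) → IsRatio P g

variable {P : Measure (Space d)} {f : ℝ × Space d → ℝ}

theorem IsRatio.sum {ι : Type*} (s : Finset ι) {F : ι → ℝ × Space d → ℝ}
    (h : ∀ i ∈ s, IsRatio P (F i)) : IsRatio P fun p => ∑ i ∈ s, F i p := by
  classical
  induction s using Finset.induction_on with
  | empty => exact ((IsRatio.base (P := P) IsKernel.gauss).const_mul 0).congr fun p _ => by simp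
  | insert a s ha ih =>
    simp_rw [Finset.sum_insert ha]
    exact (h a (by simp)).add (ih fun i hi => h i (by simp [hi]))

variable [IsProbabilityMeasure P]

theorem differentiableAt_heatDensity {p : ℝ × Space d} (hp : 0 < p.1) :
    DifferentiableAt ℝ (heatDensity P) p :=
  (hasFDerivAt_kernelIntegral .gauss (integrable_one P) hp).differentiableAt

theorem fderiv_heatDensity {p : ℝ × Space d} (hp : 0 < p.1) (v : ℝ × Space d) :
    fderiv ℝ (heatDensity P) p v = kernelIntegral P (fun _ => 1)
      (fun q => fderiv ℝ (fun p : ℝ × Space d => gaussianDensity d p.1 p.2) q v) p :=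
  fderiv_kernelIntegral .gauss (integrable_one P) hp v

theorem IsRatio.contDiffOn (hf : IsRatio P f) : ContDiffOn ℝ (⊤ : ℕ∞) f {p | 0 < p.1} := by
  induction hf with
  | base hF =>
    exact (contDiffOn_kernelIntegral hF (integrable_one P)).div (contDiffOn_heatDensity P)
      fun p hp => (heatDensity_pos P hp).ne'
  | const_mul c _ ih => exact contDiffOn_const.mul ih
  | add _ _ ih ih' => exact ih.add ih'
  | mul _ _ ih ih' => exact ih.mul ih'
  | congr _ h ih => exact ih.congr h

theorem IsRatio.contDiffAt (hf : IsRatio P f) {p : ℝ × Space d} (hp : 0 < p.1) :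
    ContDiffAt ℝ (⊤ : ℕ∞) f p := hf.contDiffOn.contDiffAt (isOpen_pos_time.mem_nhds hp)

theorem IsRatio.differentiableAt (hf : IsRatio P f) {p : ℝ × Space d} (hp : 0 < p.1) :
    DifferentiableAt ℝ f p := (hf.contDiffAt hp).differentiableAt (by simp)

theorem IsRatio.fderiv (hf : IsRatio P f) (v : ℝ × Space d) :
    IsRatio P fun p => fderiv ℝ f p v := by
  induction hf with
  | @base F hF =>
    have hg : IsKernel d fun p => gaussianDensity d p.1 p.2 := .gauss
    refine ((IsRatio.base (hF.fderiv v)).add (((IsRatio.base hF).mul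
      (.base (hg.fderiv v))).const_mul (-1))).congr fun p hp => ?_
    have hU := (heatDensity_pos P hp).ne'
    have h1 := (hasFDerivAt_kernelIntegral hF (integrable_one P) hp).differentiableAt
    have h2 := differentiableAt_heatDensity (P := P) hp
    have h3 := h1.hasFDerivAt.fun_mul ((hasDerivAt_inv hU).comp_hasFDerivAt p h2.hasFDerivAt)
    simp only [div_eq_mul_inv]
    have h4 := h3.fderiv
    simp only [Function.comp_def] at h4
    rw [h4]
    simp only [add_apply, smul_apply, smul_eq_mul, fderiv_kernelIntegral hF (integrable_one P) hp,
      fderiv_heatDensity hp]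
    field_simp
    ring
  | const_mul c h ih =>
    refine (ih.const_mul c).congr fun p hp => ?_
    rw [((h.differentiableAt hp).hasFDerivAt.const_mul c).fderiv]
    simp
  | add h h' ih ih' =>
    refine (ih.add ih').congr fun p hp => ?_
    rw [((h.differentiableAt hp).hasFDerivAt.fun_add (h'.differentiableAt hp).hasFDerivAt).fderiv]
    simp
  | mul h h' ih ih' =>
    refine ((h.mul ih').add (ih.mul h')).congr fun p hp => ?_
    rw [((h.differentiableAt hp).hasFDerivAt.fun_mul (h'.differentiableAt hp).hasFDerivAt).fderiv]
    simp
    ring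
  | @congr f g h he ih =>
    refine ih.congr fun p hp => ?_
    have : g =ᶠ[𝓝 p] f := by
      filter_upwards [isOpen_pos_time.mem_nhds hp] with q hq using he q hq
    rw [this.fderiv_eq]

theorem IsRatio.continuous_slice (hf : IsRatio P f) {τ : ℝ} (hτ : 0 < τ) :
    Continuous fun z => f (τ, z) :=
  continuous_slice_of_continuousOn hf.contDiffOn.continuousOn hτ

theorem IsRatio.memLp (hf : IsRatio P f) {τ : ℝ} (hτ : 0 < τ) (n : ℕ) :
    MemLp (fun z => f (τ, z)) n (heatLaw P τ) := by
  induction hf generalizing n with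
  | base hF => exact memLp_kernelIntegral_div P hF hτ n
  | const_mul c _ ih => exact (ih n).const_mul c
  | add _ _ ih ih' => exact (ih n).add (ih' n)
  | mul _ _ ih ih' =>
    have : ENNReal.HolderTriple ((2 * n : ℕ) : ℝ≥0∞) ((2 * n : ℕ) : ℝ≥0∞) (n : ℝ≥0∞) := by
      constructor
      push_cast
      rw [ENNReal.mul_inv (by simp) (by simp), ← add_mul, ENNReal.inv_two_add_inv_two, one_mul]
    exact (ih' (2 * n)).mul (ih (2 * n))
  | congr _ h ih =>
    simpa only [h (τ, _) hτ] using ih n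

theorem IsRatio.integrable (hf : IsRatio P f) {τ : ℝ} (hτ : 0 < τ) :
    Integrable (fun z => f (τ, z)) (heatLaw P τ) := by
  simpa [memLp_one_iff_integrable] using hf.memLp hτ 1

theorem fderiv_log_heatDensity {p : ℝ × Space d} (hp : 0 < p.1) (v : ℝ × Space d) :
    _root_.fderiv ℝ (fun q => Real.log (heatDensity P q)) p v =
      kernelIntegral P (fun _ => 1)
        (fun q => _root_.fderiv ℝ (fun p : ℝ × Space d => gaussianDensity d p.1 p.2) q v) p
        / heatDensity P p := by
  rw [((differentiableAt_heatDensity hp).hasFDerivAt.log (heatDensity_pos P hp).ne').fderiv,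
    smul_apply, fderiv_heatDensity hp, smul_eq_mul, inv_mul_eq_div]

theorem isRatio_fderiv_log (v : ℝ × Space d) :
    IsRatio P fun p => _root_.fderiv ℝ (fun q => Real.log (heatDensity P q)) p v :=
  (IsRatio.base ((IsKernel.gauss (d := d)).fderiv v)).congr fun _ hp => fderiv_log_heatDensity hp v

end CMError

namespace CMError
open Set Filter Topology
variable {d : ℕ}

/-- The partial derivative in the `i`-th space direction of a function on space-time. -/
noncomputable def spaceDeriv (i : Fin d) (f : ℝ × Space d → ℝ) (p : ℝ × Space d) : ℝ :=
  fderiv ℝ f p (0, EuclideanSpace.single i 1)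

/-- The components of the score of the heat density. -/
noncomputable def heatScoreComp (P : Measure (Space d)) (i : Fin d) : ℝ × Space d → ℝ :=
  spaceDeriv i fun q => Real.log (heatDensity P q)

/-- The score `∇ log U` of the heat density `U`. -/
noncomputable def heatScore (P : Measure (Space d)) (p : ℝ × Space d) : Space d :=
  WithLp.toLp 2 fun i => heatScoreComp P i p

/-- The ratio `ΔU / U`, expressed in terms of the score of `U`. -/
noncomputable def heatRatio (P : Measure (Space d)) (p : ℝ × Space d) : ℝ :=
  ∑ i, (spaceDeriv i (heatScoreComp P i) p + heatScoreComp P i p * heatScoreComp P i p)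

theorem fderiv_slice {F : Type*} [NormedAddCommGroup F] [NormedSpace ℝ F] {f : ℝ × Space d → F}
    {τ : ℝ} {z : Space d} (hf : DifferentiableAt ℝ f (τ, z)) :
    HasFDerivAt (fun w => f (τ, w))
      ((fderiv ℝ f (τ, z)).comp (ContinuousLinearMap.inr ℝ ℝ (Space d))) z :=
  hf.hasFDerivAt.comp z (hasFDerivAt_prodMk_right τ z)

theorem fderiv_fderiv_comm {f : ℝ × Space d → ℝ} {p : ℝ × Space d}
    (hf : ContDiffAt ℝ 2 f p) (v w : ℝ × Space d) :
    fderiv ℝ (fun q => fderiv ℝ f q v) p w = fderiv ℝ (fun q => fderiv ℝ f q w) p v := by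
  have hd : DifferentiableAt ℝ (fderiv ℝ f) p :=
    (hf.fderiv_right (m := 1) le_rfl).differentiableAt one_ne_zero
  rw [fderiv_clm_apply hd (differentiableAt_const v), fderiv_clm_apply hd (differentiableAt_const w)]
  simpa using (hf.isSymmSndFDerivAt (by simp)).eq w v

theorem norm_sq_heatScore (P : Measure (Space d)) (p : ℝ × Space d) :
    ‖heatScore P p‖ ^ 2 = ∑ i, heatScoreComp P i p * heatScoreComp P i p := norm_sq_eq_sum _

variable {P : Measure (Space d)} [IsProbabilityMeasure P] {f g : ℝ × Space d → ℝ}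

theorem IsRatio.spaceDeriv (hf : IsRatio P f) (i : Fin d) : IsRatio P (spaceDeriv i f) :=
  hf.fderiv _

theorem isRatio_heatScoreComp (i : Fin d) : IsRatio P (heatScoreComp P i) := isRatio_fderiv_log _

theorem isRatio_heatRatio : IsRatio P (heatRatio P) :=
  IsRatio.sum _ fun i _ => ((isRatio_heatScoreComp i).spaceDeriv i).add
    ((isRatio_heatScoreComp i).mul (isRatio_heatScoreComp i))

theorem contDiffAt_log_heatDensity {p : ℝ × Space d} (hp : 0 < p.1) :
    ContDiffAt ℝ (⊤ : ℕ∞) (fun q => Real.log (heatDensity P q)) p :=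
  ((contDiffOn_heatDensity P).contDiffAt (isOpen_pos_time.mem_nhds hp)).log (heatDensity_pos P hp).ne'

theorem spaceDeriv_mul (hf : IsRatio P f) (hg : IsRatio P g) {p : ℝ × Space d} (hp : 0 < p.1)
    (i : Fin d) : spaceDeriv i (fun q => f q * g q) p =
      f p * spaceDeriv i g p + spaceDeriv i f p * g p := by
  unfold CMError.spaceDeriv
  rw [((hf.differentiableAt hp).hasFDerivAt.fun_mul (hg.differentiableAt hp).hasFDerivAt).fderiv]
  simp [mul_comm]

theorem spaceDeriv_add (hf : IsRatio P f) (hg : IsRatio P g) {p : ℝ × Space d} (hp : 0 < p.1)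
    (i : Fin d) : spaceDeriv i (fun q => f q + g q) p = spaceDeriv i f p + spaceDeriv i g p := by
  unfold CMError.spaceDeriv
  rw [((hf.differentiableAt hp).hasFDerivAt.fun_add (hg.differentiableAt hp).hasFDerivAt).fderiv]
  simp

theorem spaceDeriv_sum {ι : Type*} (s : Finset ι) {F : ι → ℝ × Space d → ℝ}
    (h : ∀ i ∈ s, IsRatio P (F i)) {p : ℝ × Space d} (hp : 0 < p.1) (i : Fin d) :
    spaceDeriv i (fun q => ∑ j ∈ s, F j q) p = ∑ j ∈ s, spaceDeriv i (F j) p := by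
  unfold CMError.spaceDeriv
  rw [fderiv_fun_sum fun j hj => (h j hj).differentiableAt hp]
  simp

theorem spaceDeriv_comm {f : ℝ × Space d → ℝ} {p : ℝ × Space d} (hf : ContDiffAt ℝ (⊤ : ℕ∞) f p)
    (i j : Fin d) : spaceDeriv i (spaceDeriv j f) p = spaceDeriv j (spaceDeriv i f) p :=
  fderiv_fderiv_comm (mod_cast contDiffAt_infty.1 hf 2) _ _

theorem spaceDeriv_congr {f g : ℝ × Space d → ℝ} (h : ∀ q : ℝ × Space d, 0 < q.1 → f q = g q)
    {p : ℝ × Space d} (hp : 0 < p.1) (i : Fin d) : spaceDeriv i f p = spaceDeriv i g p := by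
  have : f =ᶠ[𝓝 p] g := by
    filter_upwards [isOpen_pos_time.mem_nhds hp] with q hq using h q hq
  rw [CMError.spaceDeriv, this.fderiv_eq, CMError.spaceDeriv]

theorem spaceDeriv_heatDensity {p : ℝ × Space d} (hp : 0 < p.1) (i : Fin d) :
    spaceDeriv i (heatDensity P) p = heatDensity P p * heatScoreComp P i p := by
  have hU := (heatDensity_pos P hp).ne'
  rw [heatScoreComp, CMError.spaceDeriv, CMError.spaceDeriv,
    ((differentiableAt_heatDensity hp).hasFDerivAt.log hU).fderiv]
  simp [hU]

theorem integral_spaceDeriv_add (hf : IsRatio P f) {τ : ℝ} (hτ : 0 < τ) (i : Fin d) :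
    ∫ z, (spaceDeriv i f (τ, z) + f (τ, z) * heatScoreComp P i (τ, z)) ∂(heatLaw P τ) = 0 := by
  have h1 := (hf.spaceDeriv i).integrable hτ
  have h2 := (hf.mul (isRatio_heatScoreComp i)).integrable hτ
  have hU : ∀ z, HasFDerivAt (fun w => heatDensity P (τ, w)) _ z := fun z =>
    fderiv_slice (differentiableAt_heatDensity (P := P) (p := (τ, z)) hτ)
  have hf' : ∀ z, HasFDerivAt (fun w => f (τ, w)) _ z := fun z =>
    fderiv_slice (hf.differentiableAt (p := (τ, z)) hτ)
  have e1 : ∀ z, fderiv ℝ (fun w => heatDensity P (τ, w)) z (EuclideanSpace.single i 1) =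
      heatDensity P (τ, z) * heatScoreComp P i (τ, z) := fun z => by
    rw [(hU z).fderiv, ← spaceDeriv_heatDensity (p := (τ, z)) hτ]; rfl
  have e2 : ∀ z, fderiv ℝ (fun w => f (τ, w)) z (EuclideanSpace.single i 1) =
      spaceDeriv i f (τ, z) := fun z => by
    rw [(hf' z).fderiv]; rfl
  have h1' := (integrable_heatLaw_iff P hτ).1 h1
  have h2' := (integrable_heatLaw_iff P hτ).1 h2
  have key := integral_mul_fderiv_eq_neg_fderiv_mul_of_integrable (μ := volume)
    (f := fun w => heatDensity P (τ, w)) (g := fun w => f (τ, w)) (v := EuclideanSpace.single i 1)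
    (by
      simp_rw [e1]
      refine h2'.congr (.of_forall fun z => ?_)
      dsimp only
      ring)
    (by simpa only [e2] using h1')
    ((integrable_heatLaw_iff P hτ).1 (hf.integrable hτ)) (fun z _ => (hU z).differentiableAt)
    (fun z _ => (hf' z).differentiableAt)
  simp_rw [e1, e2] at key
  rw [integral_add h1 h2, integral_heatLaw P hτ, integral_heatLaw P hτ, key, neg_add_eq_zero]
  congr 1
  ext z
  ring

theorem integral_heatRatio {τ : ℝ} (hτ : 0 < τ) :
    ∫ z, heatRatio P (τ, z) ∂(heatLaw P τ) = 0 := by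
  unfold heatRatio
  rw [integral_finsetSum]
  · exact Finset.sum_eq_zero fun i _ => integral_spaceDeriv_add (isRatio_heatScoreComp i) hτ i
  · exact fun i _ => (((isRatio_heatScoreComp i).spaceDeriv i).add
      ((isRatio_heatScoreComp i).mul (isRatio_heatScoreComp i))).integrable hτ

/-- The entries of the Hessian of the logarithm of the heat density. -/
noncomputable def heatHess (P : Measure (Space d)) (i j : Fin d) : ℝ × Space d → ℝ :=
  spaceDeriv j (heatScoreComp P i)

theorem isRatio_heatHess (i j : Fin d) : IsRatio P (heatHess P i j) :=
  (isRatio_heatScoreComp i).spaceDeriv j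

theorem heatHess_comm {p : ℝ × Space d} (hp : 0 < p.1) (i j : Fin d) :
    heatHess P i j p = heatHess P j i p :=
  spaceDeriv_comm (contDiffAt_log_heatDensity hp) _ _

theorem spaceDeriv_heatRatio {p : ℝ × Space d} (hp : 0 < p.1) (i : Fin d) :
    spaceDeriv i (heatRatio P) p = ∑ j, (spaceDeriv j (heatHess P i j) p
      + 2 * heatHess P i j p * heatScoreComp P j p) := by
  unfold heatRatio
  rw [spaceDeriv_sum _ (fun j _ => ((isRatio_heatScoreComp j).spaceDeriv j).add
    ((isRatio_heatScoreComp j).mul (isRatio_heatScoreComp j))) hp]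
  refine Finset.sum_congr rfl fun j _ => ?_
  have hS := isRatio_heatScoreComp (P := P) j
  rw [spaceDeriv_add (hS.spaceDeriv j) (hS.mul hS) hp, spaceDeriv_mul hS hS hp,
    spaceDeriv_comm (hS.contDiffAt hp)]
  congr 1
  · exact spaceDeriv_congr (fun q hq => heatHess_comm hq j i) hp j
  · rw [← heatHess, heatHess_comm hp j i]
    ring

/-- The Bochner identity for the heat density. -/
theorem integral_heatRatio_sq {τ : ℝ} (hτ : 0 < τ) :
    ∫ z, heatRatio P (τ, z) ^ 2 ∂(heatLaw P τ) =
      ∫ z, ∑ i, ∑ j, (heatHess P i j (τ, z) ^ 2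
        - heatHess P i j (τ, z) * heatScoreComp P i (τ, z) * heatScoreComp P j (τ, z))
        ∂(heatLaw P τ) := by
  have hR := isRatio_heatRatio (P := P)
  have hS := isRatio_heatScoreComp (P := P)
  have hA := isRatio_heatHess (P := P)
  have h1 : ∫ z, ∑ i, (spaceDeriv i (fun q => heatRatio P q * heatScoreComp P i q) (τ, z) +
      heatRatio P (τ, z) * heatScoreComp P i (τ, z) * heatScoreComp P i (τ, z)) ∂(heatLaw P τ) = 0 := by
    rw [integral_finsetSum]
    · exact Finset.sum_eq_zero fun i _ => integral_spaceDeriv_add (hR.mul (hS i)) hτ i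
    · exact fun i _ => (((hR.mul (hS i)).spaceDeriv i).add
        ((hR.mul (hS i)).mul (hS i))).integrable hτ
  have i2 : ∀ i j, Integrable (fun z => spaceDeriv j (fun q => heatHess P i j q *
      heatScoreComp P i q) (τ, z) + heatHess P i j (τ, z) * heatScoreComp P i (τ, z) *
      heatScoreComp P j (τ, z)) (heatLaw P τ) := fun i j =>
    ((((hA i j).mul (hS i)).spaceDeriv j).add (((hA i j).mul (hS i)).mul (hS j))).integrable hτ
  have h2 : ∫ z, ∑ i, ∑ j, (spaceDeriv j (fun q => heatHess P i j q *
      heatScoreComp P i q) (τ, z) + heatHess P i j (τ, z) * heatScoreComp P i (τ, z) *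
      heatScoreComp P j (τ, z)) ∂(heatLaw P τ) = 0 := by
    rw [integral_finsetSum _ fun i _ => integrable_finsetSum _ fun j _ => i2 i j]
    refine Finset.sum_eq_zero fun i _ => ?_
    rw [integral_finsetSum _ fun j _ => i2 i j]
    exact Finset.sum_eq_zero fun j _ => integral_spaceDeriv_add ((hA i j).mul (hS i)) hτ j
  have j1 : Integrable (fun z => ∑ i, (spaceDeriv i (fun q => heatRatio P q * heatScoreComp P i q)
      (τ, z) + heatRatio P (τ, z) * heatScoreComp P i (τ, z) * heatScoreComp P i (τ, z)))
      (heatLaw P τ) := integrable_finsetSum _ fun i _ => (((hR.mul (hS i)).spaceDeriv i).add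
        ((hR.mul (hS i)).mul (hS i))).integrable hτ
  have j2 := integrable_finsetSum Finset.univ fun i _ =>
    integrable_finsetSum Finset.univ fun j _ => i2 i j
  have h3 := (integral_sub j1 j2).symm
  rw [h1, h2, sub_zero] at h3
  have j3 : Integrable (fun z => heatRatio P (τ, z) ^ 2) (heatLaw P τ) := by
    simpa only [sq] using (hR.mul hR).integrable hτ
  have j4 : Integrable (fun z => ∑ i, ∑ j, (heatHess P i j (τ, z) ^ 2
        - heatHess P i j (τ, z) * heatScoreComp P i (τ, z) * heatScoreComp P j (τ, z)))
        (heatLaw P τ) := by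
    refine integrable_finsetSum _ fun i _ => integrable_finsetSum _ fun j _ => ?_
    refine Integrable.sub ?_ ((((hA i j).mul (hS i)).mul (hS j)).integrable hτ)
    simpa only [sq] using ((hA i j).mul (hA i j)).integrable hτ
  rw [← sub_eq_zero, ← integral_sub j3 j4, h3]
  congr 1
  ext z
  have hp : 0 < ((τ, z) : ℝ × Space d).1 := hτ
  have e1 : ∑ i, (spaceDeriv i (fun q => heatRatio P q * heatScoreComp P i q) (τ, z) +
      heatRatio P (τ, z) * heatScoreComp P i (τ, z) * heatScoreComp P i (τ, z)) =
      heatRatio P (τ, z) ^ 2 + ∑ i, spaceDeriv i (heatRatio P) (τ, z) * heatScoreComp P i (τ, z) := by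
    have e0 : heatRatio P (τ, z) ^ 2 = ∑ i, heatRatio P (τ, z) *
        (spaceDeriv i (heatScoreComp P i) (τ, z) +
          heatScoreComp P i (τ, z) * heatScoreComp P i (τ, z)) := by
      rw [sq, ← Finset.mul_sum]; rfl
    rw [e0, ← Finset.sum_add_distrib]
    refine Finset.sum_congr rfl fun i _ => ?_
    rw [spaceDeriv_mul hR (hS i) hp]
    ring
  rw [e1, add_sub_assoc, sub_eq_add_neg (heatRatio P (τ, z) ^ 2)]
  congr 1
  rw [← Finset.sum_neg_distrib, ← Finset.sum_sub_distrib]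
  refine Finset.sum_congr rfl fun i _ => ?_
  rw [spaceDeriv_heatRatio hp, Finset.sum_mul, ← Finset.sum_neg_distrib, ← Finset.sum_sub_distrib]
  refine Finset.sum_congr rfl fun j _ => ?_
  rw [spaceDeriv_mul (hA i j) (hS i) hp, ← heatHess]
  ring

theorem contDiffOn_heatScore : ContDiffOn ℝ (⊤ : ℕ∞) (heatScore P) {p | 0 < p.1} :=
  (contDiffOn_euclidean (𝕜 := ℝ) (f := heatScore P)).2 fun i => (isRatio_heatScoreComp i).contDiffOn

theorem differentiableAt_heatScore {p : ℝ × Space d} (hp : 0 < p.1) :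
    DifferentiableAt ℝ (heatScore P) p :=
  (contDiffOn_heatScore.contDiffAt (isOpen_pos_time.mem_nhds hp)).differentiableAt (by simp)

theorem vector_eq_sum (v : Space d) : v = ∑ j, v j • EuclideanSpace.single j (1 : ℝ) := by
  conv_lhs => rw [← (EuclideanSpace.basisFun (Fin d) ℝ).sum_repr v]
  simp

theorem fderiv_space_eq_sum (f : ℝ × Space d → ℝ) (p : ℝ × Space d) (v : Space d) :
    fderiv ℝ f p (0, v) = ∑ j, v j * spaceDeriv j f p := by
  have : ((0 : ℝ), v) = ∑ j, v j • ((0 : ℝ), EuclideanSpace.single j (1 : ℝ)) := by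
    rw [Prod.ext_iff]
    constructor
    · simp [Prod.fst_sum]
    · simp only [Prod.snd_sum, Prod.smul_snd]
      exact vector_eq_sum v
  rw [this, map_sum]
  simp_rw [map_smul]
  rfl

theorem fderiv_heatScore_apply {p : ℝ × Space d} (hp : 0 < p.1) (w : ℝ × Space d) (i : Fin d) :
    fderiv ℝ (heatScore P) p w i = fderiv ℝ (heatScoreComp P i) p w := by
  have h := (EuclideanSpace.proj (𝕜 := ℝ) i : Space d →L[ℝ] ℝ).hasFDerivAt.comp p
    (differentiableAt_heatScore (P := P) hp).hasFDerivAt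
  have h' : HasFDerivAt (heatScoreComp P i) _ p := h
  rw [h'.fderiv]
  rfl

theorem heatScore_eq_gradient {τ : ℝ} (hτ : 0 < τ) (z : Space d) :
    heatScore P (τ, z) = gradient (fun w => Real.log (heatDensity P (τ, w))) z := by
  have hL : DifferentiableAt ℝ (fun q => Real.log (heatDensity P q)) (τ, z) :=
    (contDiffAt_log_heatDensity (p := (τ, z)) hτ).differentiableAt (by simp)
  refine ext_inner_right ℝ fun v => ?_
  rw [gradient, InnerProductSpace.toDual_symm_apply, (fderiv_slice hL).fderiv,
    ContinuousLinearMap.comp_apply, ContinuousLinearMap.inr_apply, fderiv_space_eq_sum, inner_eq_sum]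
  rfl

/-- The Hessian of the logarithm of the heat density, as a linear map. -/
noncomputable def heatHessMap (P : Measure (Space d)) (p : ℝ × Space d) : Space d →L[ℝ] Space d :=
  (fderiv ℝ (heatScore P) p).comp (ContinuousLinearMap.inr ℝ ℝ (Space d))

theorem hasFDerivAt_heatScore_slice {τ : ℝ} (hτ : 0 < τ) (z : Space d) :
    HasFDerivAt (fun w => heatScore P (τ, w)) (heatHessMap P (τ, z)) z :=
  fderiv_slice (differentiableAt_heatScore (p := (τ, z)) hτ)

theorem heatHessMap_apply {p : ℝ × Space d} (hp : 0 < p.1) (v : Space d) (i : Fin d) :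
    heatHessMap P p v i = ∑ j, v j * heatHess P i j p := by
  rw [heatHessMap, ContinuousLinearMap.comp_apply, ContinuousLinearMap.inr_apply,
    fderiv_heatScore_apply hp, fderiv_space_eq_sum]
  rfl

theorem norm_heatHessMap_le {Λ : ℝ≥0} {τ : ℝ} (hτ : 0 < τ)
    (hL : LipschitzWith Λ fun z => heatScore P (τ, z)) (z : Space d) :
    ‖heatHessMap P (τ, z)‖ ≤ Λ := by
  rw [← (hasFDerivAt_heatScore_slice hτ z).fderiv]
  exact norm_fderiv_le_of_lipschitz ℝ hL

theorem heatHessMap_single {p : ℝ × Space d} (hp : 0 < p.1) (i j : Fin d) :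
    heatHessMap P p (EuclideanSpace.single j 1) i = heatHess P i j p := by
  rw [heatHessMap_apply hp]
  simp

theorem sum_heatHess_sq_le {Λ : ℝ≥0} {τ : ℝ} (hτ : 0 < τ)
    (hL : LipschitzWith Λ fun z => heatScore P (τ, z)) (z : Space d) (j : Fin d) :
    ∑ i, heatHess P i j (τ, z) ^ 2 ≤ Λ ^ 2 := by
  have h1 : ‖heatHessMap P (τ, z) (EuclideanSpace.single j 1)‖ ≤ Λ := by
    have := (heatHessMap P (τ, z)).le_opNorm (EuclideanSpace.single j 1)
    have h2 := norm_heatHessMap_le hτ hL z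
    simp only [PiLp.norm_single, norm_one, mul_one] at this
    exact this.trans h2
  have h3 : ‖heatHessMap P (τ, z) (EuclideanSpace.single j 1)‖ ^ 2 =
      ∑ i, heatHess P i j (τ, z) ^ 2 := by
    rw [norm_sq_eq_sum]
    refine Finset.sum_congr rfl fun i _ => ?_
    rw [heatHessMap_single (p := (τ, z)) hτ, sq]
  rw [← h3]
  gcongr

theorem integrable_norm_heatScore_sq {τ : ℝ} (hτ : 0 < τ) :
    Integrable (fun z => ‖heatScore P (τ, z)‖ ^ 2) (heatLaw P τ) := by
  simp_rw [norm_sq_heatScore]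
  exact integrable_finsetSum _ fun i _ =>
    ((isRatio_heatScoreComp i).mul (isRatio_heatScoreComp i)).integrable hτ

theorem integral_norm_heatScore_sq_le {Λ : ℝ≥0} {τ : ℝ} (hτ : 0 < τ)
    (hL : LipschitzWith Λ fun z => heatScore P (τ, z)) :
    ∫ z, ‖heatScore P (τ, z)‖ ^ 2 ∂(heatLaw P τ) ≤ d * Λ := by
  have := isProbabilityMeasure_heatLaw P hτ
  have h1 := integral_heatRatio (P := P) hτ
  have hi : Integrable (fun z => ∑ i, heatHess P i i (τ, z)) (heatLaw P τ) :=
    integrable_finsetSum _ fun i _ => (isRatio_heatHess i i).integrable hτ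
  have h2 : ∀ z, heatRatio P (τ, z) = ∑ i, heatHess P i i (τ, z) + ‖heatScore P (τ, z)‖ ^ 2 :=
    fun z => by rw [norm_sq_heatScore, ← Finset.sum_add_distrib]; rfl
  simp_rw [h2] at h1
  rw [integral_add hi (integrable_norm_heatScore_sq hτ)] at h1
  have h3 : -∫ z, ∑ i, heatHess P i i (τ, z) ∂(heatLaw P τ) ≤ d * Λ := by
    rw [← integral_neg]
    refine (integral_mono hi.neg (integrable_const ((d : ℝ) * Λ)) fun z => ?_).trans (by simp)
    rw [Pi.neg_apply, ← Finset.sum_neg_distrib]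
    refine (Finset.sum_le_card_nsmul Finset.univ _ (Λ : ℝ) fun i _ => ?_).trans (by simp)
    refine (neg_le_abs _).trans (abs_le_of_sq_le_sq ?_ Λ.2)
    exact (Finset.single_le_sum (f := fun j => heatHess P j i (τ, z) ^ 2) (fun j _ => sq_nonneg _)
      (Finset.mem_univ i)).trans (sum_heatHess_sq_le hτ hL z i)
  linarith

theorem integrable_heatRatio_sq {τ : ℝ} (hτ : 0 < τ) :
    Integrable (fun z => heatRatio P (τ, z) ^ 2) (heatLaw P τ) := by
  simpa only [sq] using (isRatio_heatRatio.mul isRatio_heatRatio).integrable hτ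

theorem integral_heatRatio_sq_le {Λ : ℝ≥0} {τ : ℝ} (hτ : 0 < τ)
    (hL : LipschitzWith Λ fun z => heatScore P (τ, z)) :
    ∫ z, heatRatio P (τ, z) ^ 2 ∂(heatLaw P τ) ≤ 2 * d * (Λ : ℝ) ^ 2 := by
  have := isProbabilityMeasure_heatLaw P hτ
  have hS := isRatio_heatScoreComp (P := P)
  have hA := isRatio_heatHess (P := P)
  rw [integral_heatRatio_sq hτ]
  have hi : Integrable (fun z => (d : ℝ) * (Λ : ℝ) ^ 2 + Λ * ‖heatScore P (τ, z)‖ ^ 2)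
      (heatLaw P τ) := (integrable_const _).add ((integrable_norm_heatScore_sq hτ).const_mul _)
  have h1 : ∫ z, ((d : ℝ) * (Λ : ℝ) ^ 2 + Λ * ‖heatScore P (τ, z)‖ ^ 2) ∂(heatLaw P τ) ≤
      2 * d * (Λ : ℝ) ^ 2 := by
    rw [integral_add (integrable_const _) ((integrable_norm_heatScore_sq hτ).const_mul _),
      integral_const_mul (Λ : ℝ)]
    have := mul_le_mul_of_nonneg_left (integral_norm_heatScore_sq_le hτ hL) Λ.coe_nonneg
    simp only [integral_const, probReal_univ, smul_eq_mul]
    nlinarith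
  refine (integral_mono ?_ hi fun z => ?_).trans h1
  · refine integrable_finsetSum _ fun i _ => integrable_finsetSum _ fun j _ => ?_
    refine Integrable.sub ?_ ((((hA i j).mul (hS i)).mul (hS j)).integrable hτ)
    simpa only [sq] using ((hA i j).mul (hA i j)).integrable hτ
  · simp only [Finset.sum_sub_distrib]
    rw [sub_eq_add_neg]
    refine add_le_add ?_ ?_
    · rw [Finset.sum_comm]
      exact (Finset.sum_le_card_nsmul _ _ _ fun j _ => sum_heatHess_sq_le hτ hL z j).trans (by simp)
    · have h2 : ∑ i, ∑ j, heatHess P i j (τ, z) * heatScoreComp P i (τ, z) * heatScoreComp P j (τ, z)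
          = inner ℝ (heatHessMap P (τ, z) (heatScore P (τ, z))) (heatScore P (τ, z)) := by
        rw [inner_eq_sum]
        refine Finset.sum_congr rfl fun i _ => ?_
        rw [heatHessMap_apply (p := (τ, z)) hτ, Finset.mul_sum]
        refine Finset.sum_congr rfl fun j _ => ?_
        simp only [heatScore]
        ring
      rw [h2]
      refine (neg_le_abs _).trans ((abs_real_inner_le_norm _ _).trans ?_)
      have h3 := (heatHessMap P (τ, z)).le_of_opNorm_le (norm_heatHessMap_le hτ hL z)
        (heatScore P (τ, z))
      calc _ ≤ Λ * ‖heatScore P (τ, z)‖ * ‖heatScore P (τ, z)‖ := by gcongr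
        _ = _ := by ring

end CMError

namespace CMError
open Set Filter Topology
variable {d : ℕ}

theorem integral_gaussianDensity (d : ℕ) {v : ℝ} (hv : 0 < v) :
    ∫ z, gaussianDensity d v z = 1 := by
  have h := isProbabilityMeasure_heatLaw (Measure.dirac (0 : Space d)) hv
  have h1 := integral_heatLaw (Measure.dirac (0 : Space d)) hv fun _ => 1
  simpa [heatDensity, kernelIntegral] using h1.symm

theorem gaussianDensity_mul_gaussianDensity (d : ℕ) {a r : ℝ} (ha : 0 < a) (hr : 0 < r)
    (y w : Space d) :
    gaussianDensity d a y * gaussianDensity d r (w - y) = gaussianDensity d (a + r) w *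
      gaussianDensity d (a * r / (a + r)) (y - (a / (a + r)) • w) := by
  unfold gaussianDensity
  have h1 : (2 * Real.pi * a) ^ (-(d : ℝ) / 2) * (2 * Real.pi * r) ^ (-(d : ℝ) / 2) =
      (2 * Real.pi * (a + r)) ^ (-(d : ℝ) / 2) *
        (2 * Real.pi * (a * r / (a + r))) ^ (-(d : ℝ) / 2) := by
    rw [← Real.mul_rpow (by positivity) (by positivity),
      ← Real.mul_rpow (by positivity) (by positivity)]
    congr 1
    field_simp
  have h2 : Real.exp (-‖y‖ ^ 2 / (2 * a)) * Real.exp (-‖w - y‖ ^ 2 / (2 * r)) =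
      Real.exp (-‖w‖ ^ 2 / (2 * (a + r))) *
        Real.exp (-‖y - (a / (a + r)) • w‖ ^ 2 / (2 * (a * r / (a + r)))) := by
    rw [← Real.exp_add, ← Real.exp_add, norm_sub_sq_real w y, norm_sub_sq_real y, norm_smul,
      inner_smul_right, mul_pow, Real.norm_eq_abs, sq_abs, real_inner_comm w y]
    congr 1
    field_simp
    ring
  calc _ = ((2 * Real.pi * a) ^ (-(d : ℝ) / 2) * (2 * Real.pi * r) ^ (-(d : ℝ) / 2)) *
        (Real.exp (-‖y‖ ^ 2 / (2 * a)) * Real.exp (-‖w - y‖ ^ 2 / (2 * r))) := by ring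
    _ = _ := by rw [h1, h2]; ring

theorem integral_gaussianDensity_conv (d : ℕ) {a r : ℝ} (ha : 0 < a) (hr : 0 < r) (x z : Space d) :
    ∫ y, gaussianDensity d a (y - x) * gaussianDensity d r (z - y) =
      gaussianDensity d (a + r) (z - x) := by
  have h1 : ∀ y, gaussianDensity d a (y - x) * gaussianDensity d r (z - y) =
      gaussianDensity d (a + r) (z - x) *
        gaussianDensity d (a * r / (a + r)) (y - (x + (a / (a + r)) • (z - x))) := by
    intro y
    rw [show z - y = (z - x) - (y - x) by abel, gaussianDensity_mul_gaussianDensity d ha hr,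
      sub_sub]
  simp_rw [h1]
  rw [integral_const_mul,
    integral_sub_right_eq_self (fun y => gaussianDensity d (a * r / (a + r)) y),
    integral_gaussianDensity d (by positivity), mul_one]

theorem fderiv_gaussianDensity_apply {p : ℝ × Space d} (hp : 0 < p.1) (v : ℝ × Space d) :
    fderiv ℝ (fun q : ℝ × Space d => gaussianDensity d q.1 q.2) p v =
      ((‖p.2‖ ^ 2 / (2 * p.1 ^ 2) - d / (2 * p.1)) * v.1 - p.1⁻¹ * inner ℝ p.2 v.2) *
        gaussianDensity d p.1 p.2 := by
  rw [(hasFDerivAt_gaussianDensity p hp).fderiv]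
  simp
  ring

theorem fderiv_congr_pos {f g : ℝ × Space d → ℝ} (h : ∀ q : ℝ × Space d, 0 < q.1 → f q = g q)
    {p : ℝ × Space d} (hp : 0 < p.1) : fderiv ℝ f p = fderiv ℝ g p := by
  have : f =ᶠ[𝓝 p] g := by
    filter_upwards [isOpen_pos_time.mem_nhds hp] with q hq using h q hq
  exact this.fderiv_eq

theorem fderiv_fderiv_gaussianDensity {p : ℝ × Space d} (hp : 0 < p.1) (e : Space d) :
    fderiv ℝ (fun q => fderiv ℝ (fun q : ℝ × Space d => gaussianDensity d q.1 q.2) q (0, e)) p (0, e) =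
      (p.1⁻¹ ^ 2 * inner ℝ p.2 e ^ 2 - p.1⁻¹ * ‖e‖ ^ 2) * gaussianDensity d p.1 p.2 := by
  have h1 : ∀ q : ℝ × Space d, 0 < q.1 →
      fderiv ℝ (fun q : ℝ × Space d => gaussianDensity d q.1 q.2) q (0, e) =
      (-(q.1⁻¹ * innerSL ℝ e q.2)) * gaussianDensity d q.1 q.2 := fun q hq => by
    rw [fderiv_gaussianDensity_apply hq, innerSL_apply_apply, real_inner_comm e]; simp
  rw [fderiv_congr_pos h1 hp]
  have h2 : HasFDerivAt (fun q : ℝ × Space d => q.1⁻¹)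
      (-(p.1 ^ 2)⁻¹ • ContinuousLinearMap.fst ℝ ℝ (Space d)) p :=
    (hasDerivAt_inv hp.ne').comp_hasFDerivAt p hasFDerivAt_fst
  have h3 : HasFDerivAt (fun q : ℝ × Space d => innerSL ℝ e q.2)
      ((innerSL ℝ e).comp (ContinuousLinearMap.snd ℝ ℝ (Space d))) p :=
    (innerSL ℝ e).hasFDerivAt.comp p hasFDerivAt_snd
  have h4 := (h2.fun_mul h3).fun_neg.fun_mul
    (hasFDerivAt_gaussianDensity p hp).differentiableAt.hasFDerivAt
  rw [h4.fderiv]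
  simp only [add_apply, smul_apply, smul_eq_mul, fderiv_gaussianDensity_apply hp, neg_apply]
  simp [real_inner_comm e]
  ring

variable {P : Measure (Space d)} [IsProbabilityMeasure P]

theorem heatDensity_eq_integral (P : Measure (Space d)) (p : ℝ × Space d) :
    heatDensity P p = ∫ y, gaussianDensity d p.1 (p.2 - y) ∂P := by
  simp [heatDensity, kernelIntegral]

/-- The semigroup property of the heat flow. -/
theorem heatDensity_heatLaw {a r : ℝ} (ha : 0 < a) (hr : 0 < r) (z : Space d) :
    heatDensity (heatLaw P a) (r, z) = heatDensity P (a + r, z) := by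
  rw [heatDensity_eq_integral, integral_heatLaw P ha, heatDensity_eq_integral]
  simp_rw [heatDensity_eq_integral, ← integral_mul_const]
  rw [integral_integral_swap]
  · simp_rw [integral_gaussianDensity_conv d ha hr]
  · have hc := continuous_gaussianDensity d a
    have hc' := continuous_gaussianDensity d r
    have hm : AEStronglyMeasurable (Function.uncurry fun y x : Space d =>
        gaussianDensity d a (y - x) * gaussianDensity d r (z - y)) (volume.prod P) := by
      apply Continuous.aestronglyMeasurable
      unfold Function.uncurry
      fun_prop
    refine (integrable_prod_iff' hm).2 ⟨.of_forall fun x => ?_, ?_⟩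
    · refine ((integrable_gaussianDensity d ha).comp_sub_right x).mul_bdd
        (c := (2 * Real.pi * r) ^ (-(d : ℝ) / 2))
        (hc'.comp (by fun_prop)).aestronglyMeasurable (.of_forall fun y => ?_)
      rw [Real.norm_of_nonneg (gaussianDensity_nonneg d hr _)]
      exact gaussianDensity_le d hr _
    · have : ∀ x : Space d, ∫ y, ‖Function.uncurry (fun y x : Space d =>
          gaussianDensity d a (y - x) * gaussianDensity d r (z - y)) (y, x)‖ =
          gaussianDensity d (a + r) (z - x) := by
        intro x
        rw [← integral_gaussianDensity_conv d ha hr]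
        congr 1
        ext y
        exact Real.norm_of_nonneg
          (mul_nonneg (gaussianDensity_nonneg d ha _) (gaussianDensity_nonneg d hr _))
      simp_rw [this]
      simpa using IsKernel.gauss.integrable_mul (integrable_one P) (τ := a + r) (by positivity) z

theorem fderiv_fderiv_heatDensity {p : ℝ × Space d} (hp : 0 < p.1) (v : ℝ × Space d) :
    fderiv ℝ (fun q => fderiv ℝ (heatDensity P) q v) p v = kernelIntegral P (fun _ => 1)
      (fun q => fderiv ℝ (fun q => fderiv ℝ
        (fun p : ℝ × Space d => gaussianDensity d p.1 p.2) q v) q v) p := by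
  rw [fderiv_congr_pos (fun q hq => fderiv_heatDensity hq v) hp]
  exact fderiv_kernelIntegral ((IsKernel.gauss (d := d)).fderiv v) (integrable_one P) hp v

theorem laplacian_heatDensity {p : ℝ × Space d} (hp : 0 < p.1) (i : Fin d) :
    spaceDeriv i (spaceDeriv i (heatDensity P)) p = heatDensity P p *
      (spaceDeriv i (heatScoreComp P i) p + heatScoreComp P i p * heatScoreComp P i p) := by
  rw [spaceDeriv_congr (fun q hq => spaceDeriv_heatDensity hq i) hp]
  have h1 := (differentiableAt_heatDensity (P := P) hp).hasFDerivAt.fun_mul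
    ((isRatio_heatScoreComp (P := P) i).differentiableAt hp).hasFDerivAt
  have h2 := spaceDeriv_heatDensity (P := P) hp i
  rw [spaceDeriv] at h2
  rw [spaceDeriv, h1.fderiv]
  simp only [add_apply, smul_apply, smul_eq_mul, h2, spaceDeriv]
  ring

/-- The heat equation. -/
theorem fderiv_heatDensity_time {p : ℝ × Space d} (hp : 0 < p.1) :
    fderiv ℝ (heatDensity P) p (1, 0) = heatDensity P p * heatRatio P p / 2 := by
  have h1 : heatDensity P p * heatRatio P p =
      ∑ i, spaceDeriv i (spaceDeriv i (heatDensity P)) p := by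
    rw [heatRatio, Finset.mul_sum]
    exact Finset.sum_congr rfl fun i _ => (laplacian_heatDensity hp i).symm
  have h2 : ∀ i, IsKernel d fun q => fderiv ℝ (fun q => fderiv ℝ
        (fun p : ℝ × Space d => gaussianDensity d p.1 p.2) q (0, EuclideanSpace.single i 1)) q
        (0, EuclideanSpace.single i 1) := fun i => (IsKernel.gauss.fderiv _).fderiv _
  have h0 : ∀ i, spaceDeriv i (spaceDeriv i (heatDensity P)) p = _ := fun i =>
    fderiv_fderiv_heatDensity (P := P) hp (0, EuclideanSpace.single i 1)
  rw [h1, fderiv_heatDensity hp]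
  simp_rw [h0]
  unfold kernelIntegral
  dsimp only
  rw [← integral_finsetSum _ fun i _ => (h2 i).integrable_mul (integrable_one P) hp p.2,
    ← integral_div]
  congr 1
  ext y
  have hq : 0 < ((p.1, p.2 - y) : ℝ × Space d).1 := hp
  simp only [one_mul, fderiv_fderiv_gaussianDensity hq, fderiv_gaussianDensity_apply hq]
  rw [← Finset.sum_mul, Finset.sum_sub_distrib, ← Finset.mul_sum]
  have h3 : ∑ i, inner ℝ (p.2 - y) (EuclideanSpace.single i (1 : ℝ)) ^ 2 = ‖p.2 - y‖ ^ 2 := by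
    rw [norm_sq_eq_sum]
    refine Finset.sum_congr rfl fun i _ => ?_
    rw [EuclideanSpace.inner_single_right]
    simp [sq]
  rw [h3]
  simp
  field_simp

theorem heatScore_heatLaw {a r : ℝ} (ha : 0 < a) (hr : 0 < r) (z : Space d) :
    heatScore (heatLaw P a) (r, z) = heatScore P (a + r, z) := by
  have := isProbabilityMeasure_heatLaw P ha
  rw [heatScore_eq_gradient hr, heatScore_eq_gradient (by positivity)]
  simp_rw [heatDensity_heatLaw ha hr]

theorem heatRatio_heatLaw {a r : ℝ} (ha : 0 < a) (hr : 0 < r) (z : Space d) :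
    kernelIntegral (heatLaw P a) (fun y => heatRatio P (a, y))
      (fun p => gaussianDensity d p.1 p.2) (r, z) =
      heatRatio P (a + r, z) * heatDensity P (a + r, z) := by
  have hd : ∀ a, 0 < a → ∀ z, HasDerivAt (fun t => heatDensity P (t, z))
      (heatDensity P (a, z) * heatRatio P (a, z) / 2) a := by
    intro a ha z
    rw [← fderiv_heatDensity_time (p := (a, z)) ha]
    have h1 := (differentiableAt_heatDensity (P := P) (p := (a, z)) ha).hasFDerivAt
    exact h1.comp_hasDerivAt a ((hasDerivAt_id a).prodMk (hasDerivAt_const a z))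
  have h1 : HasDerivAt (fun t => heatDensity P (t + r, z))
      (heatDensity P (a + r, z) * heatRatio P (a + r, z) / 2) a :=
    (hd (a + r) (by positivity) z).comp_add_const a r
  have hg := continuous_gaussianDensity d r
  obtain ⟨C, hC, hb⟩ := ((IsKernel.gauss (d := d)).fderiv (1, 0)).exists_const_bound
    (a := a / 2) (b := 2 * a) (by positivity) (by linarith)
  have hbU : ∀ t ∈ Icc (a / 2) (2 * a), ∀ y, ‖heatDensity P (t, y) * heatRatio P (t, y) / 2‖ ≤ C := by
    intro t ht y
    have ht0 : 0 < t := (half_pos ha).trans_le ht.1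
    rw [← fderiv_heatDensity_time (p := (t, y)) ht0, fderiv_heatDensity (p := (t, y)) ht0,
      kernelIntegral]
    refine (norm_integral_le_of_norm_le_const (C := C) (.of_forall fun x => ?_)).trans (by simp)
    simpa using hb t ht (y - x)
  have hgi : Integrable fun y => gaussianDensity d r (z - y) :=
    (integrable_gaussianDensity d hr).comp_sub_left z
  have hUc : ∀ t, 0 < t → Continuous fun y => heatDensity P (t, y) := fun t ht =>
    continuous_heatDensity_slice P ht
  have hnhds : Ioo (a / 2) (2 * a) ∈ 𝓝 a := Ioo_mem_nhds (by linarith) (by linarith)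
  have hint : Integrable fun y => heatDensity P (a, y) * gaussianDensity d r (z - y) := by
    refine (integrable_heatDensity P ha).mul_bdd (c := (2 * Real.pi * r) ^ (-(d : ℝ) / 2))
      (hg.comp (by fun_prop)).aestronglyMeasurable (.of_forall fun y => ?_)
    rw [Real.norm_of_nonneg (gaussianDensity_nonneg d hr _)]
    exact gaussianDensity_le d hr _
  have h2 := (hasDerivAt_integral_of_dominated_loc_of_deriv_le (μ := volume)
    (F := fun t y => heatDensity P (t, y) * gaussianDensity d r (z - y))
    (F' := fun t y => (heatDensity P (t, y) * heatRatio P (t, y) / 2) * gaussianDensity d r (z - y))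
    (bound := fun y => C * gaussianDensity d r (z - y)) hnhds
    (by
      filter_upwards [hnhds] with t ht
      exact ((hUc t ((half_pos ha).trans ht.1)).mul (hg.comp (by fun_prop))).aestronglyMeasurable)
    hint
    ((((hUc a ha).mul (isRatio_heatRatio.continuous_slice ha)).div_const 2).mul
      (hg.comp (by fun_prop))).aestronglyMeasurable
    (.of_forall fun y t ht => by
      rw [norm_mul, Real.norm_of_nonneg (gaussianDensity_nonneg d hr (z - y))]
      exact mul_le_mul_of_nonneg_right (hbU t ⟨ht.1.le, ht.2.le⟩ y) (gaussianDensity_nonneg d hr _))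
    (hgi.const_mul C)
    (.of_forall fun y t ht => (hd t ((half_pos ha).trans ht.1) y).mul_const _)).2
  have h3 : (fun t => ∫ y, heatDensity P (t, y) * gaussianDensity d r (z - y)) =ᶠ[𝓝 a]
      fun t => heatDensity P (t + r, z) := by
    filter_upwards [lt_mem_nhds ha] with t ht
    rw [← heatDensity_heatLaw ht hr, heatDensity_eq_integral, integral_heatLaw P ht]
  have h4 := (h2.congr_of_eventuallyEq h3.symm).unique h1
  have h5 : ∫ y, heatDensity P (a, y) * heatRatio P (a, y) / 2 * gaussianDensity d r (z - y) =
      (∫ y, heatDensity P (a, y) * (heatRatio P (a, y) * gaussianDensity d r (z - y))) / 2 := by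
    rw [← integral_div]
    congr 1
    ext y
    ring
  rw [h5] at h4
  rw [kernelIntegral, integral_heatLaw P ha]
  dsimp only
  linarith

theorem sq_integral_mul_le {α : Type*} [MeasurableSpace α] {μ : Measure α} {f g G : α → ℝ}
    (hG : ∀ y, 0 ≤ G y) (hf : Integrable (fun y => f y ^ 2 * G y) μ)
    (hg : Integrable (fun y => g y ^ 2 * G y) μ) (hfg : Integrable (fun y => f y * g y * G y) μ) :
    (∫ y, f y * g y * G y ∂μ) ^ 2 ≤ (∫ y, f y ^ 2 * G y ∂μ) * ∫ y, g y ^ 2 * G y ∂μ := by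
  have h : ∀ t : ℝ, 0 ≤ (∫ y, g y ^ 2 * G y ∂μ) * (t * t) + (2 * ∫ y, f y * g y * G y ∂μ) * t
      + ∫ y, f y ^ 2 * G y ∂μ := by
    intro t
    have h1 : 0 ≤ ∫ y, (t * g y + f y) ^ 2 * G y ∂μ :=
      integral_nonneg fun y => mul_nonneg (sq_nonneg _) (hG y)
    have h2 : ∀ y, (t * g y + f y) ^ 2 * G y =
        (t * t) * (g y ^ 2 * G y) + (2 * t) * (f y * g y * G y) + f y ^ 2 * G y := fun y => by ring
    simp_rw [h2] at h1
    rw [integral_add ((hg.const_mul _).fun_add (hfg.const_mul _)) hf,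
      integral_add (hg.const_mul _) (hfg.const_mul _), integral_const_mul, integral_const_mul] at h1
    linarith
  have := discrim_le_zero h
  rw [discrim] at this
  nlinarith

/-- The gradient of a heat average `∫ φ G / ∫ G` is controlled by the Lipschitz constant of the
score: it is a covariance of `φ` with the Gaussian noise. -/
theorem sq_fderiv_kernelIntegral_div_le {φ : Space d → ℝ} (hφ : Integrable φ P)
    (hφ2 : Integrable (fun y => φ y ^ 2) P) {r : ℝ} (hr : 0 < r) {Λ : ℝ≥0}
    (hL : LipschitzWith Λ fun z => heatScore P (r, z)) (z e : Space d) :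
    (fderiv ℝ (fun p => kernelIntegral P φ (fun p => gaussianDensity d p.1 p.2) p / heatDensity P p)
      (r, z) (0, e)) ^ 2 ≤ (Λ + r⁻¹) * ‖e‖ ^ 2 *
        ((∫ y, φ y ^ 2 * gaussianDensity d r (z - y) ∂P) / heatDensity P (r, z)) := by
  have hg : IsKernel d fun p => gaussianDensity d p.1 p.2 := .gauss
  have hp : 0 < ((r, z) : ℝ × Space d).1 := hr
  set G : Space d → ℝ := fun y => gaussianDensity d r (z - y) with hGdef
  set m : Space d → ℝ := fun y => inner ℝ (z - y) e with hm
  have hG0 : ∀ y, 0 ≤ G y := fun y => gaussianDensity_nonneg d hr _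
  -- first and second derivatives as integrals
  have k1 : ∀ ψ : Space d → ℝ, kernelIntegral P ψ (fun q => fderiv ℝ
      (fun p : ℝ × Space d => gaussianDensity d p.1 p.2) q (0, e)) (r, z) =
      -(r⁻¹ * ∫ y, ψ y * m y * G y ∂P) := by
    intro ψ
    rw [kernelIntegral, ← integral_const_mul, ← integral_neg]
    congr 1
    ext y
    rw [fderiv_gaussianDensity_apply (p := (r, z - y)) hr]
    simp [hm, hGdef]
    ring
  have im : ∀ ψ : Space d → ℝ, Integrable ψ P → Integrable (fun y => ψ y * m y * G y) P := by
    intro ψ hψ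
    have := ((hg.fderiv (0, e)).integrable_mul hψ hr z).const_mul (-r)
    refine this.congr (.of_forall fun y => ?_)
    dsimp only
    rw [fderiv_gaussianDensity_apply (p := (r, z - y)) hr]
    simp [hm, hGdef]
    field_simp
  have iG : ∀ ψ : Space d → ℝ, Integrable ψ P → Integrable (fun y => ψ y * G y) P := fun ψ hψ =>
    hg.integrable_mul hψ hr z
  have imm : Integrable (fun y => m y ^ 2 * G y) P := by
    have h1 := (((hg.fderiv (0, e)).fderiv (0, e)).integrable_mul (integrable_one P) hr z).const_mul
      (r ^ 2)
    have h2 := (iG _ (integrable_one P)).const_mul (r * ‖e‖ ^ 2)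
    refine (h1.add h2).congr (.of_forall fun y => ?_)
    simp only [Pi.add_apply]
    rw [fderiv_fderiv_gaussianDensity (p := (r, z - y)) hr]
    simp only [hm, hGdef]
    field_simp
    ring
  set u := heatDensity P (r, z) with hu
  have hu0 : 0 < u := heatDensity_pos P hp
  have hue : u = ∫ y, G y ∂P := heatDensity_eq_integral P (r, z)
  set v := ∫ y, φ y * G y ∂P with hv
  set um := ∫ y, m y * G y ∂P with hum
  set vm := ∫ y, φ y * m y * G y ∂P with hvm
  set umm := ∫ y, m y ^ 2 * G y ∂P with humm
  set vv := ∫ y, φ y ^ 2 * G y ∂P with hvv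
  have iG1 : Integrable G P := by simpa using iG _ (integrable_one P)
  have im1 : Integrable (fun y => m y * G y) P := by simpa using im _ (integrable_one P)
  have dU : fderiv ℝ (heatDensity P) (r, z) (0, e) = -(r⁻¹ * um) := by
    rw [fderiv_heatDensity hp, k1]
    simp [hum]
  have dV : fderiv ℝ (kernelIntegral P φ fun p => gaussianDensity d p.1 p.2) (r, z) (0, e) =
      -(r⁻¹ * vm) := by
    rw [fderiv_kernelIntegral hg hφ hp, k1]
  have ddU : fderiv ℝ (fun q => fderiv ℝ (heatDensity P) q (0, e)) (r, z) (0, e) =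
      r⁻¹ ^ 2 * umm - r⁻¹ * ‖e‖ ^ 2 * u := by
    rw [fderiv_fderiv_heatDensity hp, kernelIntegral, humm, hue, ← integral_const_mul,
      ← integral_const_mul, ← integral_sub (imm.const_mul _) (iG1.const_mul _)]
    congr 1
    ext y
    rw [fderiv_fderiv_gaussianDensity (p := (r, z - y)) hr]
    simp only [hm, hGdef]
    ring
  -- the Hessian of the log-density in direction `e`
  have hess : r⁻¹ ^ 2 * umm / u - r⁻¹ * ‖e‖ ^ 2 - (r⁻¹ * um / u) ^ 2 ≤ Λ * ‖e‖ ^ 2 := by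
    have h1 : ∀ q : ℝ × Space d, 0 < q.1 → inner ℝ e (heatScore P q) =
        fderiv ℝ (heatDensity P) q (0, e) * (heatDensity P q)⁻¹ := by
      intro q hq
      have h2 : fderiv ℝ (fun q => Real.log (heatDensity P q)) q (0, e) = inner ℝ e (heatScore P q) := by
        rw [fderiv_space_eq_sum, real_inner_comm, inner_eq_sum]
        rfl
      rw [← h2, fderiv_log_heatDensity hq, fderiv_heatDensity hq, div_eq_mul_inv]
    have h3 : fderiv ℝ (fun q => innerSL ℝ e (heatScore P q)) (r, z) (0, e) =
        inner ℝ e (heatHessMap P (r, z) e) := by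
      have h2 : HasFDerivAt (fun q => innerSL ℝ e (heatScore P q)) _ (r, z) :=
        (innerSL ℝ e).hasFDerivAt.comp (r, z) (differentiableAt_heatScore hp).hasFDerivAt
      rw [h2.fderiv]
      rfl
    have h4 : DifferentiableAt ℝ (fun q => fderiv ℝ (heatDensity P) q (0, e)) (r, z) := by
      have := ((contDiffOn_heatDensity P).contDiffAt (isOpen_pos_time.mem_nhds hp))
      have := ((contDiffAt_infty.1 this 2).fderiv_right (m := 1) le_rfl).differentiableAt one_ne_zero
      exact this.clm_apply (differentiableAt_const _)
    have h5 := h4.hasFDerivAt.fun_mul ((hasDerivAt_inv hu0.ne').comp_hasFDerivAt (r, z)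
      (differentiableAt_heatDensity (P := P) hp).hasFDerivAt)
    simp only [Function.comp_def] at h5
    have h6 : fderiv ℝ (fun q => innerSL ℝ e (heatScore P q)) (r, z) =
        fderiv ℝ (fun q => fderiv ℝ (heatDensity P) q (0, e) * (heatDensity P q)⁻¹) (r, z) :=
      fderiv_congr_pos (fun q hq => h1 q hq) hp
    rw [h6, h5.fderiv] at h3
    simp only [add_apply, smul_apply, smul_eq_mul, dU, ddU] at h3
    have h7 : inner ℝ e (heatHessMap P (r, z) e) ≤ Λ * ‖e‖ ^ 2 := by
      have := (heatHessMap P (r, z)).le_of_opNorm_le (norm_heatHessMap_le hr hL z) e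
      refine (real_inner_le_norm _ _).trans ?_
      nlinarith [norm_nonneg e]
    rw [← h3] at h7
    refine le_trans (le_of_eq ?_) h7
    rw [← hu]
    field_simp
    ring
  -- the derivative of the average
  have dR : fderiv ℝ (fun p => kernelIntegral P φ (fun p => gaussianDensity d p.1 p.2) p /
      heatDensity P p) (r, z) (0, e) = -(r⁻¹ * (vm - um / u * v)) / u := by
    have h1 := (hasFDerivAt_kernelIntegral hg hφ hp).differentiableAt.hasFDerivAt.fun_mul
      ((hasDerivAt_inv hu0.ne').comp_hasFDerivAt (r, z)
      (differentiableAt_heatDensity (P := P) hp).hasFDerivAt)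
    simp only [Function.comp_def] at h1
    simp only [div_eq_mul_inv]
    rw [h1.fderiv]
    simp only [add_apply, smul_apply, smul_eq_mul, dU, dV]
    rw [show kernelIntegral P φ (fun p => gaussianDensity d p.1 p.2) (r, z) = v from rfl, ← hu]
    field_simp
    ring
  -- Cauchy-Schwarz
  have icov : ∀ y, φ y * (m y - um / u) * G y = φ y * m y * G y - um / u * (φ y * G y) := fun y => by
    ring
  have ivar : ∀ y, (m y - um / u) ^ 2 * G y =
      m y ^ 2 * G y - (2 * (um / u)) * (m y * G y) + (um / u) ^ 2 * G y := fun y => by ring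
  have hcov : ∫ y, φ y * (m y - um / u) * G y ∂P = vm - um / u * v := by
    simp_rw [icov]
    rw [integral_sub (im φ hφ) ((iG φ hφ).const_mul _), integral_const_mul]
  have hvar : ∫ y, (m y - um / u) ^ 2 * G y ∂P = umm - um ^ 2 / u := by
    simp_rw [ivar]
    have h1 : Integrable (fun y => m y ^ 2 * G y - 2 * (um / u) * (m y * G y)) P :=
      imm.sub (im1.const_mul _)
    rw [integral_add h1 (iG1.const_mul _),
      integral_sub imm (im1.const_mul _), integral_const_mul, integral_const_mul, ← hue]
    field_simp
    ring
  have hCS := sq_integral_mul_le (μ := P) (f := φ) (g := fun y => m y - um / u) hG0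
    (iG _ hφ2)
    (by simp_rw [ivar]; exact (imm.sub (im1.const_mul _)).add (iG1.const_mul _))
    (by simp_rw [icov]; exact (im φ hφ).sub ((iG φ hφ).const_mul _))
  rw [hcov, hvar, ← hvv] at hCS
  have hvv0 : 0 ≤ vv := integral_nonneg fun y => mul_nonneg (sq_nonneg _) (hG0 y)
  rw [dR]
  calc (-(r⁻¹ * (vm - um / u * v)) / u) ^ 2 = (r⁻¹ / u) ^ 2 * (vm - um / u * v) ^ 2 := by ring
    _ ≤ (r⁻¹ / u) ^ 2 * (vv * (umm - um ^ 2 / u)) := by gcongr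
    _ = vv / u * (r⁻¹ ^ 2 * umm / u - r⁻¹ * ‖e‖ ^ 2 - (r⁻¹ * um / u) ^ 2 + r⁻¹ * ‖e‖ ^ 2) := by
      field_simp
      ring
    _ ≤ vv / u * (Λ * ‖e‖ ^ 2 + r⁻¹ * ‖e‖ ^ 2) := by gcongr
    _ = _ := by ring

end CMError

namespace CMError
open Set Filter Topology
variable {d : ℕ}
/-- The spatial gradient of `heatRatio`. -/
noncomputable def heatRatioGrad (P : Measure (Space d)) (p : ℝ × Space d) : Space d :=
  WithLp.toLp 2 fun i => spaceDeriv i (heatRatio P) p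

theorem norm_sq_heatRatioGrad (P : Measure (Space d)) (p : ℝ × Space d) : ‖heatRatioGrad P p‖ ^ 2 =
    fderiv ℝ (heatRatio P) p (0, heatRatioGrad P p) := by
  rw [fderiv_space_eq_sum, norm_sq_eq_sum]
  rfl

variable {P : Measure (Space d)} [IsProbabilityMeasure P]

theorem integrable_norm_heatRatioGrad_sq {τ : ℝ} (hτ : 0 < τ) :
    Integrable (fun z => ‖heatRatioGrad P (τ, z)‖ ^ 2) (heatLaw P τ) := by
  simp_rw [norm_sq_eq_sum]
  exact integrable_finsetSum _ fun i _ =>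
    ((isRatio_heatRatio.spaceDeriv i).mul (isRatio_heatRatio.spaceDeriv i)).integrable hτ

theorem norm_heatRatioGrad_sq_le {a r : ℝ} (ha : 0 < a) (hr : 0 < r) {Λ : ℝ≥0}
    (hL : LipschitzWith Λ fun z => heatScore P (a + r, z)) (z : Space d) :
    ‖heatRatioGrad P (a + r, z)‖ ^ 2 ≤ (Λ + r⁻¹) *
      ((∫ y, heatRatio P (a, y) ^ 2 * gaussianDensity d r (z - y) ∂(heatLaw P a)) /
        heatDensity P (a + r, z)) := by
  have := isProbabilityMeasure_heatLaw P ha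
  have hL' : LipschitzWith Λ fun z => heatScore (heatLaw P a) (r, z) := by
    simp_rw [heatScore_heatLaw ha hr]
    exact hL
  set e := heatRatioGrad P (a + r, z) with he
  have h := sq_fderiv_kernelIntegral_div_le (P := heatLaw P a)
    (isRatio_heatRatio.integrable ha) (integrable_heatRatio_sq (P := P) ha) hr hL' z e
  have hfd : fderiv ℝ (fun p => kernelIntegral (heatLaw P a) (fun y => heatRatio P (a, y))
      (fun p => gaussianDensity d p.1 p.2) p / heatDensity (heatLaw P a) p) (r, z) (0, e) =
      ‖e‖ ^ 2 := by
    rw [he, norm_sq_heatRatioGrad, ← he]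
    have h1 : ∀ q : ℝ × Space d, 0 < q.1 → kernelIntegral (heatLaw P a)
        (fun y => heatRatio P (a, y)) (fun p => gaussianDensity d p.1 p.2) q /
        heatDensity (heatLaw P a) q = heatRatio P ((a, 0) + q) := by
      rintro ⟨r, z⟩ hr
      rw [heatRatio_heatLaw ha hr, heatDensity_heatLaw ha hr, mul_div_cancel_right₀ _
        (heatDensity_pos P (p := (a + r, z)) (add_pos ha hr)).ne']
      simp
    rw [fderiv_congr_pos h1 (p := (r, z)) hr, fderiv_comp_add_left]
    simp
  rw [hfd, heatDensity_heatLaw ha hr] at h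
  rcases eq_or_ne (‖e‖ ^ 2) 0 with h0 | h0
  · rw [h0]
    refine mul_nonneg (by positivity) (div_nonneg (integral_nonneg fun y =>
      mul_nonneg (sq_nonneg _) (gaussianDensity_nonneg d hr _))
      (heatDensity_pos P (p := (a + r, z)) (add_pos ha hr)).le)
  · have : 0 < ‖e‖ ^ 2 := lt_of_le_of_ne (sq_nonneg _) h0.symm
    refine le_of_mul_le_mul_left ?_ this
    linarith

theorem integral_norm_heatRatioGrad_sq_le {a r : ℝ} (ha : 0 < a) (hr : 0 < r) {Λ Λ' : ℝ≥0}
    (hL : LipschitzWith Λ fun z => heatScore P (a + r, z))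
    (hL' : LipschitzWith Λ' fun z => heatScore P (a, z)) :
    ∫ z, ‖heatRatioGrad P (a + r, z)‖ ^ 2 ∂(heatLaw P (a + r)) ≤
      (Λ + r⁻¹) * (2 * d * (Λ' : ℝ) ^ 2) := by
  have := isProbabilityMeasure_heatLaw P ha
  have har := add_pos ha hr
  have hm : AEStronglyMeasurable (Function.uncurry fun (z y : Space d) =>
      heatRatio P (a, y) ^ 2 * gaussianDensity d r (z - y)) (volume.prod (heatLaw P a)) := by
    apply Continuous.aestronglyMeasurable
    have h1 := isRatio_heatRatio (P := P).continuous_slice ha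
    have h2 := continuous_gaussianDensity d r
    exact ((h1.comp continuous_snd).pow 2).mul (h2.comp (continuous_fst.sub continuous_snd))
  have hval : ∀ y, ∫ z, heatRatio P (a, y) ^ 2 * gaussianDensity d r (z - y) =
      heatRatio P (a, y) ^ 2 := fun y => by
    rw [integral_const_mul, integral_sub_right_eq_self (fun z => gaussianDensity d r z),
      integral_gaussianDensity d hr, mul_one]
  have hi : Integrable (Function.uncurry fun (z y : Space d) =>
      heatRatio P (a, y) ^ 2 * gaussianDensity d r (z - y)) (volume.prod (heatLaw P a)) := by
    refine (integrable_prod_iff' hm).2 ⟨.of_forall fun y => by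
      simpa only [Function.uncurry] using
        ((integrable_gaussianDensity d hr).comp_sub_right y).const_mul (heatRatio P (a, y) ^ 2), ?_⟩
    refine (integrable_heatRatio_sq (P := P) ha).congr (.of_forall fun y => ?_)
    simp only [Function.uncurry]
    refine (hval y).symm.trans ?_
    congr 1
    ext z
    exact (Real.norm_of_nonneg (mul_nonneg (sq_nonneg _) (gaussianDensity_nonneg d hr _))).symm
  rw [integral_heatLaw P har]
  calc ∫ z, heatDensity P (a + r, z) * ‖heatRatioGrad P (a + r, z)‖ ^ 2
      ≤ ∫ z, (Λ + r⁻¹) *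
        ∫ y, heatRatio P (a, y) ^ 2 * gaussianDensity d r (z - y) ∂(heatLaw P a) := by
        refine integral_mono ((integrable_heatLaw_iff P har).1
          (integrable_norm_heatRatioGrad_sq har)) (hi.integral_prod_left.const_mul _) fun z => ?_
        have hU := heatDensity_pos P (p := (a + r, z)) har
        refine (mul_le_mul_of_nonneg_left (norm_heatRatioGrad_sq_le ha hr hL z) hU.le).trans
          (le_of_eq ?_)
        field_simp
    _ = (Λ + r⁻¹) * ∫ y, heatRatio P (a, y) ^ 2 ∂(heatLaw P a) := by
        rw [integral_const_mul, integral_integral_swap hi]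
        simp_rw [hval]
    _ ≤ _ := by
        gcongr
        exact integral_heatRatio_sq_le ha hL'

end CMError

namespace CMError
open Set Filter Topology
variable {d : ℕ}

section Flow

variable {E : Type*} [NormedAddCommGroup E] [NormedSpace ℝ E]

/-- A solution of `y' = v(t, y)` on `[a, b]`. -/
def IsSolution (v : ℝ → E → E) (a b : ℝ) (y : ℝ → E) : Prop :=
  ∀ t ∈ Icc a b, HasDerivWithinAt y (v t (y t)) (Icc a b) t

variable {v : ℝ → E → E} {a b : ℝ} {y : ℝ → E}

theorem IsSolution.continuousOn (h : IsSolution v a b y) : ContinuousOn y (Icc a b) :=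
  fun t ht => (h t ht).continuousWithinAt

theorem _root_.HasDerivWithinAt.Ici_of_Icc {f : ℝ → E} {f' : E} {t : ℝ} (h : HasDerivWithinAt f f' (Icc a b) t)
    (ht : t ∈ Ico a b) : HasDerivWithinAt f f' (Ici t) t :=
  (h.mono (Icc_subset_Icc_left ht.1)).mono_of_mem_nhdsWithin (Icc_mem_nhdsGE ht.2)

theorem _root_.HasDerivWithinAt.Iic_of_Icc {f : ℝ → E} {f' : E} {t : ℝ} (h : HasDerivWithinAt f f' (Icc a b) t)
    (ht : t ∈ Ioc a b) : HasDerivWithinAt f f' (Iic t) t :=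
  (h.mono (Icc_subset_Icc_right ht.2)).mono_of_mem_nhdsWithin (Icc_mem_nhdsLE ht.1)

theorem IsSolution.trans {c : ℝ} {w : ℝ → E} (hab : a ≤ b) (hbc : b ≤ c) (hy : IsSolution v a b y)
    (hw : IsSolution v b c w) (hyw : w b = y b) :
    IsSolution v a c fun t => if t ≤ b then y t else w t := by
  set u : ℝ → E := fun t => if t ≤ b then y t else w t with hu
  have h1 : EqOn u y (Icc a b) := fun t ht => if_pos ht.2
  have h2 : EqOn u w (Icc b c) := fun t ht => by
    rcases eq_or_lt_of_le ht.1 with rfl | h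
    · simp [hu, hyw]
    · simp [hu, h.not_ge]
  intro t ht
  rw [← Icc_union_Icc_eq_Icc hab hbc]
  have k1 : t ∈ Icc a b → HasDerivWithinAt u (v t (u t)) (Icc a b) t := fun h => by
    rw [h1 h]; exact (hy t h).congr h1 (h1 h)
  have k2 : t ∈ Icc b c → HasDerivWithinAt u (v t (u t)) (Icc b c) t := fun h => by
    rw [h2 h]; exact (hw t h).congr h2 (h2 h)
  rcases lt_trichotomy t b with h | rfl | h
  · refine (k1 ⟨ht.1, h.le⟩).mono_of_mem_nhdsWithin ?_
    filter_upwards [self_mem_nhdsWithin, mem_nhdsWithin_of_mem_nhds (Iio_mem_nhds h)] with x hx hx'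
    exact ⟨hx.elim (·.1) fun h => hab.trans h.1, (mem_Iio.1 hx').le⟩
  · exact (k1 ⟨hab, le_rfl⟩).union (k2 ⟨le_rfl, hbc⟩)
  · refine (k2 ⟨h.le, ht.2⟩).mono_of_mem_nhdsWithin ?_
    filter_upwards [self_mem_nhdsWithin, mem_nhdsWithin_of_mem_nhds (Ioi_mem_nhds h)] with x hx hx'
    exact ⟨(mem_Ioi.1 hx').le, hx.elim (fun h => h.2.trans hbc) (·.2)⟩

/-- Global existence for Lipschitz vector fields. -/
theorem exists_isSolution [CompleteSpace E] {K : ℝ≥0} (hv : ∀ x, Continuous fun t => v t x)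
    (hK : ∀ t, LipschitzWith K (v t)) (a b : ℝ) (x₀ : E) :
    ∃ y, y a = x₀ ∧ IsSolution v a b y := by
  set η : ℝ := (1 + K : ℝ)⁻¹ with hη
  have hη0 : 0 < η := by positivity
  have local_ex : ∀ c x, ∃ y, y c = x ∧ IsSolution v c (c + η) y := by
    intro c x
    obtain ⟨M, hM⟩ := (isCompact_Icc (a := c) (b := c + η)).exists_bound_of_continuousOn
      (hv x).continuousOn
    have hM0 : 0 ≤ M := (norm_nonneg _).trans (hM c ⟨le_rfl, by linarith⟩)
    lift M to ℝ≥0 using hM0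
    have hpl : IsPicardLindelof v (tmin := c) (tmax := c + η) ⟨c, le_rfl, by linarith⟩ x M 0
        ((1 + K) * M) K :=
      { lipschitzOnWith := fun t _ => (hK t).lipschitzOnWith
        continuousOn := fun x _ => (hv x).continuousOn
        norm_le := fun t ht w hw => by
          have h1 := (hK t).dist_le_mul w x
          have h2 : dist w x ≤ M := hw
          rw [dist_eq_norm] at h1
          have h3 : ‖v t w‖ ≤ ‖v t x‖ + ‖v t w - v t x‖ := by
            simpa using norm_add_le (v t x) (v t w - v t x)
          have h4 := hM t ht
          push_cast
          nlinarith [mul_le_mul_of_nonneg_left h2 K.coe_nonneg]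
        mul_max_le := by
          simp only [add_sub_cancel_left, sub_self, max_eq_left hη0.le]
          push_cast
          rw [sub_zero, mul_right_comm, hη, mul_inv_cancel₀ (by positivity), one_mul] }
    exact hpl.exists_eq_forall_mem_Icc_hasDerivWithinAt₀
  have glob : ∀ n : ℕ, ∃ y, y a = x₀ ∧ IsSolution v a (a + n * η) y := by
    intro n
    induction n with
    | zero =>
      obtain ⟨y, h1, h2⟩ := local_ex a x₀
      refine ⟨y, h1, fun t ht => ?_⟩
      have hs : Icc a (a + (0 : ℕ) * η) ⊆ Icc a (a + η) := Icc_subset_Icc_right (by simp; positivity)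
      exact (h2 t (hs ht)).mono hs
    | succ n ih =>
      obtain ⟨y, h1, h2⟩ := ih
      obtain ⟨w, h3, h4⟩ := local_ex (a + n * η) (y (a + n * η))
      have hn : 0 ≤ (n : ℝ) * η := by positivity
      have h5 := h2.trans (by linarith) (by linarith) h4 h3
      rw [show a + n * η + η = a + (n + 1 : ℕ) * η by push_cast; ring] at h5
      exact ⟨_, by simp [hn, h1], h5⟩
  obtain ⟨n, hn⟩ := exists_nat_ge ((b - a) / η)
  obtain ⟨y, h1, h2⟩ := glob n
  have hs : Icc a b ⊆ Icc a (a + n * η) := Icc_subset_Icc_right (by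
    rw [div_le_iff₀ hη0] at hn; linarith)
  exact ⟨y, h1, fun t ht => (h2 t (hs ht)).mono hs⟩

theorem IsSolution.norm_sub_le {K : ℝ≥0} (hK : ∀ t, LipschitzWith K (v t)) {w : ℝ → E}
    (hy : IsSolution v a b y) (hw : IsSolution v a b w) {t : ℝ} (ht : t ∈ Icc a b) :
    ‖y t - w t‖ ≤ ‖y a - w a‖ * Real.exp (K * (t - a)) := by
  rw [← dist_eq_norm, ← dist_eq_norm]
  exact dist_le_of_trajectories_ODE hK hy.continuousOn
    (fun t ht => (hy t (Ico_subset_Icc_self ht)).Ici_of_Icc ht) hw.continuousOn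
    (fun t ht => (hw t (Ico_subset_Icc_self ht)).Ici_of_Icc ht) le_rfl t ht

theorem IsSolution.eq_of_eq_right {K : ℝ≥0} (hK : ∀ t, LipschitzWith K (v t)) {w : ℝ → E}
    (hab : a ≤ b) (hy : IsSolution v a b y) (hw : IsSolution v a b w) (h : y b = w b) :
    y a = w a :=
  ODE_solution_unique_of_mem_Icc_left (s := fun _ => univ) (fun t _ => (hK t).lipschitzOnWith)
    hy.continuousOn (fun t ht => (hy t (Ioc_subset_Icc_self ht)).Iic_of_Icc ht)
    (fun _ _ => trivial) hw.continuousOn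
    (fun t ht => (hw t (Ioc_subset_Icc_self ht)).Iic_of_Icc ht) (fun _ _ => trivial) h ⟨le_rfl, hab⟩

theorem IsSolution.mono {c e : ℝ} (h : IsSolution v a b y) (hs : Icc c e ⊆ Icc a b) :
    IsSolution v c e y := fun t ht => (h t (hs ht)).mono hs

/-- Solutions depend differentiably on the initial value; the derivative solves the linearised
equation. -/
theorem hasFDerivAt_of_isSolution {K : ℝ≥0} (hK : ∀ t, LipschitzWith K (v t))
    [FiniteDimensional ℝ E] {A : ℝ → E → E →L[ℝ] E} (hA : ∀ t x, HasFDerivAt (v t) (A t x) x)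
    (hAc : Continuous fun q : ℝ × E => A q.1 q.2) {Φ : E → ℝ → E} (hΦ0 : ∀ z, Φ z a = z)
    (hΦ : ∀ z, IsSolution v a b (Φ z)) {z : E} {J : ℝ → E →L[ℝ] E}
    (hJ0 : J a = ContinuousLinearMap.id ℝ E)
    (hJ : IsSolution (fun t B => (A t (Φ z t)).comp B) a b J) {t : ℝ} (ht : t ∈ Icc a b) :
    HasFDerivAt (fun w => Φ w t) (J t) z := by
  have : CompleteSpace E := FiniteDimensional.complete ℝ E
  have : ProperSpace E := FiniteDimensional.proper ℝ E
  set X := Real.exp (K * (b - a)) with hX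
  have hX1 : 0 < X := Real.exp_pos _
  have hab : a ≤ b := ht.1.trans ht.2
  -- uniform differentiability of `v` along the trajectory
  have unif : ∀ ε > 0, ∃ ρ > 0, ∀ s ∈ Icc a b, ∀ u, ‖u - Φ z s‖ ≤ ρ →
      ‖v s u - v s (Φ z s) - A s (Φ z s) (u - Φ z s)‖ ≤ ε * ‖u - Φ z s‖ := by
    intro ε hε
    have hcomp : IsCompact ((fun s => (s, Φ z s)) '' Icc a b) :=
      isCompact_Icc.image_of_continuousOn (continuousOn_id.prodMk (hΦ z).continuousOn)
    have := hcomp.uniformContinuousAt_of_continuousAt (fun q : ℝ × E => A q.1 q.2)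
      (fun q _ => hAc.continuousAt) (Metric.dist_mem_uniformity hε)
    obtain ⟨ρ, hρ, h⟩ := Metric.mem_uniformity_dist.1 this
    refine ⟨ρ / 2, by positivity, fun s hs u hu => ?_⟩
    refine Convex.norm_image_sub_le_of_norm_hasFDerivWithin_le' (f' := A s)
      (s := Metric.closedBall (Φ z s) (ρ / 2)) (fun x _ => (hA s x).hasFDerivWithinAt)
      (fun x hx => ?_) (convex_closedBall _ _) (Metric.mem_closedBall_self (by positivity))
      (by rwa [mem_closedBall_iff_norm])
    have h1 := @h (s, Φ z s) (s, x) (by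
      rw [Prod.dist_eq, dist_self, max_eq_right dist_nonneg, dist_comm]
      exact lt_of_le_of_lt hx (by linarith)) (mem_image_of_mem _ hs)
    rw [mem_ofPred_eq, dist_comm, dist_eq_norm] at h1
    exact h1.le
  rw [hasFDerivAt_iff_isLittleO, Asymptotics.isLittleO_iff]
  intro c hc
  set B := gronwallBound 0 K 1 (b - a) + 1 with hB
  have hg : ∀ ε, 0 ≤ ε → ∀ s ∈ Icc a b, gronwallBound 0 K ε (s - a) ≤ ε * B := by
    intro ε hε s hs
    have h1 : ∀ x, gronwallBound 0 K ε x = ε * gronwallBound 0 K 1 x := fun x => by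
      unfold gronwallBound
      split_ifs
      · ring
      · ring
    rw [h1, hB]
    have h2 := gronwallBound_mono le_rfl zero_le_one K.coe_nonneg (sub_le_sub_right hs.2 a)
    gcongr
    linarith
  have hB0 : 0 < B := by
    have h2 := hg 1 zero_le_one a ⟨le_rfl, hab⟩
    rw [sub_self, gronwallBound_x0] at h2
    have h3 := gronwallBound_mono (le_refl (0 : ℝ)) zero_le_one K.coe_nonneg (sub_nonneg.2 hab)
    rw [gronwallBound_x0] at h3
    linarith
  set ε := c / (X * B) with hε
  have hε0 : 0 < ε := by positivity
  obtain ⟨ρ, hρ, hu⟩ := unif ε hε0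
  have hnear : ∀ᶠ w in 𝓝 z, ‖w - z‖ < ρ / X := by
    have := Metric.ball_mem_nhds z (show 0 < ρ / X by positivity)
    filter_upwards [this] with w hw
    rwa [← dist_eq_norm]
  filter_upwards [hnear] with w hw
  have hbd : ∀ s ∈ Icc a b, ‖Φ w s - Φ z s‖ ≤ ‖w - z‖ * X := by
    intro s hs
    refine ((hΦ w).norm_sub_le hK (hΦ z) hs).trans ?_
    rw [hΦ0, hΦ0, hX]
    gcongr
    exact hs.2
  have hJw : ∀ s ∈ Icc a b, HasDerivWithinAt (fun s => J s (w - z))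
      (A s (Φ z s) (J s (w - z))) (Icc a b) s := fun s hs =>
    ((hJ s hs).clm_apply (hasDerivWithinAt_const s _ (w - z))).congr_deriv (by simp)
  have hd : ∀ s ∈ Icc a b, HasDerivWithinAt (fun s => Φ w s - Φ z s - J s (w - z))
      (v s (Φ w s) - v s (Φ z s) - A s (Φ z s) (J s (w - z))) (Icc a b) s := fun s hs =>
    ((hΦ w s hs).sub (hΦ z s hs)).sub (hJw s hs)
  have hmain := norm_le_gronwallBound_of_norm_deriv_right_le (δ := 0) (K := K)
    (ε := ε * (‖w - z‖ * X))
    (fun s hs => (hd s hs).continuousWithinAt)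
    (fun s hs => (hd s (Ico_subset_Icc_self hs)).Ici_of_Icc hs) (by simp [hΦ0, hJ0]) (by
      intro s hs
      have hs' := Ico_subset_Icc_self hs
      have h1 := hu s hs' (Φ w s) ((hbd s hs').trans (by
        rw [lt_div_iff₀ hX1] at hw; exact hw.le))
      have h2 : ‖A s (Φ z s)‖ ≤ K := by
        rw [← (hA s (Φ z s)).fderiv]; exact norm_fderiv_le_of_lipschitz ℝ (hK s)
      have h3 : v s (Φ w s) - v s (Φ z s) - A s (Φ z s) (J s (w - z)) =
        (v s (Φ w s) - v s (Φ z s) - A s (Φ z s) (Φ w s - Φ z s)) +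
          A s (Φ z s) (Φ w s - Φ z s - J s (w - z)) := by
        simp only [map_sub]; abel
      rw [h3]
      refine (norm_add_le _ _).trans ?_
      rw [add_comm]
      refine add_le_add ((A s (Φ z s)).le_of_opNorm_le h2 _) (h1.trans ?_)
      exact mul_le_mul_of_nonneg_left (hbd s hs') hε0.le) t ht
  refine hmain.trans ((hg _ (by positivity) t ht).trans (le_of_eq ?_))
  rw [hε]
  field_simp

end Flow

end CMError

namespace CMError
open Set Filter Topology
variable {d : ℕ}

/-- Jacobi's formula along a curve of matrices with `N' = B N`. -/
theorem hasDerivWithinAt_det {ι : Type*} [Fintype ι] [DecidableEq ι] {N : ℝ → Matrix ι ι ℝ}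
    {B : Matrix ι ι ℝ} {s : Set ℝ} {t : ℝ}
    (h : ∀ i j, HasDerivWithinAt (fun x => N x i j) ((B * N t) i j) s t) :
    HasDerivWithinAt (fun x => (N x).det) (B.trace * (N t).det) s t := by
  let D : ContinuousMultilinearMap ℝ (fun _ : ι => ι → ℝ) ℝ :=
    { Matrix.detRowAlternating (R := ℝ) (n := ι).toMultilinearMap with
      cont := by
        show Continuous fun M : Matrix ι ι ℝ => M.det
        exact continuous_id.matrix_det }
  have hD : ∀ M : Matrix ι ι ℝ, D M = M.det := fun _ => rfl
  have hN : HasDerivWithinAt (fun x i => N x i) (fun i => (B * N t) i) s t :=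
    hasDerivWithinAt_pi.2 fun i => hasDerivWithinAt_pi.2 fun j => h i j
  have h1 := (D.hasFDerivAt (fun i => N t i)).comp_hasDerivWithinAt t hN
  refine h1.congr_deriv ?_
  rw [ContinuousMultilinearMap.linearDeriv_apply, Matrix.trace, Finset.sum_mul]
  refine Finset.sum_congr rfl fun i _ => ?_
  have h2 : (B * N t) i = ∑ j, B i j • N t j := by
    ext k
    simp [Matrix.mul_apply, Finset.sum_apply]
  rw [h2]
  have h3 : ∀ w, D (Function.update (fun i => N t i) i w) =
      Matrix.detRowAlternating.toMultilinearMap (Function.update (fun i => N t i) i w) :=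
    fun _ => rfl
  rw [h3, MultilinearMap.map_update_sum, Finset.sum_eq_single i]
  · rw [MultilinearMap.map_update_smul]
    simp only [Function.update_eq_self, smul_eq_mul]
    rfl
  · intro j _ hj
    rw [MultilinearMap.map_update_smul]
    have : Matrix.detRowAlternating (Function.update (fun i => N t i) i (N t j)) = 0 :=
      AlternatingMap.map_update_self _ _ hj.symm
    erw [this]
    simp
  · simp

/-- Liouville's formula. -/
theorem hasDerivWithinAt_det_clm {J : ℝ → Space d →L[ℝ] Space d} {A : Space d →L[ℝ] Space d}
    {s : Set ℝ} {t : ℝ} (h : HasDerivWithinAt J (A.comp (J t)) s t) :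
    HasDerivWithinAt (fun x => (J x).det)
      ((∑ i, A (EuclideanSpace.single i 1) i) * (J t).det) s t := by
  set b := (EuclideanSpace.basisFun (Fin d) ℝ).toBasis with hb
  have hdet : ∀ L : Space d →L[ℝ] Space d, L.det = (LinearMap.toMatrix b b L).det := fun L =>
    (LinearMap.det_toMatrix b _).symm
  have hent : ∀ (L : Space d →L[ℝ] Space d) i j,
      LinearMap.toMatrix b b L i j = L (EuclideanSpace.single j 1) i := fun L i j => by
    rw [LinearMap.toMatrix_apply]
    simp [hb]
  simp_rw [hdet]
  have htr : ∑ i, A (EuclideanSpace.single i 1) i = (LinearMap.toMatrix b b A).trace :=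
    Finset.sum_congr rfl fun i _ => (hent A i i).symm
  rw [htr]
  refine hasDerivWithinAt_det fun i j => ?_
  have : LinearMap.toMatrix b b A * LinearMap.toMatrix b b (J t) =
      LinearMap.toMatrix b b (A.comp (J t)) := (LinearMap.toMatrix_comp b b b _ _).symm
  rw [this, hent]
  simp_rw [hent]
  have h1 := h.clm_apply (hasDerivWithinAt_const t s (EuclideanSpace.single j (1 : ℝ)))
  exact (((EuclideanSpace.proj (𝕜 := ℝ) i : Space d →L[ℝ] ℝ).hasFDerivAt.comp_hasDerivWithinAt t
    h1)).congr_deriv (by simp)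

/-- A density that satisfies the continuity equation along solutions is transported by the flow. -/
theorem map_flow_eq {v : ℝ → Space d → Space d} {K : ℝ≥0}
    (hK : ∀ t, LipschitzWith K (v t)) {A : ℝ → Space d → Space d →L[ℝ] Space d}
    (hA : ∀ t x, HasFDerivAt (v t) (A t x) x)
    (hAc : Continuous fun q : ℝ × Space d => A q.1 q.2) {a b : ℝ} {p : ℝ → Space d → ℝ}
    (hp : ∀ t ∈ Icc a b, ∀ z, 0 < p t z)
    (hprob : ∀ t ∈ Icc a b,
      IsProbabilityMeasure (volume.withDensity fun z => ENNReal.ofReal (p t z)))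
    (hcont : ∀ y, IsSolution v a b y → ∀ t ∈ Icc a b, HasDerivWithinAt (fun s => p s (y s))
      (-(∑ i, A t (y t) (EuclideanSpace.single i 1) i) * p t (y t)) (Icc a b) t)
    {Φ : Space d → ℝ → Space d} (hΦ0 : ∀ z, Φ z a = z) (hΦ : ∀ z, IsSolution v a b (Φ z))
    {t : ℝ} (ht : t ∈ Icc a b) :
    (volume.withDensity fun z => ENNReal.ofReal (p a z)).map (fun z => Φ z t) =
      volume.withDensity fun z => ENNReal.ofReal (p t z) := by
  have hab : a ≤ b := ht.1.trans ht.2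
  have ha : a ∈ Icc a b := ⟨le_rfl, hab⟩
  -- the derivative of the flow
  have hJ : ∀ z, ∃ J : ℝ → Space d →L[ℝ] Space d, J a = ContinuousLinearMap.id ℝ (Space d) ∧
      IsSolution (fun t B => (A t (Φ z t)).comp B) a b J := by
    intro z
    have hc : Continuous fun s => A (projIcc a b hab s) (Φ z (projIcc a b hab s)) := by
      have h1 : Continuous fun s => Φ z (projIcc a b hab s) :=
        ((hΦ z).continuousOn.domRestrict).comp continuous_projIcc
      exact hAc.comp ((continuous_subtype_val.comp (continuous_projIcc (h := hab))).prodMk h1)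
    have hAK : ∀ t x, ‖A t x‖ ≤ K := fun t x => by
      rw [← (hA t x).fderiv]; exact norm_fderiv_le_of_lipschitz ℝ (hK t)
    obtain ⟨J, h1, h2⟩ := exists_isSolution (K := K)
      (v := fun s (B : Space d →L[ℝ] Space d) =>
        (A (projIcc a b hab s) (Φ z (projIcc a b hab s))).comp B)
      (fun B => hc.clm_comp continuous_const) (fun s => by
        refine LipschitzWith.of_dist_le_mul fun B C => ?_
        rw [dist_eq_norm, dist_eq_norm, ← ContinuousLinearMap.comp_sub]
        refine (ContinuousLinearMap.opNorm_comp_le _ _).trans ?_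
        gcongr
        exact hAK _ _) a b (ContinuousLinearMap.id ℝ (Space d))
    refine ⟨J, h1, fun s hs => ?_⟩
    have := h2 s hs
    simpa only [projIcc_of_mem hab hs] using this
  choose J hJ0 hJ1 using hJ
  have hdet : ∀ z, ∀ s ∈ Icc a b, (J z s).det * p s (Φ z s) = p a z := by
    intro z s hs
    have hD : ∀ s ∈ Icc a b, HasDerivWithinAt (fun s => (J z s).det * p s (Φ z s)) 0 (Icc a b) s :=
      fun s hs => ((hasDerivWithinAt_det_clm (hJ1 z s hs)).mul (hcont _ (hΦ z) s hs)).congr_deriv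
        (by ring)
    have h1 := constant_of_derivWithin_zero (fun s hs => (hD s hs).differentiableWithinAt)
      (fun s hs => (hD s (Ico_subset_Icc_self hs)).derivWithin
        (uniqueDiffOn_Icc (hs.1.trans_lt hs.2) s (Ico_subset_Icc_self hs))) s hs
    rw [h1, hJ0, hΦ0]
    simp [ContinuousLinearMap.det]
  have hdiff : ∀ z, HasFDerivAt (fun w => Φ w t) (J z t) z := fun z =>
    hasFDerivAt_of_isSolution hK hA hAc hΦ0 hΦ (hJ0 z) (hJ1 z) ht
  have hΦm : Measurable fun w => Φ w t :=
    (continuous_iff_continuousAt.2 fun z => (hdiff z).continuousAt).measurable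
  have hinj : Function.Injective fun w => Φ w t := by
    intro z w h
    have hs : Icc a t ⊆ Icc a b := Icc_subset_Icc_right ht.2
    have := ((hΦ z).mono hs).eq_of_eq_right hK ht.1 ((hΦ w).mono hs) h
    rwa [hΦ0, hΦ0] at this
  have := hprob t ht
  have := hprob a ha
  have := Measure.isProbabilityMeasure_map
    (μ := volume.withDensity fun z => ENNReal.ofReal (p a z)) hΦm.aemeasurable
  refine Measure.eq_of_le_of_isProbabilityMeasure ?_
  refine Measure.le_iff.2 fun B hB => ?_
  rw [Measure.map_apply hΦm hB, withDensity_apply _ (hΦm hB), withDensity_apply _ hB]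
  have h1 : ∀ z, ENNReal.ofReal (p a z) =
      ENNReal.ofReal |(J z t).det| * ENNReal.ofReal (p t (Φ z t)) := fun z => by
    have h2 := hdet z t ht
    have h3 := hp t ht (Φ z t)
    have h4 : 0 < (J z t).det := by
      have := hp a ha z
      rw [← h2] at this
      exact pos_of_mul_pos_left this h3.le
    rw [abs_of_pos h4, ← ENNReal.ofReal_mul h4.le, h2]
  simp_rw [h1]
  rw [← lintegral_image_eq_lintegral_abs_det_fderiv_mul volume (hΦm hB)
    (fun z _ => (hdiff z).hasFDerivWithinAt) hinj.injOn (fun z => ENNReal.ofReal (p t z))]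
  exact lintegral_mono_set (image_preimage_subset _ _)

end CMError

namespace CMError
open Set Filter Topology
variable {d : ℕ}

theorem eLpNorm_two_eq {Ω F : Type*} [MeasurableSpace Ω] [NormedAddCommGroup F] (μ : Measure Ω)
    (f : Ω → F) : eLpNorm f 2 μ = (∫⁻ x, ‖f x‖ₑ ^ 2 ∂μ) ^ ((1 : ℝ) / 2) := by
  rw [eLpNorm_eq_lintegral_rpow_enorm_toReal two_ne_zero ENNReal.ofNat_ne_top]
  simp

theorem eLpNorm_two_le_ofReal {Ω F : Type*} [MeasurableSpace Ω] [NormedAddCommGroup F]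
    {μ : Measure Ω} {f : Ω → F} {c : ℝ} (hc : 0 ≤ c)
    (h : ∫⁻ x, ‖f x‖ₑ ^ 2 ∂μ ≤ ENNReal.ofReal (c ^ 2)) : eLpNorm f 2 μ ≤ ENNReal.ofReal c := by
  rw [eLpNorm_two_eq]
  refine (ENNReal.rpow_le_rpow h (by positivity)).trans (le_of_eq ?_)
  rw [ENNReal.ofReal_rpow_of_nonneg (by positivity) (by positivity), ← Real.sqrt_eq_rpow,
    Real.sqrt_sq hc]

theorem W2_le_eLpNorm {μ ν : Measure (Space d)} {γ : Measure (Space d × Space d)}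
    (h1 : γ.map Prod.fst = μ) (h2 : γ.map Prod.snd = ν) :
    W2 μ ν ≤ eLpNorm (fun z => z.1 - z.2) 2 γ := by
  rw [eLpNorm_two_eq, W2]
  exact ENNReal.rpow_le_rpow (iInf₂_le γ ⟨h1, h2⟩) (by positivity)

theorem exists_coupling_lt {μ ν : Measure (Space d)} {c : ℝ≥0∞} (h : W2 μ ν < c) :
    ∃ γ : Measure (Space d × Space d), γ.map Prod.fst = μ ∧ γ.map Prod.snd = ν ∧
      eLpNorm (fun z => z.1 - z.2) 2 γ < c := by
  have h1 : (⨅ γ ∈ {γ : Measure (Space d × Space d) | γ.map Prod.fst = μ ∧ γ.map Prod.snd = ν},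
      ∫⁻ z, ‖z.1 - z.2‖ₑ ^ 2 ∂γ) < c ^ (2 : ℝ) := by
    by_contra! hcon
    have := ENNReal.rpow_le_rpow hcon (show (0 : ℝ) ≤ 1 / 2 by positivity)
    rw [← ENNReal.rpow_mul] at this
    norm_num at this
    rw [W2] at h
    norm_num at h
    exact absurd h this.not_gt
  obtain ⟨γ, h2⟩ := iInf_lt_iff.1 h1
  obtain ⟨⟨h3, h4⟩, h5⟩ := iInf_lt_iff.1 h2
  refine ⟨γ, h3, h4, ?_⟩
  rw [eLpNorm_two_eq]
  have := ENNReal.rpow_lt_rpow h5 (show (0 : ℝ) < 1 / 2 by positivity)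
  rwa [← ENNReal.rpow_mul, show (2 : ℝ) * (1 / 2) = 1 by norm_num, ENNReal.rpow_one] at this

/-- The gluing lemma, and with it the triangle inequality for the Wasserstein distance. -/
theorem W2_triangle (μ ν ρ : Measure (Space d)) [IsFiniteMeasure μ] [IsFiniteMeasure ν] :
    W2 μ ρ ≤ W2 μ ν + W2 ν ρ := by
  refine ENNReal.le_of_forall_pos_le_add fun ε hε htop => ?_
  have hε' : (0 : ℝ≥0∞) < ε / 2 := by simpa using hε.ne'
  rw [ENNReal.add_lt_top] at htop
  obtain ⟨γ, a1, a2, a3⟩ := exists_coupling_lt (ENNReal.lt_add_right htop.1.ne hε'.ne')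
  obtain ⟨γ', b1, b2, b3⟩ := exists_coupling_lt (ENNReal.lt_add_right htop.2.ne hε'.ne')
  have : IsFiniteMeasure γ := ⟨by
    have := measure_lt_top μ univ
    rwa [← a1, Measure.map_apply measurable_fst .univ, preimage_univ] at this⟩
  have : IsFiniteMeasure γ' := ⟨by
    have := measure_lt_top ν univ
    rwa [← b1, Measure.map_apply measurable_fst .univ, preimage_univ] at this⟩
  set π := γ ⊗ₘ (γ'.condKernel.comap Prod.snd measurable_snd) with hπ
  have c1 : π.map Prod.fst = γ := Measure.fst_compProd _ _
  have c2 : π.map (fun q => (q.1.2, q.2)) = γ' := by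
    refine Measure.ext_of_lintegral _ fun g hg => ?_
    have h1 : γ'.fst = γ.map Prod.snd := by rw [a2, ← b1]; rfl
    rw [lintegral_map hg (by fun_prop), hπ, Measure.lintegral_compProd (by fun_prop)]
    conv_rhs => rw [← γ'.disintegrate γ'.condKernel, h1, Measure.lintegral_compProd hg,
      lintegral_map (hg.lintegral_kernel_prod_right') measurable_snd]
    rfl
  have hfst : (π.map fun q => (q.1.1, q.2)).map Prod.fst = μ := by
    rw [Measure.map_map (by fun_prop) (by fun_prop), ← a1, ← c1,
      Measure.map_map (by fun_prop) (by fun_prop)]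
    rfl
  have hsnd : (π.map fun q => (q.1.1, q.2)).map Prod.snd = ρ := by
    rw [Measure.map_map (by fun_prop) (by fun_prop), ← b2, ← c2,
      Measure.map_map (by fun_prop) (by fun_prop)]
    rfl
  refine (W2_le_eLpNorm hfst hsnd).trans ?_
  have hm : ∀ μ : Measure (Space d × Space d),
      AEStronglyMeasurable (fun z : Space d × Space d => z.1 - z.2) μ := fun μ =>
    Measurable.aestronglyMeasurable (by fun_prop)
  rw [eLpNorm_map_measure (hm _) (by fun_prop)]
  rw [← c1, eLpNorm_map_measure (hm _) (by fun_prop)] at a3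
  rw [← c2, eLpNorm_map_measure (hm _) (by fun_prop)] at b3
  have hsum : ((fun z : Space d × Space d => z.1 - z.2) ∘ fun q : (Space d × Space d) × Space d =>
      (q.1.1, q.2)) = ((fun z : Space d × Space d => z.1 - z.2) ∘ Prod.fst) +
      ((fun z : Space d × Space d => z.1 - z.2) ∘ fun q : (Space d × Space d) × Space d =>
      (q.1.2, q.2)) := by
    ext1 q
    simp
  rw [hsum]
  refine (eLpNorm_add_le (Measurable.aestronglyMeasurable (by fun_prop))
    (Measurable.aestronglyMeasurable (by fun_prop)) one_le_two).trans ?_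
  refine (add_le_add a3.le b3.le).trans (le_of_eq ?_)
  rw [add_add_add_comm, ENNReal.add_halves]

theorem W2_map_map_le {Ω : Type*} [MeasurableSpace Ω] {μ : Measure Ω} {f g : Ω → Space d}
    (hf : Measurable f) (hg : Measurable g) :
    W2 (μ.map f) (μ.map g) ≤ eLpNorm (fun x => f x - g x) 2 μ := by
  have h := W2_le_eLpNorm (γ := μ.map fun x => (f x, g x)) (μ := μ.map f) (ν := μ.map g)
    (by rw [Measure.map_map (by fun_prop) (by fun_prop)]; rfl)
    (by rw [Measure.map_map (by fun_prop) (by fun_prop)]; rfl)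
  rwa [eLpNorm_map_measure (Measurable.aestronglyMeasurable (by fun_prop)) (by fun_prop)] at h

theorem lintegral_enorm_sq_stdGaussian (d : ℕ) :
    ∫⁻ x, ‖x‖ₑ ^ 2 ∂(stdGaussian (Space d)) = ENNReal.ofReal d := by
  have hL : ∀ i : Fin d, MemLp (fun x : Space d => x i) 2 (stdGaussian (Space d)) := fun i =>
    (EuclideanSpace.proj (𝕜 := ℝ) i : Space d →L[ℝ] ℝ).comp_memLp' IsGaussian.memLp_two_id
  have h1 : ∀ i : Fin d, ∫ x, x i ^ 2 ∂(stdGaussian (Space d)) = 1 := by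
    intro i
    have h := variance_dual_stdGaussian (E := Space d)
      (innerSL ℝ (EuclideanSpace.single i (1 : ℝ)))
    rw [variance_eq_integral (by fun_prop), integral_strongDual_stdGaussian] at h
    simpa [EuclideanSpace.inner_single_left] using h
  have hi : ∀ i : Fin d, Integrable (fun x : Space d => x i ^ 2) (stdGaussian (Space d)) :=
    fun i => (hL i).integrable_sq
  have h2 : ∫ x, ‖x‖ ^ 2 ∂(stdGaussian (Space d)) = d := by
    simp_rw [EuclideanSpace.real_norm_sq_eq]
    rw [integral_finsetSum _ fun i _ => hi i]
    simp [h1]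
  have h3 : Integrable (fun x => ‖x‖ ^ 2) (stdGaussian (Space d)) := by
    simp_rw [EuclideanSpace.real_norm_sq_eq]
    exact integrable_finsetSum _ fun i _ => hi i
  rw [← h2, ofReal_integral_eq_lintegral_ofReal h3 (.of_forall fun x => by positivity)]
  simp_rw [ENNReal.ofReal_pow (norm_nonneg _), ofReal_norm]

theorem ouLaw_eq_map (P : Measure (Space d)) [IsProbabilityMeasure P] (t : ℝ) :
    ouLaw P t = (P.prod (stdGaussian (Space d))).map
      fun q => Real.exp (-t) • q.1 + √(1 - Real.exp (-2 * t)) • q.2 := by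
  rw [ouLaw, Measure.conv, Measure.map_prod_map _ _ (by fun_prop) (by fun_prop),
    Measure.map_map (by fun_prop) (by fun_prop)]
  rfl

theorem eLpNorm_smul_fst_add_smul_snd_le {P : Measure (Space d)} [IsProbabilityMeasure P] {m₂ : ℝ}
    (h2 : Integrable (fun x => ‖x‖ ^ 2) P) (hm₂ : ∫ x, ‖x‖ ^ 2 ∂P = m₂ ^ 2)
    {α β c : ℝ} (hc : 0 ≤ c) (h : 2 * α ^ 2 * m₂ ^ 2 + 2 * β ^ 2 * d ≤ c ^ 2) :
    eLpNorm (fun q : Space d × Space d => α • q.1 + β • q.2) 2 (P.prod (stdGaussian (Space d))) ≤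
      ENNReal.ofReal c := by
  refine eLpNorm_two_le_ofReal hc (le_trans ?_ (ENNReal.ofReal_le_ofReal h))
  have hP : ∫⁻ x, ‖x‖ₑ ^ 2 ∂P = ENNReal.ofReal (m₂ ^ 2) := by
    rw [← hm₂, ofReal_integral_eq_lintegral_ofReal h2 (.of_forall fun x => by positivity)]
    simp_rw [ENNReal.ofReal_pow (norm_nonneg _), ofReal_norm]
  calc ∫⁻ q : Space d × Space d, ‖α • q.1 + β • q.2‖ₑ ^ 2 ∂(P.prod (stdGaussian (Space d)))
      ≤ ∫⁻ q : Space d × Space d, (ENNReal.ofReal (2 * α ^ 2) * ‖q.1‖ₑ ^ 2 +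
        ENNReal.ofReal (2 * β ^ 2) * ‖q.2‖ₑ ^ 2) ∂(P.prod (stdGaussian (Space d))) := by
        refine lintegral_mono fun q => ?_
        dsimp only
        rw [← ofReal_norm, ← ofReal_norm, ← ofReal_norm, ← ENNReal.ofReal_pow (norm_nonneg _),
          ← ENNReal.ofReal_pow (norm_nonneg _), ← ENNReal.ofReal_pow (norm_nonneg _),
          ← ENNReal.ofReal_mul (by positivity), ← ENNReal.ofReal_mul (by positivity),
          ← ENNReal.ofReal_add (by positivity) (by positivity)]
        refine ENNReal.ofReal_le_ofReal ?_
        have h1 := norm_add_le (α • q.1) (β • q.2)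
        rw [norm_smul, norm_smul, Real.norm_eq_abs, Real.norm_eq_abs] at h1
        have h2 : ‖α • q.1 + β • q.2‖ ^ 2 ≤ (|α| * ‖q.1‖ + |β| * ‖q.2‖) ^ 2 := by gcongr
        nlinarith [sq_nonneg (|α| * ‖q.1‖ - |β| * ‖q.2‖), sq_abs α, sq_abs β]
    _ = _ := by
        rw [lintegral_add_left (by fun_prop), lintegral_const_mul _ (by fun_prop),
          lintegral_const_mul _ (by fun_prop)]
        have e1 : ∫⁻ q : Space d × Space d, ‖q.1‖ₑ ^ 2 ∂(P.prod (stdGaussian (Space d))) =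
            ∫⁻ x, ‖x‖ₑ ^ 2 ∂P := by
          rw [lintegral_prod _ (by fun_prop)]
          simp
        have e2 : ∫⁻ q : Space d × Space d, ‖q.2‖ₑ ^ 2 ∂(P.prod (stdGaussian (Space d))) =
            ∫⁻ x, ‖x‖ₑ ^ 2 ∂(stdGaussian (Space d)) := by
          rw [lintegral_prod _ (by fun_prop)]
          simp
        rw [e1, e2, hP, lintegral_enorm_sq_stdGaussian, ← ENNReal.ofReal_mul (by positivity),
          ← ENNReal.ofReal_mul (by positivity), ← ENNReal.ofReal_add (by positivity) (by positivity)]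

/-- The contraction of the Ornstein-Uhlenbeck process towards its equilibrium, seen through a
Lipschitz map. -/
theorem W2_map_stdGaussian_map_ouLaw_le {P : Measure (Space d)} [IsProbabilityMeasure P] {m₂ : ℝ}
    (h2 : Integrable (fun x => ‖x‖ ^ 2) P) (hm₂ : ∫ x, ‖x‖ ^ 2 ∂P = m₂ ^ 2) (h0 : 0 ≤ m₂) {T : ℝ}
    (hT : 0 ≤ T) {L : ℝ≥0} {f : Space d → Space d} (hf : LipschitzWith L f) :
    W2 ((stdGaussian (Space d)).map f) ((ouLaw P T).map f) ≤
      ENNReal.ofReal (2 * (max √(d : ℝ) m₂ * L * Real.exp (-T))) := by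
  have hfm : Measurable f := hf.continuous.measurable
  have e1 : stdGaussian (Space d) = (P.prod (stdGaussian (Space d))).map Prod.snd := by
    rw [← Measure.snd, Measure.snd_prod]
  have e2 : (stdGaussian (Space d)).map f =
      (P.prod (stdGaussian (Space d))).map fun q => f q.2 := by
    conv_lhs => rw [e1, Measure.map_map hfm (by fun_prop)]
    rfl
  rw [e2, ouLaw_eq_map, Measure.map_map hfm (by fun_prop)]
  refine (W2_map_map_le (by fun_prop) (by fun_prop)).trans ?_
  set a := Real.exp (-T) with ha
  have ha0 : 0 < a := Real.exp_pos _
  have ha1 : a ≤ 1 := Real.exp_le_one_iff.2 (by linarith)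
  have ha2 : Real.exp (-2 * T) = a ^ 2 := by rw [ha, ← Real.exp_nat_mul]; congr 1; push_cast; ring
  rw [ha2]
  set b := √(1 - a ^ 2) with hb
  have hb1 : b ≤ 1 := Real.sqrt_le_one.2 (by nlinarith)
  have hb2 : 1 - a ≤ b := Real.le_sqrt_of_sq_le (by nlinarith)
  have hM : m₂ ^ 2 ≤ max √(d : ℝ) m₂ ^ 2 := by gcongr; exact le_max_right _ _
  have hM' : (d : ℝ) ≤ max √(d : ℝ) m₂ ^ 2 := by
    conv_lhs => rw [← Real.sq_sqrt (Nat.cast_nonneg d)]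
    gcongr
    exact le_max_left _ _
  have hmax : 0 ≤ max √(d : ℝ) m₂ := le_max_of_le_left (Real.sqrt_nonneg _)
  have hmain := eLpNorm_smul_fst_add_smul_snd_le h2 hm₂ (α := -a) (β := 1 - b)
    (c := 2 * (max √(d : ℝ) m₂ * a)) (by positivity) (by
      have h3 : (1 - b) ^ 2 ≤ a ^ 2 := by
        apply pow_le_pow_left₀ <;> linarith
      have h4 := mul_le_mul h3 hM' (Nat.cast_nonneg d) (sq_nonneg a)
      have h5 := mul_le_mul_of_nonneg_left hM (sq_nonneg a)
      nlinarith)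
  refine (eLpNorm_le_nnreal_smul_eLpNorm_of_ae_le_mul (c := L) (g := fun q : Space d × Space d =>
    (-a) • q.1 + (1 - b) • q.2) (.of_forall fun q => ?_) 2).trans ?_
  · refine (hf.norm_sub_le _ _).trans (le_of_eq ?_)
    congr 2
    simp only [sub_smul, neg_smul, one_smul]
    abel
  · rw [ENNReal.smul_def, smul_eq_mul, show 2 * (max √(d : ℝ) m₂ * L * a) =
      L * (2 * (max √(d : ℝ) m₂ * a)) by ring, ENNReal.ofReal_mul L.coe_nonneg,
      ENNReal.ofReal_coe_nnreal]
    gcongr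

theorem W2_ouLaw_le {P : Measure (Space d)} [IsProbabilityMeasure P] {m₂ : ℝ}
    (h2 : Integrable (fun x => ‖x‖ ^ 2) P) (hm₂ : ∫ x, ‖x‖ ^ 2 ∂P = m₂ ^ 2) (h0 : 0 ≤ m₂) {δ : ℝ}
    (hδ : 0 < δ) : W2 (ouLaw P δ) P ≤ ENNReal.ofReal (3 * (max √(d : ℝ) m₂ * √δ)) := by
  have e1 : P = (P.prod (stdGaussian (Space d))).map Prod.fst := by
    rw [← Measure.fst, Measure.fst_prod]
  conv_lhs =>
    arg 2
    rw [e1]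
  rw [ouLaw_eq_map]
  refine (W2_map_map_le (by fun_prop) (by fun_prop)).trans ?_
  set a := Real.exp (-δ) with ha
  have ha0 : 0 < a := Real.exp_pos _
  have ha1 : a ≤ 1 := Real.exp_le_one_iff.2 (by linarith)
  have ha2 : Real.exp (-2 * δ) = a ^ 2 := by rw [ha, ← Real.exp_nat_mul]; congr 1; push_cast; ring
  have ha3 : 1 - δ ≤ a := by have := Real.add_one_le_exp (-δ); linarith
  rw [ha2]
  have hM : m₂ ^ 2 ≤ max √(d : ℝ) m₂ ^ 2 := by gcongr; exact le_max_right _ _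
  have hM' : (d : ℝ) ≤ max √(d : ℝ) m₂ ^ 2 := by
    conv_lhs => rw [← Real.sq_sqrt (Nat.cast_nonneg d)]
    gcongr
    exact le_max_left _ _
  have hmax : 0 ≤ max √(d : ℝ) m₂ := le_max_of_le_left (Real.sqrt_nonneg _)
  have hmain := eLpNorm_smul_fst_add_smul_snd_le h2 hm₂ (α := a - 1) (β := √(1 - a ^ 2))
    (c := 3 * (max √(d : ℝ) m₂ * √δ)) (by positivity) (by
      rw [Real.sq_sqrt (by nlinarith), mul_pow, mul_pow, Real.sq_sqrt hδ.le]
      have h3 : (a - 1) ^ 2 ≤ δ := by nlinarith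
      have h4 : 1 - a ^ 2 ≤ 2 * δ := by nlinarith
      have h5 := mul_le_mul h3 hM (sq_nonneg _) hδ.le
      have h6 := mul_le_mul h4 hM' (Nat.cast_nonneg d) (by positivity)
      nlinarith [mul_nonneg hδ.le (sq_nonneg (max √(d : ℝ) m₂))])
  refine le_trans (le_of_eq ?_) hmain
  congr 1
  ext1 q
  simp only [sub_smul, one_smul]
  abel

end CMError

namespace CMError
open Set Filter Topology
variable {d : ℕ}

variable {P : Measure (Space d)} [IsProbabilityMeasure P]

theorem score_eq {t : ℝ} (ht : 0 < t) (x : Space d) :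
    score P t x = Real.exp t • heatScore P (heatTime t, Real.exp t • x) := by
  have hτ := heatTime_pos ht
  rw [heatScore_eq_gradient hτ, score, gradient, gradient, ← map_smul]
  congr 1
  have h1 : ∀ z, Real.log (ouDensity P t z) = Real.log (Real.exp t ^ d) +
      Real.log (heatDensity P (heatTime t, Real.exp t • z)) := fun z => by
    rw [ouDensity_eq P ht, Real.log_mul (by positivity) (heatDensity_pos P hτ).ne']
  simp_rw [h1]
  rw [fderiv_const_add, fderiv_comp_smul (f := fun w => Real.log (heatDensity P (heatTime t, w)))]

theorem heatScore_eq_smul_score {t : ℝ} (ht : 0 < t) (z : Space d) :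
    heatScore P (heatTime t, z) = Real.exp (-t) • score P t (Real.exp (-t) • z) := by
  rw [score_eq ht, smul_smul, smul_smul, ← Real.exp_add, ← Real.exp_add]
  simp

theorem lipschitzWith_heatScore {t : ℝ} (ht : 0 < t) {L : ℝ≥0} (hL : LipschitzWith L (score P t)) :
    LipschitzWith (Real.toNNReal (Real.exp (-(2 * t))) * L) fun z => heatScore P (heatTime t, z) := by
  refine LipschitzWith.of_dist_le_mul fun z w => ?_
  rw [heatScore_eq_smul_score ht, heatScore_eq_smul_score ht, dist_smul₀]
  have h := hL.dist_le_mul (Real.exp (-t) • z) (Real.exp (-t) • w)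
  rw [dist_smul₀] at h
  rw [Real.norm_of_nonneg (Real.exp_pos _).le] at h ⊢
  push_cast
  rw [Real.coe_toNNReal _ (Real.exp_pos _).le]
  refine (mul_le_mul_of_nonneg_left h (Real.exp_pos _).le).trans (le_of_eq ?_)
  rw [show -(2 * t) = -t + -t by ring, Real.exp_add]
  ring

theorem fderiv_heatScore_time {p : ℝ × Space d} (hp : 0 < p.1) :
    fderiv ℝ (heatScore P) p (1, 0) = (1 / 2 : ℝ) • heatRatioGrad P p := by
  have h1 : ∀ q : ℝ × Space d, 0 < q.1 →
      fderiv ℝ (fun q => Real.log (heatDensity P q)) q (1, 0) = (1 / 2 : ℝ) * heatRatio P q := by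
    intro q hq
    have hU := heatDensity_pos P hq
    rw [((differentiableAt_heatDensity hq).hasFDerivAt.log hU.ne').fderiv, smul_apply,
      fderiv_heatDensity_time hq, smul_eq_mul]
    field_simp
  ext i
  rw [fderiv_heatScore_apply hp]
  have h2 : fderiv ℝ (heatScoreComp P i) p (1, 0) = _ :=
    fderiv_fderiv_comm (mod_cast contDiffAt_infty.1 (contDiffAt_log_heatDensity hp) 2) _ _
  rw [h2, fderiv_congr_pos h1 hp, fderiv_const_mul (isRatio_heatRatio.differentiableAt hp)]
  rfl

/-- The velocity of the probability flow, in heat coordinates, at time `t`. -/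
noncomputable def probFlow (P : Measure (Space d)) (t : ℝ) (z : Space d) : Space d :=
  -(Real.exp (2 * t) • heatScore P (heatTime t, z))

/-- The time derivative of the score along the probability flow, in heat coordinates. -/
noncomputable def scoreVelocity (P : Measure (Space d)) (t : ℝ) (z : Space d) : Space d :=
  Real.exp t • heatScore P (heatTime t, z) + Real.exp (3 * t) •
    (heatRatioGrad P (heatTime t, z) - heatHessMap P (heatTime t, z) (heatScore P (heatTime t, z)))

theorem hasDerivAt_heatTime (t : ℝ) : HasDerivAt heatTime (2 * Real.exp (2 * t)) t := by
  have h1 : HasDerivAt (fun t : ℝ => 2 * t) 2 t := by simpa using (hasDerivAt_id t).const_mul 2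
  exact (h1.exp.sub_const 1).congr_deriv (by ring)

theorem continuous_heatTime : Continuous heatTime := by unfold heatTime; fun_prop

section
variable {a b : ℝ} {y : ℝ → Space d}

theorem hasDerivWithinAt_heatScore_flow {t : ℝ} (ht : 0 < t)
    (hy : HasDerivWithinAt y (probFlow P t (y t)) (Icc a b) t) :
    HasDerivWithinAt (fun u => Real.exp u • heatScore P (heatTime u, y u))
      (scoreVelocity P t (y t)) (Icc a b) t := by
  have hp : 0 < ((heatTime t, y t) : ℝ × Space d).1 := heatTime_pos ht
  have h1 := (differentiableAt_heatScore (P := P) hp).hasFDerivAt.comp_hasDerivWithinAt t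
    ((hasDerivAt_heatTime t).hasDerivWithinAt.prodMk hy)
  have h2 := (Real.hasDerivAt_exp t).hasDerivWithinAt.fun_smul h1 (s := Icc a b)
  refine h2.congr_deriv ?_
  have h3 : ((2 * Real.exp (2 * t), probFlow P t (y t)) : ℝ × Space d) =
      (2 * Real.exp (2 * t)) • ((1 : ℝ), (0 : Space d)) + (0, probFlow P t (y t)) := by simp
  have h4 : fderiv ℝ (heatScore P) (heatTime t, y t) (0, probFlow P t (y t)) =
      heatHessMap P (heatTime t, y t) (probFlow P t (y t)) := rfl
  rw [h3, map_add, map_smul, h4, fderiv_heatScore_time hp, probFlow, map_neg, map_smul,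
    scoreVelocity, show 3 * t = t + 2 * t by ring, Real.exp_add]
  simp only [Function.comp]
  module

theorem hasDerivWithinAt_heatDensity_flow {t : ℝ} (ht : 0 < t)
    (hy : HasDerivWithinAt y (probFlow P t (y t)) (Icc a b) t) :
    HasDerivWithinAt (fun u => heatDensity P (heatTime u, y u))
      (-(∑ i, (-(Real.exp (2 * t) • heatHessMap P (heatTime t, y t)))
        (EuclideanSpace.single i 1) i) * heatDensity P (heatTime t, y t)) (Icc a b) t := by
  have hp : 0 < ((heatTime t, y t) : ℝ × Space d).1 := heatTime_pos ht
  have h1 := (differentiableAt_heatDensity (P := P) hp).hasFDerivAt.comp_hasDerivWithinAt t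
    ((hasDerivAt_heatTime t).hasDerivWithinAt.prodMk hy)
  refine h1.congr_deriv ?_
  have h3 : ((2 * Real.exp (2 * t), probFlow P t (y t)) : ℝ × Space d) =
      (2 * Real.exp (2 * t)) • ((1 : ℝ), (0 : Space d)) + (0, probFlow P t (y t)) := by simp
  have h4 : ∀ v, fderiv ℝ (heatDensity P) (heatTime t, y t) (0, v) =
      heatDensity P (heatTime t, y t) * inner ℝ (heatScore P (heatTime t, y t)) v := by
    intro v
    have h5 : fderiv ℝ (fun q => Real.log (heatDensity P q)) (heatTime t, y t) (0, v) =
        inner ℝ (heatScore P (heatTime t, y t)) v := by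
      rw [fderiv_space_eq_sum, inner_eq_sum]
      rfl
    have hU := heatDensity_pos P hp
    rw [← h5, ((differentiableAt_heatDensity hp).hasFDerivAt.log hU.ne').fderiv, smul_apply,
      smul_eq_mul]
    field_simp
  have h6 : heatRatio P (heatTime t, y t) = ∑ i, heatHess P i i (heatTime t, y t) +
      ‖heatScore P (heatTime t, y t)‖ ^ 2 := by
    rw [norm_sq_heatScore, ← Finset.sum_add_distrib]; rfl
  rw [h3, map_add, map_smul, h4, fderiv_heatDensity_time hp, probFlow, inner_neg_right,
    real_inner_smul_right, real_inner_self_eq_norm_sq, h6]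
  simp only [neg_apply, smul_apply, PiLp.neg_apply, PiLp.smul_apply, heatHessMap_single hp,
    smul_eq_mul, Finset.sum_neg_distrib, ← Finset.mul_sum]
  ring

end

end CMError

namespace CMError
open Set Filter Topology
variable {d : ℕ}
variable {P : Measure (Space d)} [IsProbabilityMeasure P]

theorem continuousOn_heatRatioGrad : ContinuousOn (heatRatioGrad P) {p | 0 < p.1} :=
  (PiLp.continuous_toLp 2 _).comp_continuousOn
    (continuousOn_pi.2 fun i => (isRatio_heatRatio.spaceDeriv i).contDiffOn.continuousOn)

theorem continuousOn_heatHessMap : ContinuousOn (heatHessMap P) {p | 0 < p.1} :=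
  (contDiffOn_heatScore.continuousOn_fderiv_of_isOpen isOpen_pos_time (by simp)).clm_comp
    continuousOn_const

theorem continuousOn_scoreVelocity :
    ContinuousOn (fun q : ℝ × Space d => scoreVelocity P q.1 q.2) {q | 0 < q.1} := by
  have hτ : ContinuousOn (fun q : ℝ × Space d => (heatTime q.1, q.2)) {q | 0 < q.1} :=
    ((continuous_heatTime.comp continuous_fst).prodMk continuous_snd).continuousOn
  have hm : MapsTo (fun q : ℝ × Space d => (heatTime q.1, q.2)) {q | 0 < q.1} {p | 0 < p.1} :=
    fun q hq => heatTime_pos hq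
  have h1 := contDiffOn_heatScore (P := P).continuousOn.comp hτ hm
  have h2 := (continuousOn_heatRatioGrad (P := P)).comp hτ hm
  have h3 := (continuousOn_heatHessMap (P := P)).comp hτ hm
  have h4 : Continuous fun q : ℝ × Space d => Real.exp q.1 := by fun_prop
  have h5 : Continuous fun q : ℝ × Space d => Real.exp (3 * q.1) := by fun_prop
  exact (h4.continuousOn.smul h1).add (h5.continuousOn.smul (h2.sub (h3.clm_apply h1)))

theorem continuous_scoreVelocity {t : ℝ} (ht : 0 < t) : Continuous (scoreVelocity P t) :=
  continuous_iff_continuousAt.2 fun z =>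
    (continuousOn_scoreVelocity.continuousAt (isOpen_pos_time.mem_nhds (x := (t, z)) ht)).comp
      (f := fun z => (t, z)) (by fun_prop)

theorem exp_mul_integral_norm_heatScore_sq_le {t : ℝ} (ht : 0 < t) {L : ℝ≥0}
    (hL : LipschitzWith L (score P t)) :
    Real.exp t ^ 2 * ∫ z, ‖heatScore P (heatTime t, z)‖ ^ 2 ∂(heatLaw P (heatTime t)) ≤ d * L := by
  have h := integral_norm_heatScore_sq_le (heatTime_pos ht) (lipschitzWith_heatScore ht hL)
  refine (mul_le_mul_of_nonneg_left h (by positivity)).trans (le_of_eq ?_)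
  push_cast
  rw [Real.coe_toNNReal _ (Real.exp_pos _).le, ← Real.exp_nat_mul,
    show Real.exp ((2 : ℕ) * t) * (d * (Real.exp (-(2 * t)) * L)) =
      Real.exp ((2 : ℕ) * t) * Real.exp (-(2 * t)) * (d * L) by ring, ← Real.exp_add]
  simp

theorem exp_mul_norm_heatHessMap_le {t : ℝ} (ht : 0 < t) {L : ℝ≥0}
    (hL : LipschitzWith L (score P t)) (z : Space d) :
    Real.exp t ^ 2 * ‖heatHessMap P (heatTime t, z)‖ ≤ L := by
  have h := norm_heatHessMap_le (heatTime_pos ht) (lipschitzWith_heatScore ht hL) z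
  refine (mul_le_mul_of_nonneg_left h (by positivity)).trans (le_of_eq ?_)
  push_cast
  rw [Real.coe_toNNReal _ (Real.exp_pos _).le, ← Real.exp_nat_mul, ← mul_assoc, ← Real.exp_add]
  simp

theorem half_le_one_sub_exp_neg {w : ℝ} (h0 : 0 ≤ w) (h1 : w ≤ 1) :
    w / 2 ≤ 1 - Real.exp (-w) := by
  have h2 := Real.add_one_le_exp w
  have h3 : Real.exp (-w) * Real.exp w = 1 := by rw [← Real.exp_add]; simp
  have h4 : Real.exp (-w) ≤ 1 := Real.exp_le_one_iff.2 (by linarith)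
  nlinarith [Real.exp_pos (-w)]

theorem exp_mul_integral_norm_heatRatioGrad_sq_le {t : ℝ} (ht : 0 < t) {L : ℝ≥0}
    (hL : ∀ s, 0 < s → s ≤ t → LipschitzWith L (score P s)) :
    (Real.exp t ^ 3) ^ 2 *
      ∫ z, ‖heatRatioGrad P (heatTime t, z)‖ ^ 2 ∂(heatLaw P (heatTime t)) ≤
      18 * d * (L : ℝ) ^ 2 * (L + 2 + 2 / t) := by
  set w := min t 1 with hw
  have hw0 : 0 < w := lt_min ht one_pos
  have hw1 : w ≤ 1 := min_le_right _ _
  have hwt : w ≤ t := min_le_left _ _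
  have hs : 0 < t - w / 2 := by linarith
  set s := t - w / 2 with hsdef
  set r := heatTime t - heatTime s with hr
  have hrv : r = Real.exp t ^ 2 * (1 - Real.exp (-w)) := by
    rw [hr, heatTime, heatTime, hsdef, ← Real.exp_nat_mul, mul_one_sub, ← Real.exp_add]
    push_cast
    rw [show 2 * t + -w = 2 * (t - w / 2) by ring]
    ring
  have hhalf := half_le_one_sub_exp_neg hw0.le hw1
  have hr0 : 0 < r := by
    rw [hrv]
    have : 0 < 1 - Real.exp (-w) := by linarith
    positivity
  have hsum : heatTime s + r = heatTime t := by rw [hr]; ring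
  have h := integral_norm_heatRatioGrad_sq_le (P := P) (heatTime_pos hs) hr0
    (by rw [hsum]; exact lipschitzWith_heatScore ht (hL t ht le_rfl))
    (lipschitzWith_heatScore hs (hL s hs (by linarith)))
  rw [hsum] at h
  refine (mul_le_mul_of_nonneg_left h (by positivity)).trans ?_
  push_cast
  rw [Real.coe_toNNReal _ (Real.exp_pos _).le, Real.coe_toNNReal _ (Real.exp_pos _).le]
  have e1 : Real.exp t ^ 2 * Real.exp (-(2 * t)) = 1 := by
    rw [← Real.exp_nat_mul, ← Real.exp_add]; simp
  have e2 : Real.exp (-(2 * s)) = Real.exp (-(2 * t)) * Real.exp w := by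
    rw [← Real.exp_add, hsdef]; congr 1; ring
  have e3 : Real.exp t ^ 2 * r⁻¹ = (1 - Real.exp (-w))⁻¹ := by
    rw [hrv, mul_inv, ← mul_assoc, mul_inv_cancel₀ (by positivity), one_mul]
  have e4 : (1 - Real.exp (-w))⁻¹ ≤ 2 + 2 / t := by
    have h1 : (1 - Real.exp (-w))⁻¹ ≤ (w / 2)⁻¹ := by gcongr
    refine h1.trans ?_
    rcases min_choice t 1 with h2 | h2
    · rw [hw, h2, inv_div]
      linarith
    · rw [hw, h2]
      have : 0 ≤ 2 / t := by positivity
      norm_num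
      exact this
  have e5 : Real.exp w ^ 2 ≤ 9 := by
    have h1 : Real.exp w ≤ 3 := (Real.exp_le_exp.2 hw1).trans (Real.exp_one_lt_d9.le.trans (by norm_num))
    nlinarith [Real.exp_pos w]
  calc (Real.exp t ^ 3) ^ 2 * ((Real.exp (-(2 * t)) * L + r⁻¹) *
        (2 * d * (Real.exp (-(2 * s)) * L) ^ 2))
      = (Real.exp t ^ 2 * Real.exp (-(2 * t)) * L + Real.exp t ^ 2 * r⁻¹) *
        (2 * d * (Real.exp t ^ 2 * Real.exp (-(2 * t))) ^ 2 * Real.exp w ^ 2 * (L : ℝ) ^ 2) := by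
        rw [e2]; ring
    _ = (L + (1 - Real.exp (-w))⁻¹) * (2 * d * Real.exp w ^ 2 * (L : ℝ) ^ 2) := by
        rw [e1, e3]; ring
    _ ≤ (L + (2 + 2 / t)) * (2 * d * 9 * (L : ℝ) ^ 2) := by gcongr
    _ = _ := by ring

/-- The mean square of the velocity of the score along the probability flow. -/
theorem lintegral_enorm_scoreVelocity_sq_le {t : ℝ} (ht : 0 < t) {L : ℝ≥0} (hL1 : 1 ≤ L)
    (hL : ∀ s, 0 < s → s ≤ t → LipschitzWith L (score P s)) :
    ∫⁻ z, ‖scoreVelocity P t z‖ₑ ^ 2 ∂(heatLaw P (heatTime t)) ≤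
      ENNReal.ofReal (169 * d * (L : ℝ) ^ 2 * (L + t⁻¹)) := by
  have hτ := heatTime_pos ht
  have hL1' : (1 : ℝ) ≤ L := hL1
  set E := Real.exp t with hE
  have hE3 : Real.exp (3 * t) = E ^ 3 := by rw [hE, ← Real.exp_nat_mul]; congr 1
  have hLt := hL t ht le_rfl
  have i1 := integrable_norm_heatScore_sq (P := P) hτ
  have i2 := integrable_norm_heatRatioGrad_sq (P := P) hτ
  have hpt : ∀ z, ‖scoreVelocity P t z‖ ^ 2 ≤
      3 * (1 + (L : ℝ) ^ 2) * (E ^ 2 * ‖heatScore P (heatTime t, z)‖ ^ 2) +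
      3 * ((E ^ 3) ^ 2 * ‖heatRatioGrad P (heatTime t, z)‖ ^ 2) := by
    intro z
    set S := heatScore P (heatTime t, z)
    set D := heatRatioGrad P (heatTime t, z)
    set A := heatHessMap P (heatTime t, z)
    have h1 : ‖scoreVelocity P t z‖ ≤ E * ‖S‖ + E ^ 3 * ‖D‖ + L * (E * ‖S‖) := by
      rw [scoreVelocity, hE3, smul_sub]
      have hA := exp_mul_norm_heatHessMap_le ht hLt z
      calc ‖E • S + (E ^ 3 • D - E ^ 3 • A S)‖ ≤ ‖E • S‖ + (‖E ^ 3 • D‖ + ‖E ^ 3 • A S‖) :=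
            (norm_add_le _ _).trans (add_le_add le_rfl (norm_sub_le _ _))
        _ ≤ E * ‖S‖ + (E ^ 3 * ‖D‖ + L * (E * ‖S‖)) := by
            simp only [norm_smul]
            have h0 : 0 < E := Real.exp_pos _
            rw [Real.norm_of_nonneg h0.le, Real.norm_of_nonneg (by positivity : 0 ≤ E ^ 3)]
            refine add_le_add le_rfl (add_le_add le_rfl ?_)
            calc E ^ 3 * ‖A S‖ ≤ E ^ 3 * (‖A‖ * ‖S‖) := by gcongr; exact A.le_opNorm S
              _ = E ^ 2 * ‖A‖ * (E * ‖S‖) := by ring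
              _ ≤ L * (E * ‖S‖) := by gcongr
        _ = _ := by ring
    have h2 : ‖scoreVelocity P t z‖ ^ 2 ≤ (E * ‖S‖ + E ^ 3 * ‖D‖ + L * (E * ‖S‖)) ^ 2 := by gcongr
    refine h2.trans ?_
    nlinarith [sq_nonneg (E * ‖S‖ - E ^ 3 * ‖D‖), sq_nonneg (E * ‖S‖ - L * (E * ‖S‖)),
      sq_nonneg (E ^ 3 * ‖D‖ - L * (E * ‖S‖))]
  have i3 := (i1.const_mul (E ^ 2)).const_mul (3 * (1 + (L : ℝ) ^ 2))
  have i4 := (i2.const_mul ((E ^ 3) ^ 2)).const_mul 3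
  calc ∫⁻ z, ‖scoreVelocity P t z‖ₑ ^ 2 ∂(heatLaw P (heatTime t))
      ≤ ∫⁻ z, ENNReal.ofReal (3 * (1 + (L : ℝ) ^ 2) * (E ^ 2 * ‖heatScore P (heatTime t, z)‖ ^ 2) +
        3 * ((E ^ 3) ^ 2 * ‖heatRatioGrad P (heatTime t, z)‖ ^ 2)) ∂(heatLaw P (heatTime t)) := by
        refine lintegral_mono fun z => ?_
        rw [← ofReal_norm, ← ENNReal.ofReal_pow (norm_nonneg _)]
        exact ENNReal.ofReal_le_ofReal (hpt z)
    _ = ENNReal.ofReal (3 * (1 + (L : ℝ) ^ 2) * (E ^ 2 *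
          ∫ z, ‖heatScore P (heatTime t, z)‖ ^ 2 ∂(heatLaw P (heatTime t))) +
        3 * ((E ^ 3) ^ 2 *
          ∫ z, ‖heatRatioGrad P (heatTime t, z)‖ ^ 2 ∂(heatLaw P (heatTime t)))) := by
        rw [← integral_const_mul, ← integral_const_mul, ← integral_const_mul, ← integral_const_mul,
          ← integral_add i3 i4]
        exact (ofReal_integral_eq_lintegral_ofReal (i3.add i4)
          (.of_forall fun z => add_nonneg (by positivity) (by positivity))).symm
    _ ≤ _ := by
        refine ENNReal.ofReal_le_ofReal ?_
        have h1 := exp_mul_integral_norm_heatScore_sq_le ht hLt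
        have h2 := exp_mul_integral_norm_heatRatioGrad_sq_le ht hL
        refine (add_le_add (mul_le_mul_of_nonneg_left h1 (by positivity))
          (mul_le_mul_of_nonneg_left h2 (by norm_num : (0 : ℝ) ≤ 3))).trans ?_
        have h3 : 0 ≤ d * (L : ℝ) ^ 2 * ((L : ℝ) - 1) := by
          have := sub_nonneg.2 hL1'
          positivity
        have h4 : 0 ≤ d * (L : ℝ) * ((L : ℝ) - 1) := by
          have := sub_nonneg.2 hL1'
          positivity
        have h5 : 0 ≤ d * (L : ℝ) ^ 2 * t⁻¹ := by positivity
        rw [div_eq_mul_inv]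
        have h6 : 0 ≤ (d : ℝ) * L ^ 3 := by positivity
        nlinarith
end CMError

namespace CMError
open Set Filter Topology
variable {d : ℕ}

/-- Minkowski's integral inequality in `L²`, for a family with given bounds on the `L²` norms. -/
theorem lintegral_sq_lintegral_le {α β : Type*} [MeasurableSpace α] [MeasurableSpace β]
    {ν : Measure α} {μ : Measure β} [SFinite ν] [SFinite μ] {f : α → β → ℝ≥0∞}
    (hf : Measurable (Function.uncurry f)) {κ : α → ℝ≥0∞} (hκ : Measurable κ)
    (h0 : ∀ a, κ a ≠ 0) (htop : ∀ a, κ a ≠ ∞)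
    (h : ∀ᵐ a ∂ν, ∫⁻ b, f a b ^ 2 ∂μ ≤ κ a ^ 2) :
    ∫⁻ b, (∫⁻ a, f a b ∂ν) ^ 2 ∂μ ≤ (∫⁻ a, κ a ∂ν) ^ 2 := by
  have hpt : ∀ b, (∫⁻ a, f a b ∂ν) ^ 2 ≤ (∫⁻ a, κ a ∂ν) * ∫⁻ a, (κ a)⁻¹ * f a b ^ 2 ∂ν := by
    intro b
    have hfb : Measurable fun a => f a b := hf.comp measurable_prodMk_right
    have h1 := ENNReal.lintegral_mul_le_Lp_mul_Lq ν Real.HolderConjugate.two_two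
      (f := fun a => κ a ^ ((1 : ℝ) / 2)) (g := fun a => (κ a)⁻¹ ^ ((1 : ℝ) / 2) * f a b)
      (hκ.pow_const _).aemeasurable ((hκ.inv.pow_const _).mul hfb).aemeasurable
    have h2 : ∀ a, ((fun a => κ a ^ ((1 : ℝ) / 2)) * fun a => (κ a)⁻¹ ^ ((1 : ℝ) / 2) * f a b) a =
        f a b := fun a => by
      rw [Pi.mul_apply, ← mul_assoc, ← ENNReal.mul_rpow_of_nonneg _ _ (by positivity),
        ENNReal.mul_inv_cancel (h0 a) (htop a), ENNReal.one_rpow, one_mul]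
    have h3 : ∀ x : ℝ≥0∞, (x ^ ((1 : ℝ) / 2)) ^ (2 : ℝ) = x := fun x => by
      rw [← ENNReal.rpow_mul]; norm_num
    have h4 : ∀ a, ((κ a)⁻¹ ^ ((1 : ℝ) / 2) * f a b) ^ (2 : ℝ) = (κ a)⁻¹ * f a b ^ 2 := fun a => by
      rw [ENNReal.mul_rpow_of_nonneg _ _ (by positivity), h3, ENNReal.rpow_two]
    simp_rw [h2, h3, h4] at h1
    have h5 := pow_le_pow_left₀ (zero_le (a := ∫⁻ a, f a b ∂ν)) h1 2
    rwa [mul_pow, ← ENNReal.rpow_two, ← ENNReal.rpow_two, ← ENNReal.rpow_two, h3, h3,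
      ENNReal.rpow_two] at h5
  have hm : Measurable (Function.uncurry fun b a => (κ a)⁻¹ * f a b ^ 2) :=
    (hκ.inv.comp measurable_snd).mul ((hf.comp measurable_swap).pow_const 2)
  calc ∫⁻ b, (∫⁻ a, f a b ∂ν) ^ 2 ∂μ
      ≤ ∫⁻ b, (∫⁻ a, κ a ∂ν) * ∫⁻ a, (κ a)⁻¹ * f a b ^ 2 ∂ν ∂μ := lintegral_mono hpt
    _ = (∫⁻ a, κ a ∂ν) * ∫⁻ a, (κ a)⁻¹ * ∫⁻ b, f a b ^ 2 ∂μ ∂ν := by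
        rw [lintegral_const_mul _ hm.lintegral_prod_right, lintegral_lintegral_swap hm.aemeasurable]
        congr 1
        refine lintegral_congr fun a => ?_
        exact lintegral_const_mul _ ((hf.comp measurable_prodMk_left).pow_const 2)
    _ ≤ (∫⁻ a, κ a ∂ν) * ∫⁻ a, κ a ∂ν := by
        gcongr 1
        refine lintegral_mono_ae ?_
        filter_upwards [h] with a ha
        refine (mul_le_mul_right ha _).trans (le_of_eq ?_)
        rw [sq, ← mul_assoc, ENNReal.inv_mul_cancel (h0 a) (htop a), one_mul]
    _ = _ := (sq _).symm

variable {P : Measure (Space d)} [IsProbabilityMeasure P]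

theorem continuous_comp_heatTime_projIcc {F : Type*} [TopologicalSpace F] {f : ℝ × Space d → F}
    (hf : ContinuousOn f {p | 0 < p.1}) {a b : ℝ} (ha : 0 < a) (hab : a ≤ b) :
    Continuous fun q : ℝ × Space d => f (heatTime (projIcc a b hab q.1), q.2) := by
  refine hf.comp_continuous ?_ fun q => heatTime_pos (ha.trans_le (projIcc a b hab q.1).2.1)
  exact (continuous_heatTime.comp (continuous_subtype_val.comp
    (continuous_projIcc.comp continuous_fst))).prodMk continuous_snd

/-- The probability flow transports the laws of the process. -/
theorem exists_probFlow {a b : ℝ} (ha : 0 < a) (hab : a ≤ b) {L : ℝ≥0}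
    (hL : ∀ s, 0 < s → s ≤ b → LipschitzWith L (score P s)) :
    ∃ Φ : Space d → ℝ → Space d, (∀ z, Φ z a = z) ∧ (∀ z, IsSolution (probFlow P) a b (Φ z)) ∧
      (Continuous fun q : ℝ × Space d => Φ q.2 (projIcc a b hab q.1)) ∧
      ∀ t ∈ Icc a b, (heatLaw P (heatTime a)).map (fun z => Φ z t) = heatLaw P (heatTime t) := by
  set c : ℝ → ℝ := fun t => projIcc a b hab t with hc
  have hcc : Continuous c := continuous_subtype_val.comp continuous_projIcc
  have hcmem : ∀ t, c t ∈ Icc a b := fun t => (projIcc a b hab t).2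
  have hcid : ∀ t ∈ Icc a b, c t = t := fun t ht => by simp only [hc, projIcc_of_mem hab ht]
  set v : ℝ → Space d → Space d := fun t => probFlow P (c t) with hv
  set A : ℝ → Space d → Space d →L[ℝ] Space d :=
    fun t z => -(Real.exp (2 * c t) • heatHessMap P (heatTime (c t), z)) with hA
  have hvA : ∀ t x, HasFDerivAt (v t) (A t x) x := fun t x =>
    ((hasFDerivAt_heatScore_slice (P := P) (heatTime_pos (ha.trans_le (hcmem t).1)) x).fun_const_smul
      (Real.exp (2 * c t))).fun_neg
  have hvc : Continuous fun q : ℝ × Space d => v q.1 q.2 := by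
    have h1 := continuous_comp_heatTime_projIcc (contDiffOn_heatScore (P := P)).continuousOn ha hab
    have h2 : Continuous fun q : ℝ × Space d => Real.exp (2 * c q.1) := by fun_prop
    exact (h2.smul h1).neg
  have hAc : Continuous fun q : ℝ × Space d => A q.1 q.2 := by
    have h1 := continuous_comp_heatTime_projIcc (continuousOn_heatHessMap (P := P)) ha hab
    have h2 : Continuous fun q : ℝ × Space d => Real.exp (2 * c q.1) := by fun_prop
    exact (h2.smul h1).neg
  have hK : ∀ t, LipschitzWith L (v t) := by
    intro t
    have ht := ha.trans_le (hcmem t).1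
    refine lipschitzWith_of_nnnorm_fderiv_le (𝕜 := ℝ) (fun x => (hvA t x).differentiableAt) fun x => ?_
    rw [(hvA t x).fderiv, ← NNReal.coe_le_coe, coe_nnnorm, hA, norm_neg, norm_smul,
      Real.norm_of_nonneg (Real.exp_pos _).le]
    have h1 := exp_mul_norm_heatHessMap_le ht (hL _ ht (hcmem t).2) x
    rwa [← Real.exp_nat_mul] at h1
  have hsol : ∀ y, IsSolution v a b y ↔ IsSolution (probFlow P) a b y := fun y =>
    forall₂_congr fun t ht => by simp only [hv, hcid t ht]
  have hex := fun z => exists_isSolution (fun x => hvc.comp (by fun_prop : Continuous fun t => (t, x)))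
    hK a b z
  choose Φ h1 h2 using hex
  refine ⟨Φ, h1, fun z => (hsol _).1 (h2 z), ?_, fun t ht => ?_⟩
  · refine continuous_prod_of_continuous_lipschitzWith' _
      (Real.toNNReal (Real.exp (L * (b - a)))) (fun t => ?_) fun z => ?_
    rotate_left
    · exact (h2 z).continuousOn.domRestrict.comp continuous_projIcc
    · refine LipschitzWith.of_dist_le_mul fun z w => ?_
      have h3 := (h2 z).norm_sub_le hK (h2 w) (hcmem t)
      rw [h1, h1, ← dist_eq_norm, ← dist_eq_norm] at h3
      refine h3.trans ?_
      rw [mul_comm, Real.coe_toNNReal _ (Real.exp_pos _).le]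
      gcongr
      exact (hcmem t).2
  · refine map_flow_eq hK hvA hAc (p := fun t z => heatDensity P (heatTime t, z))
      (fun t ht z => heatDensity_pos P (heatTime_pos (ha.trans_le ht.1)))
      (fun t ht => isProbabilityMeasure_heatLaw P (heatTime_pos (ha.trans_le ht.1)))
      (fun y hy t ht => ?_) h1 h2 ht
    have := hasDerivWithinAt_heatDensity_flow (P := P) (ha.trans_le ht.1) ((hsol y).1 hy t ht)
    simpa only [hA, hcid t ht] using this

/-- The exact solution differs from one step of the exponential integrator by the variation of the
score along the trajectory. -/
theorem norm_sub_expIntegrator_le {a b : ℝ} (ha : 0 < a) (hab : a ≤ b) {y : ℝ → Space d}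
    (hy : IsSolution (probFlow P) a b y) {W : ℝ}
    (hW : ∀ u ∈ Icc a b, ‖Real.exp u • heatScore P (heatTime u, y u) -
      Real.exp b • heatScore P (heatTime b, y b)‖ ≤ W) :
    ‖Real.exp (-a) • y a - expIntegrator (score P) a b (Real.exp (-b) • y b)‖ ≤
      (b - a) * Real.exp (b - a) * W := by
  set σ := Real.exp b • heatScore P (heatTime b, y b) with hσ
  have hb : 0 < b := ha.trans_le hab
  have hs : score P b (Real.exp (-b) • y b) = σ := by
    rw [score_eq hb, smul_smul, ← Real.exp_add]; simp [hσ]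
  have hd : ∀ u ∈ Icc a b, HasDerivWithinAt (fun u => Real.exp (-a) • (y u + Real.exp u • σ))
      (Real.exp (u - a) • (σ - Real.exp u • heatScore P (heatTime u, y u))) (Icc a b) u := by
    intro u hu
    have h1 := ((hy u hu).add ((Real.hasDerivAt_exp u).hasDerivWithinAt.smul_const σ)).const_smul
      (Real.exp (-a))
    refine h1.congr_deriv ?_
    rw [probFlow, sub_eq_add_neg u a, Real.exp_add, two_mul, Real.exp_add]
    module
  have hbd : ∀ u ∈ Icc a b,
      ‖Real.exp (u - a) • (σ - Real.exp u • heatScore P (heatTime u, y u))‖ ≤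
      Real.exp (b - a) * W := by
    intro u hu
    rw [norm_smul, Real.norm_of_nonneg (Real.exp_pos _).le, norm_sub_rev]
    have := hW u hu
    have h2 := (norm_nonneg _).trans this
    gcongr
    exact hu.2
  have hmain := (convex_Icc a b).norm_image_sub_le_of_norm_hasDerivWithin_le hd hbd
    (⟨le_rfl, hab⟩ : a ∈ Icc a b) (⟨hab, le_rfl⟩ : b ∈ Icc a b)
  rw [norm_sub_rev, Real.norm_of_nonneg (sub_nonneg.2 hab)] at hmain
  refine le_trans (le_of_eq ?_) (hmain.trans (le_of_eq (by ring)))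
  rw [expIntegrator, hs]
  congr 1
  have e1 : Real.exp (-a) * Real.exp a = 1 := by rw [← Real.exp_add]; simp
  have e2 : Real.exp (b - a) * Real.exp (-b) = Real.exp (-a) := by rw [← Real.exp_add]; ring_nf
  have e3 : Real.exp (-a) * Real.exp b = Real.exp (b - a) := by rw [← Real.exp_add]; ring_nf
  clear_value σ
  rw [smul_smul, e2, smul_add, smul_add, smul_smul, smul_smul, e1, e3]
  module

theorem norm_score_sub_le_integral {a b : ℝ} (ha : 0 < a) {y : ℝ → Space d}
    (hy : IsSolution (probFlow P) a b y) {u : ℝ} (hu : u ∈ Icc a b) :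
    ‖Real.exp u • heatScore P (heatTime u, y u) - Real.exp b • heatScore P (heatTime b, y b)‖ ≤
      (∫⁻ r in Icc a b, ‖scoreVelocity P r (y r)‖ₑ).toReal := by
  have hcont : ContinuousOn (fun r => scoreVelocity P r (y r)) (Icc a b) :=
    continuousOn_scoreVelocity.comp (f := fun r => (r, y r)) (continuousOn_id.prodMk hy.continuousOn)
      fun r hr => ha.trans_le hr.1
  have hint : IntegrableOn (fun r => scoreVelocity P r (y r)) (Icc a b) :=
    hcont.integrableOn_compact isCompact_Icc
  have hsub : Icc u b ⊆ Icc a b := Icc_subset_Icc_left hu.1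
  have hd := fun r hr => hasDerivWithinAt_heatScore_flow (P := P) (ha.trans_le hr.1) (hy r hr)
  have h1 := intervalIntegral.integral_eq_sub_of_hasDeriv_right_of_le hu.2
    (fun r hr => (hd r (hsub hr)).continuousWithinAt.mono hsub)
    (fun r hr => ((hd r (hsub (Ioo_subset_Icc_self hr))).Ici_of_Icc
      ⟨hu.1.trans hr.1.le, hr.2⟩).mono Ioi_subset_Ici_self)
    ((intervalIntegrable_iff_integrableOn_Icc_of_le hu.2).2 (hint.mono_set hsub))
  rw [norm_sub_rev, ← h1, intervalIntegral.integral_of_le hu.2, ← integral_Icc_eq_integral_Ioc,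
    ← toReal_enorm]
  refine ENNReal.toReal_mono hint.2.ne ((enorm_integral_le_lintegral_enorm _).trans ?_)
  exact lintegral_mono_set hsub

end CMError

namespace CMError
open Set Filter Topology
variable {d : ℕ}

theorem eLpNorm_two_le {Ω F : Type*} [MeasurableSpace Ω] [NormedAddCommGroup F] {μ : Measure Ω}
    {f : Ω → F} {c : ℝ≥0∞} (h : ∫⁻ x, ‖f x‖ₑ ^ 2 ∂μ ≤ c ^ 2) : eLpNorm f 2 μ ≤ c := by
  rw [eLpNorm_two_eq]
  refine (ENNReal.rpow_le_rpow h (by positivity)).trans (le_of_eq ?_)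
  rw [← ENNReal.rpow_two, ← ENNReal.rpow_mul]
  norm_num

/-- A bound for the root mean square of `scoreVelocity` at time `u`. -/
noncomputable def velocityBound (d : ℕ) (L : ℝ≥0) (u : ℝ) : ℝ := 13 * √d * L * (√L + √u⁻¹)

theorem lintegral_velocityBound_le (L : ℝ≥0) {a b : ℝ} (ha : 0 < a) (hab : a ≤ b) :
    ∫⁻ u in Icc a b, ENNReal.ofReal (velocityBound d L u) ≤
      ENNReal.ofReal (13 * √d * L * ((√L * b + 2 * √b) - (√L * a + 2 * √a))) := by
  have hcont : ContinuousOn (fun u => √(L : ℝ) + √u⁻¹) (Icc a b) := by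
    refine continuousOn_const.add (ContinuousOn.sqrt (continuousOn_inv₀.mono ?_))
    intro u hu
    exact (ha.trans_le hu.1).ne'
  have h1 : ∫ u in a..b, (√(L : ℝ) + √u⁻¹) = (√L * b + 2 * √b) - (√L * a + 2 * √a) := by
    rw [intervalIntegral.integral_eq_sub_of_hasDerivAt (f := fun u => √L * u + 2 * √u)]
    · intro u hu
      rw [uIcc_of_le hab] at hu
      have hu0 := ha.trans_le hu.1
      have h2 := ((hasDerivAt_id u).const_mul √(L : ℝ)).add
        ((Real.hasDerivAt_sqrt hu0.ne').const_mul 2)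
      refine h2.congr_deriv ?_
      rw [Real.sqrt_inv]
      have := (Real.sqrt_pos.2 hu0).ne'
      field_simp
    · exact ContinuousOn.intervalIntegrable (by rwa [uIcc_of_le hab])
  have hint : IntegrableOn (velocityBound d L) (Icc a b) :=
    (continuousOn_const.mul hcont).integrableOn_compact isCompact_Icc
  rw [← ofReal_integral_eq_lintegral_ofReal hint (.of_forall fun u => by
    unfold velocityBound; positivity), integral_Icc_eq_integral_Ioc,
    ← intervalIntegral.integral_of_le hab]
  unfold velocityBound
  rw [intervalIntegral.integral_const_mul, h1]

variable {P : Measure (Space d)} [IsProbabilityMeasure P]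

theorem map_smul_heatLaw {t : ℝ} (ht : 0 < t) :
    (heatLaw P (heatTime t)).map (fun z => Real.exp (-t) • z) = ouLaw P t := by
  rw [← map_smul_ouLaw P ht, Measure.map_map (by fun_prop) (by fun_prop)]
  have : ((fun z : Space d => Real.exp (-t) • z) ∘ fun x => Real.exp t • x) = id := by
    ext1 x
    simp [smul_smul, ← Real.exp_add]
  rw [this, Measure.map_id]

/-- The mean square error of one step of the exponential integrator with the exact score, along a
coupling of the laws at the two times. -/
theorem exists_coupling_expIntegrator (hd : 1 ≤ d) {a b : ℝ} (ha : 0 < a) (hab : a ≤ b) {L : ℝ≥0}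
    (hL1 : 1 ≤ L) (hL : ∀ s, 0 < s → s ≤ b → LipschitzWith L (score P s)) :
    ∃ X Y : Space d → Space d, Measurable X ∧ Measurable Y ∧
      (heatLaw P (heatTime a)).map X = ouLaw P a ∧ (heatLaw P (heatTime a)).map Y = ouLaw P b ∧
      eLpNorm (fun z => X z - expIntegrator (score P) a b (Y z)) 2 (heatLaw P (heatTime a)) ≤
        ENNReal.ofReal ((b - a) * Real.exp (b - a)) *
          ∫⁻ u in Icc a b, ENNReal.ofReal (velocityBound d L u) := by
  obtain ⟨Φ, h0, hsol, hc, hmap⟩ := exists_probFlow (P := P) ha hab hL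
  have hb : 0 < b := ha.trans_le hab
  have hΦm : ∀ t ∈ Icc a b, Measurable fun z => Φ z t := fun t ht => by
    have h1 : Continuous fun z : Space d => Φ z (projIcc a b hab t) :=
      hc.comp (by fun_prop : Continuous fun z : Space d => (t, z))
    rw [projIcc_of_mem hab ht] at h1
    exact h1.measurable
  have hprob := isProbabilityMeasure_heatLaw P (heatTime_pos ha)
  have hbm : b ∈ Icc a b := ⟨hab, le_rfl⟩
  refine ⟨fun z => Real.exp (-a) • z, fun z => Real.exp (-b) • Φ z b, by fun_prop,
    (measurable_const_smul (Real.exp (-b))).comp (hΦm b hbm), map_smul_heatLaw ha, ?_, ?_⟩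
  · rw [← map_smul_heatLaw hb, ← hmap b hbm, Measure.map_map (by fun_prop) (hΦm b hbm)]
    rfl
  refine eLpNorm_two_le ?_
  have hpt : ∀ z, ‖Real.exp (-a) • z - expIntegrator (score P) a b (Real.exp (-b) • Φ z b)‖ₑ ≤
      ENNReal.ofReal ((b - a) * Real.exp (b - a)) *
        ∫⁻ r in Icc a b, ‖scoreVelocity P r (Φ z r)‖ₑ := by
    intro z
    have h1 := norm_sub_expIntegrator_le ha hab (hsol z)
      (fun u hu => norm_score_sub_le_integral ha (hsol z) hu)
    rw [h0] at h1
    rw [← ofReal_norm]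
    refine (ENNReal.ofReal_le_ofReal h1).trans ?_
    rw [ENNReal.ofReal_mul (mul_nonneg (sub_nonneg.2 hab) (Real.exp_pos _).le)]
    gcongr
    exact ENNReal.ofReal_toReal_le
  set F : ℝ → Space d → ℝ≥0∞ := fun u z =>
    ‖scoreVelocity P (projIcc a b hab u) (Φ z (projIcc a b hab u))‖ₑ with hF
  have hFm : Measurable (Function.uncurry F) := by
    refine Measurable.enorm (Continuous.measurable ?_)
    refine continuousOn_scoreVelocity.comp_continuous
      (f := fun q : ℝ × Space d => ((projIcc a b hab q.1 : ℝ), Φ q.2 (projIcc a b hab q.1)))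
      ((continuous_subtype_val.comp (continuous_projIcc.comp continuous_fst)).prodMk hc)
      fun q => ha.trans_le (projIcc a b hab q.1).2.1
  have hFe : ∀ z, ∫⁻ r in Icc a b, ‖scoreVelocity P r (Φ z r)‖ₑ = ∫⁻ r in Icc a b, F r z :=
    fun z => setLIntegral_congr_fun measurableSet_Icc fun r hr => by
      simp only [hF, projIcc_of_mem hab hr]
  have hκpos : ∀ u, 0 < velocityBound d L u := fun u => by
    have h1 : (0 : ℝ) < d := by exact_mod_cast hd
    have h2 : (0 : ℝ) < L := lt_of_lt_of_le one_pos hL1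
    have h3 := Real.sqrt_pos.2 h1
    have h4 := Real.sqrt_pos.2 h2
    unfold velocityBound
    positivity
  have hmink := lintegral_sq_lintegral_le (ν := volume.restrict (Icc a b))
    (μ := heatLaw P (heatTime a)) hFm (κ := fun u => ENNReal.ofReal (velocityBound d L u))
    (by unfold velocityBound; fun_prop) (fun u => by simpa using hκpos u) (fun u => by simp) (by
      filter_upwards [ae_restrict_mem measurableSet_Icc] with u hu
      have hu0 := ha.trans_le hu.1
      have e1 : ∫⁻ z, F u z ^ 2 ∂(heatLaw P (heatTime a)) =
          ∫⁻ w, ‖scoreVelocity P u w‖ₑ ^ 2 ∂(heatLaw P (heatTime u)) := by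
        rw [← hmap u hu, lintegral_map ((continuous_scoreVelocity hu0).measurable.enorm.pow_const 2)
          (hΦm u hu)]
        simp only [hF, projIcc_of_mem hab hu]
      rw [e1, ← ENNReal.ofReal_pow (hκpos u).le]
      refine (lintegral_enorm_scoreVelocity_sq_le hu0 hL1
        fun s hs hs' => hL s hs (hs'.trans hu.2)).trans (ENNReal.ofReal_le_ofReal ?_)
      unfold velocityBound
      have h1 : (L : ℝ) + u⁻¹ ≤ (√L + √u⁻¹) ^ 2 := by
        have h2 := Real.sq_sqrt L.coe_nonneg
        have h3 := Real.sq_sqrt (inv_nonneg.2 hu0.le)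
        nlinarith [mul_nonneg (Real.sqrt_nonneg (L : ℝ)) (Real.sqrt_nonneg u⁻¹)]
      calc 169 * d * (L : ℝ) ^ 2 * (L + u⁻¹) ≤ 169 * d * (L : ℝ) ^ 2 * (√L + √u⁻¹) ^ 2 := by gcongr
        _ = 169 * (√d) ^ 2 * (L : ℝ) ^ 2 * (√L + √u⁻¹) ^ 2 := by
          rw [Real.sq_sqrt (Nat.cast_nonneg d)]
        _ = _ := by ring)
  calc ∫⁻ z, ‖Real.exp (-a) • z - expIntegrator (score P) a b (Real.exp (-b) • Φ z b)‖ₑ ^ 2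
        ∂(heatLaw P (heatTime a))
      ≤ ∫⁻ z, ENNReal.ofReal ((b - a) * Real.exp (b - a)) ^ 2 * (∫⁻ r in Icc a b, F r z) ^ 2
        ∂(heatLaw P (heatTime a)) := by
        refine lintegral_mono fun z => ?_
        rw [← mul_pow, ← hFe]
        exact pow_le_pow_left₀ (zero_le) (hpt z) 2
    _ ≤ _ := by
        rw [lintegral_const_mul' _ _ (by simp), mul_pow]
        gcongr

theorem measurable_expIntegrator {s : ℝ → Space d → Space d} {a b : ℝ} (hs : Measurable (s b)) :
    Measurable (expIntegrator s a b) := by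
  unfold expIntegrator
  fun_prop

/-- The effect of the error of the score model on one step of the exponential integrator. -/
theorem eLpNorm_expIntegrator_sub_le {μ : Measure (Space d)} {s s' : ℝ → Space d → Space d}
    {a b : ℝ} (hab : a ≤ b) {ε : ℝ}
    (h : eLpNorm (fun x => s b x - s' b x) 2 μ ≤ ENNReal.ofReal ε) :
    eLpNorm (fun x => expIntegrator s' a b x - expIntegrator s a b x) 2 μ ≤
      ENNReal.ofReal ((b - a) * Real.exp (b - a) * ε) := by
  have hba : 0 ≤ b - a := sub_nonneg.2 hab
  have hexp : 0 ≤ (b - a) * Real.exp (b - a) := mul_nonneg hba (Real.exp_pos _).le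
  have hk0 : 0 ≤ Real.exp (b - a) - 1 := sub_nonneg.2 (Real.one_le_exp hba)
  have hk : Real.exp (b - a) - 1 ≤ (b - a) * Real.exp (b - a) := by
    have h2 := Real.add_one_le_exp (-(b - a))
    have h3 : Real.exp (-(b - a)) * Real.exp (b - a) = 1 := by rw [← Real.exp_add]; simp
    nlinarith [Real.exp_pos (b - a)]
  have h3 : (fun x => expIntegrator s' a b x - expIntegrator s a b x) =
      (-(Real.exp (b - a) - 1)) • (fun x => s b x - s' b x) := by
    ext1 x
    simp only [expIntegrator, Pi.smul_apply]
    module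
  rw [h3, eLpNorm_const_smul, enorm_neg, Real.enorm_of_nonneg hk0, ENNReal.ofReal_mul hexp]
  exact mul_le_mul' (ENNReal.ofReal_le_ofReal hk) h

theorem eLpNorm_comp_of_map_eq {μ ν : Measure (Space d)} {Y : Space d → Space d}
    (hY : Measurable Y) (hmap : μ.map Y = ν) {f : Space d → Space d} (hf : Measurable f) :
    eLpNorm (fun z => f (Y z)) 2 μ = eLpNorm f 2 ν := by
  rw [← hmap, eLpNorm_map_measure hf.aestronglyMeasurable hY.aemeasurable]
  rfl

/-- One step of the consistency model. -/
theorem W2_map_map_le_of_coupling {Q μ ν : Measure (Space d)} {X Y : Space d → Space d}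
    (hX : Measurable X) (hY : Measurable Y) (hXmap : Q.map X = μ) (hYmap : Q.map Y = ν) {Lf : ℝ≥0}
    {s s' : ℝ → Space d → Space d} {a b : ℝ} (hab : a ≤ b) (hs : Measurable (s b))
    (hs' : Measurable (s' b)) {f g : Space d → Space d} (hf : LipschitzWith Lf f)
    (hg : Measurable g) {ε ε' K : ℝ} (hε : 0 ≤ ε) (hε' : 0 ≤ ε') (hK : 0 ≤ K)
    (hXY : eLpNorm (fun z => X z - expIntegrator s' a b (Y z)) 2 Q ≤ ENNReal.ofReal K)
    (hse : ∫⁻ x, ‖s b x - s' b x‖ₑ ^ 2 ∂ν ≤ ENNReal.ofReal (ε ^ 2))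
    (hce : ∫⁻ x, ‖g x - f (expIntegrator s a b x)‖ₑ ^ 2 ∂ν ≤ ENNReal.ofReal (ε' ^ 2)) :
    W2 (ν.map g) (μ.map f) ≤
      ENNReal.ofReal (ε' + Lf * ((b - a) * Real.exp (b - a) * ε + K)) := by
  have hfm := hf.continuous.measurable
  have hEm := measurable_expIntegrator (a := a) hs
  have hEm' := measurable_expIntegrator (a := a) hs'
  have hexp : 0 ≤ (b - a) * Real.exp (b - a) * ε :=
    mul_nonneg (mul_nonneg (sub_nonneg.2 hab) (Real.exp_pos _).le) hε
  have h1 : eLpNorm (fun z => expIntegrator s' a b (Y z) - expIntegrator s a b (Y z)) 2 Q ≤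
      ENNReal.ofReal ((b - a) * Real.exp (b - a) * ε) := by
    rw [eLpNorm_comp_of_map_eq hY hYmap (f := fun x => expIntegrator s' a b x -
      expIntegrator s a b x) (hEm'.sub hEm)]
    exact eLpNorm_expIntegrator_sub_le hab (eLpNorm_two_le_ofReal hε hse)
  have h2 : eLpNorm (fun z => f (expIntegrator s a b (Y z)) - f (X z)) 2 Q ≤
      ENNReal.ofReal (Lf * ((b - a) * Real.exp (b - a) * ε + K)) := by
    refine (eLpNorm_le_nnreal_smul_eLpNorm_of_ae_le_mul (c := Lf)
      (g := (fun z => X z - expIntegrator s' a b (Y z)) +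
        fun z => expIntegrator s' a b (Y z) - expIntegrator s a b (Y z))
      (.of_forall fun z => ?_) 2).trans ?_
    · have h := hf.norm_sub_le (X z) (expIntegrator s a b (Y z))
      rw [norm_sub_rev] at h
      refine h.trans (le_of_eq ?_)
      congr 2
      simp
    · rw [ENNReal.smul_def, smul_eq_mul, ENNReal.ofReal_mul Lf.coe_nonneg,
        ENNReal.ofReal_coe_nnreal]
      refine mul_le_mul_right ?_ _
      refine (eLpNorm_add_le (hX.sub (hEm'.comp hY)).aestronglyMeasurable
        ((hEm'.comp hY).sub (hEm.comp hY)).aestronglyMeasurable one_le_two).trans ?_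
      rw [add_comm, ENNReal.ofReal_add hexp hK]
      exact add_le_add h1 hXY
  have h3 : eLpNorm (fun z => g (Y z) - f (expIntegrator s a b (Y z))) 2 Q ≤ ENNReal.ofReal ε' := by
    rw [eLpNorm_comp_of_map_eq hY hYmap (f := fun x => g x - f (expIntegrator s a b x))
      (hg.sub (hfm.comp hEm))]
    exact eLpNorm_two_le_ofReal hε' hce
  rw [← hXmap, ← hYmap, Measure.map_map hg hY, Measure.map_map hfm hX]
  refine (W2_map_map_le (hg.comp hY) (hfm.comp hX)).trans ?_
  have h5 : (fun z => (g ∘ Y) z - (f ∘ X) z) = (fun z => g (Y z) - f (expIntegrator s a b (Y z))) +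
      fun z => f (expIntegrator s a b (Y z)) - f (X z) := by
    ext1 z
    simp
  rw [h5]
  refine (eLpNorm_add_le ((hg.comp hY).sub (hfm.comp (hEm.comp hY))).aestronglyMeasurable
    ((hfm.comp (hEm.comp hY)).sub (hfm.comp hX)).aestronglyMeasurable one_le_two).trans ?_
  rw [ENNReal.ofReal_add hε' (mul_nonneg Lf.coe_nonneg (add_nonneg hexp hK))]
  exact add_le_add h3 h2

theorem W2_map_map_ouLaw_le (hd : 1 ≤ d) {a b : ℝ} (ha : 0 < a) (hab : a ≤ b) {L Lf : ℝ≥0}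
    (hL1 : 1 ≤ L) (hL : ∀ s, 0 < s → s ≤ b → LipschitzWith L (score P s))
    {s : ℝ → Space d → Space d} (hs : Measurable (s b)) {f g : Space d → Space d}
    (hf : LipschitzWith Lf f) (hg : Measurable g) {ε ε' : ℝ} (hε : 0 ≤ ε) (hε' : 0 ≤ ε')
    (hse : ∫⁻ x, ‖s b x - score P b x‖ₑ ^ 2 ∂(ouLaw P b) ≤ ENNReal.ofReal (ε ^ 2))
    (hce : ∫⁻ x, ‖g x - f (expIntegrator s a b x)‖ₑ ^ 2 ∂(ouLaw P b) ≤ ENNReal.ofReal (ε' ^ 2)) :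
    W2 ((ouLaw P b).map g) ((ouLaw P a).map f) ≤
      ENNReal.ofReal (ε' + Lf * ((b - a) * Real.exp (b - a) * ε + (b - a) * Real.exp (b - a) *
        (13 * √d * L * ((√L * b + 2 * √b) - (√L * a + 2 * √a))))) := by
  obtain ⟨X, Y, hX, hY, hXmap, hYmap, hXY⟩ :=
    exists_coupling_expIntegrator (P := P) hd ha hab hL1 hL
  have hexp : 0 ≤ (b - a) * Real.exp (b - a) := mul_nonneg (sub_nonneg.2 hab) (Real.exp_pos _).le
  have hK : 0 ≤ 13 * √d * L * ((√L * b + 2 * √b) - (√L * a + 2 * √a)) := by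
    have h1 : √a ≤ √b := Real.sqrt_le_sqrt hab
    have h2 : √(L : ℝ) * a ≤ √L * b := by gcongr
    have : 0 ≤ (√L * b + 2 * √b) - (√L * a + 2 * √a) := by linarith
    positivity
  refine W2_map_map_le_of_coupling hX hY hXmap hYmap hab hs
    (hL b (ha.trans_le hab) le_rfl).continuous.measurable hf hg hε hε' (mul_nonneg hexp hK)
    (hXY.trans ?_) hse hce
  rw [ENNReal.ofReal_mul hexp]
  exact mul_le_mul_right (lintegral_velocityBound_le L ha hab) _

end CMError

namespace CMError
open Set Filter Topology

namespace IsTwoStageSchedule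

variable {t : ℕ → ℝ} {N N₁ : ℕ} {h δ T : ℝ}

theorem mono (H : IsTwoStageSchedule t N N₁ h δ T) {i j : ℕ} (hi : 1 ≤ i) (hij : i ≤ j)
    (hj : j ≤ N) : t i ≤ t j := by
  induction j, hij using Nat.le_induction with
  | base => exact le_rfl
  | succ j hij ih => exact (ih (by omega)).trans (H.increasing j (by omega) (by omega)).le

theorem pos (H : IsTwoStageSchedule t N N₁ h δ T) {i : ℕ} (hi : 1 ≤ i) (hN : i ≤ N) : 0 < t i :=
  (H.first ▸ H.delta_pos).trans_le (H.mono le_rfl hi hN)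

theorem le_T (H : IsTwoStageSchedule t N N₁ h δ T) {i : ℕ} (hi : 1 ≤ i) (hN : i ≤ N) : t i ≤ T :=
  H.last ▸ H.mono hi hN le_rfl

theorem T_pos (H : IsTwoStageSchedule t N N₁ h δ T) : 0 < T :=
  H.last ▸ H.pos (H.one_le.trans H.le_last) le_rfl

theorem h_pos (H : IsTwoStageSchedule t N N₁ h δ T) : 0 < h := by
  have h1 : (N₁ : ℝ) ≤ N := by exact_mod_cast H.le_last
  exact pos_of_mul_pos_right (H.T_pos.trans_le H.constant_upper) (by linarith)

theorem step_le (H : IsTwoStageSchedule t N N₁ h δ T) {k : ℕ} (hk : 1 ≤ k) (hN : k < N) :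
    t (k + 1) - t k ≤ h := by
  rcases le_or_gt N₁ k with h1 | h1
  · exact (H.constant_step k h1 hN).le
  rcases eq_or_lt_of_le hk with rfl | h2
  · have h3 : ∀ j, N₁ ≤ j → j ≤ N → t j = t N₁ + ((j : ℝ) - N₁) * h := by
      intro j hj
      induction j, hj using Nat.le_induction with
      | base => simp
      | succ j hj ih =>
        intro hjN
        have h4 := H.constant_step j hj (by omega)
        rw [ih (by omega)] at h4
        push_cast
        linarith
    have h4 := h3 N H.le_last le_rfl
    have h5 := H.constant_upper
    rw [H.last] at h4
    have h6 := H.mono (i := 2) (by norm_num) h1 H.le_last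
    have h7 := H.pos le_rfl hN.le
    simp only [Nat.reduceAdd]
    linarith
  · rw [H.geometric_step k h2 h1]
    exact div_le_self H.h_pos.le (one_le_pow₀ one_le_two)

end IsTwoStageSchedule

variable {d : ℕ} {P : Measure (Space d)} [IsProbabilityMeasure P] {m₂ : ℝ} {Ls Lf : ℝ≥0}
  {s f : ℝ → Space d → Space d} {εsc εcm : ℝ} {t : ℕ → ℝ} {N N₁ : ℕ} {h δ T : ℝ}

/-- The accumulated error of the consistency model up to time `u`. -/
noncomputable def errorProfile (d : ℕ) (Ls Lf : ℝ≥0) (εsc εcm h B u : ℝ) : ℝ :=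
  εcm * u + Lf * B * εsc * u + 13 * Lf * B * √d * Ls * h * (√Ls * u + 2 * √u)

theorem errorProfile_mono (hεsc : 0 ≤ εsc) (hεcm : 0 ≤ εcm) (hh : 0 ≤ h) {B : ℝ} (hB : 0 ≤ B)
    {u v : ℝ} (huv : u ≤ v) :
    errorProfile d Ls Lf εsc εcm h B u ≤ errorProfile d Ls Lf εsc εcm h B v := by
  have := Real.sqrt_le_sqrt huv
  unfold errorProfile
  gcongr

theorem Assumptions.W2_step_le (H : Assumptions P m₂ Ls Lf s f εsc εcm t N N₁ h δ T) (hd : 1 ≤ d)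
    {h₀ : ℝ} (hh : h ≤ h₀) {n : ℕ} (hn : 1 ≤ n) (hN : n < N) :
    W2 ((ouLaw P (t (n + 1))).map (f (t (n + 1)))) ((ouLaw P (t n)).map (f (t n))) ≤
      ENNReal.ofReal (errorProfile d Ls Lf εsc εcm h (Real.exp h₀) (t (n + 1)) -
        errorProfile d Ls Lf εsc εcm h (Real.exp h₀) (t n)) := by
  have ha := H.schedule.pos hn hN.le
  have hab := (H.schedule.increasing n hn hN).le
  have hstep := H.schedule.step_le hn hN
  have hsc := H.εsc_nonneg
  have hcm := H.εcm_nonneg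
  have hba : 0 ≤ t (n + 1) - t n := sub_nonneg.2 hab
  have hbT := H.schedule.le_T (i := n + 1) (by omega) (by omega)
  have h1 := W2_map_map_ouLaw_le (P := P) hd ha hab H.one_le_Ls
    (fun r hr hr' => H.score_lipschitz r hr (hr'.trans hbT))
    (H.score_model_measurable (n + 1) (by omega) (by omega)) (H.model_lipschitz n hn hN.le)
    (H.model_lipschitz (n + 1) (by omega) (by omega)).continuous.measurable hsc
    (mul_nonneg hcm hba) (H.score_error (n + 1) (by omega) (by omega))
    (by rw [mul_pow]; exact H.consistency_error n hn hN)
  refine h1.trans (ENNReal.ofReal_le_ofReal ?_)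
  have hexp : Real.exp (t (n + 1) - t n) ≤ Real.exp h₀ := Real.exp_le_exp.2 (hstep.trans hh)
  have hsq : 0 ≤ (√Ls * t (n + 1) + 2 * √(t (n + 1))) - (√Ls * t n + 2 * √(t n)) := by
    have h2 := Real.sqrt_le_sqrt hab
    have h3 : √(Ls : ℝ) * t n ≤ √Ls * t (n + 1) := by gcongr
    linarith
  calc εcm * (t (n + 1) - t n) + Lf * ((t (n + 1) - t n) * Real.exp (t (n + 1) - t n) * εsc +
        (t (n + 1) - t n) * Real.exp (t (n + 1) - t n) * (13 * √d * Ls *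
          ((√Ls * t (n + 1) + 2 * √(t (n + 1))) - (√Ls * t n + 2 * √(t n)))))
      ≤ εcm * (t (n + 1) - t n) + Lf * ((t (n + 1) - t n) * Real.exp h₀ * εsc +
        h * Real.exp h₀ * (13 * √d * Ls *
          ((√Ls * t (n + 1) + 2 * √(t (n + 1))) - (√Ls * t n + 2 * √(t n))))) := by
        have := H.schedule.h_pos
        gcongr
    _ = _ := by
        unfold errorProfile
        ring

theorem Assumptions.W2_map_le (H : Assumptions P m₂ Ls Lf s f εsc εcm t N N₁ h δ T) (hd : 1 ≤ d)
    {h₀ : ℝ} (hh : h ≤ h₀) {n : ℕ} (hn : 1 ≤ n) (hN : n ≤ N) :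
    W2 ((ouLaw P (t n)).map (f (t n))) (ouLaw P δ) ≤
      ENNReal.ofReal (errorProfile d Ls Lf εsc εcm h (Real.exp h₀) (t n) -
        errorProfile d Ls Lf εsc εcm h (Real.exp h₀) δ) := by
  induction n, hn using Nat.le_induction with
  | base =>
    have h1 : f (t 1) = id := by
      rw [H.schedule.first]
      exact funext H.boundary
    rw [h1, Measure.map_id, H.schedule.first]
    refine (W2_le_eLpNorm (γ := (ouLaw P δ).map fun x => (x, x)) ?_ ?_).trans ?_
    · rw [Measure.map_map (by fun_prop) (by fun_prop)]
      exact Measure.map_id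
    · rw [Measure.map_map (by fun_prop) (by fun_prop)]
      exact Measure.map_id
    · rw [eLpNorm_map_measure (Measurable.aestronglyMeasurable (by fun_prop)) (by fun_prop)]
      have : ((fun z : Space d × Space d => z.1 - z.2) ∘ fun x => (x, x)) = 0 := by
        ext1 x
        simp
      rw [this]
      simp
  | succ n hn ih =>
    have hfm : ∀ n, 1 ≤ n → n ≤ N → IsProbabilityMeasure ((ouLaw P (t n)).map (f (t n))) :=
      fun n hn hN => Measure.isProbabilityMeasure_map
        (H.model_lipschitz n hn hN).continuous.measurable.aemeasurable
    have := hfm n hn (by omega)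
    have := hfm (n + 1) (by omega) hN
    have hB := (Real.exp_pos h₀).le
    have hh0 := H.schedule.h_pos.le
    have hmono : ∀ {u v : ℝ}, u ≤ v → errorProfile d Ls Lf εsc εcm h (Real.exp h₀) u ≤
        errorProfile d Ls Lf εsc εcm h (Real.exp h₀) v := fun huv =>
      errorProfile_mono H.εsc_nonneg H.εcm_nonneg hh0 hB huv
    refine (W2_triangle _ ((ouLaw P (t n)).map (f (t n))) _).trans
      ((add_le_add (H.W2_step_le hd hh hn (by omega)) (ih (by omega))).trans (le_of_eq ?_))
    rw [← ENNReal.ofReal_add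
      (sub_nonneg.2 (hmono (H.schedule.increasing n hn (by omega)).le))
      (sub_nonneg.2 (hmono (H.schedule.first ▸ H.schedule.mono le_rfl hn (by omega))))]
    congr 1
    ring

/-- The total error bound. -/
theorem Assumptions.W2_le (H : Assumptions P m₂ Ls Lf s f εsc εcm t N N₁ h δ T) (hd : 1 ≤ d)
    (hT : (Ls : ℝ)⁻¹ < T) {h₀ : ℝ} (hh₀ : 0 < h₀) (hh : h ≤ h₀) :
    W2 ((stdGaussian (Space d)).map (f T)) P ≤
      ENNReal.ofReal (39 * Real.exp h₀ *
        (max √(d : ℝ) m₂ * Lf * Real.exp (-T)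
          + T * (εcm + Lf * εsc + Lf * (Ls : ℝ) ^ ((3 : ℝ) / 2) * √(d : ℝ) * h)
          + max √(d : ℝ) m₂ * √δ)) := by
  have hN : 1 ≤ N := H.schedule.one_le.trans H.schedule.le_last
  have hT0 := H.schedule.T_pos
  have hδ := H.schedule.delta_pos
  have hh1 := H.schedule.h_pos
  have hsc := H.εsc_nonneg
  have hcm := H.εcm_nonneg
  have hfT := H.model_lipschitz N hN le_rfl
  rw [H.schedule.last] at hfT
  have e1 := W2_map_stdGaussian_map_ouLaw_le H.integrable_sq H.second_moment H.m₂_nonneg hT0.le hfT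
  have e2 := H.W2_map_le hd hh hN le_rfl
  rw [H.schedule.last] at e2
  have e3 := W2_ouLaw_le H.integrable_sq H.second_moment H.m₂_nonneg hδ
  have p1 := Measure.isProbabilityMeasure_map (μ := stdGaussian (Space d))
    hfT.continuous.measurable.aemeasurable
  have p2 := Measure.isProbabilityMeasure_map (μ := ouLaw P T)
    hfT.continuous.measurable.aemeasurable
  have hL0 : (0 : ℝ) < Ls := zero_lt_one.trans_le (NNReal.coe_le_coe.2 H.one_le_Ls)
  set M := max √(d : ℝ) m₂ with hM
  have hM0 : 0 ≤ M := le_max_of_le_left (Real.sqrt_nonneg _)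
  set B := Real.exp h₀ with hB
  have hB1 : 1 ≤ B := Real.one_le_exp hh₀.le
  set Q := T * (εcm + Lf * εsc + Lf * (Ls : ℝ) ^ ((3 : ℝ) / 2) * √(d : ℝ) * h) with hQ
  have hQ0 : 0 ≤ Q := by positivity
  have e2' : errorProfile d Ls Lf εsc εcm h B T - errorProfile d Ls Lf εsc εcm h B δ ≤
      39 * B * Q := by
    have h1 : 0 ≤ errorProfile d Ls Lf εsc εcm h B δ := by
      unfold errorProfile
      positivity
    have h2 : √T ≤ T * √(Ls : ℝ) := by
      have h3 : T = √T * √T := (Real.mul_self_sqrt hT0.le).symm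
      have h4 : 1 ≤ √T * √(Ls : ℝ) := by
        rw [← Real.sqrt_mul hT0.le]
        refine Real.one_le_sqrt.2 ?_
        rw [inv_lt_iff_one_lt_mul₀ hL0] at hT
        exact hT.le
      calc √T = √T * 1 := (mul_one _).symm
        _ ≤ √T * (√T * √(Ls : ℝ)) := by gcongr
        _ = T * √(Ls : ℝ) := by rw [← mul_assoc, ← h3]
    have h5 : (Ls : ℝ) ^ ((3 : ℝ) / 2) = Ls * √Ls := by
      rw [show (3 : ℝ) / 2 = 1 + 1 / 2 by norm_num, Real.rpow_add hL0, Real.rpow_one,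
        Real.sqrt_eq_rpow]
    refine (sub_le_self _ h1).trans ?_
    rw [hQ, h5]
    unfold errorProfile
    calc εcm * T + Lf * B * εsc * T + 13 * Lf * B * √d * Ls * h * (√Ls * T + 2 * √T)
        ≤ 39 * B * (εcm * T) + 39 * B * (Lf * εsc * T) +
          13 * Lf * B * √d * Ls * h * (√Ls * T + 2 * (T * √Ls)) := by
          refine add_le_add (add_le_add ?_ ?_) (by gcongr)
          · exact le_mul_of_one_le_left (by positivity) (by linarith)
          · rw [show Lf * B * εsc * T = B * (Lf * εsc * T) by ring]
            have : 0 ≤ Lf * εsc * T := by positivity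
            nlinarith [mul_nonneg (zero_le_one.trans hB1) this]
      _ = _ := by ring
  refine (W2_triangle _ ((ouLaw P T).map (f T)) _).trans ?_
  refine (add_le_add e1 ((W2_triangle _ (ouLaw P δ) _).trans
    (add_le_add (e2.trans (ENNReal.ofReal_le_ofReal e2')) e3))).trans ?_
  rw [← ENNReal.ofReal_add (by positivity) (by positivity),
    ← ENNReal.ofReal_add (by positivity) (by positivity)]
  refine ENNReal.ofReal_le_ofReal ?_
  have k1 : 0 ≤ M * Lf * Real.exp (-T) := by positivity
  have k2 : 0 ≤ M * √δ := by positivity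
  nlinarith [mul_nonneg k1 (sub_nonneg.2 hB1), mul_nonneg k2 (sub_nonneg.2 hB1)]

end CMError

theorem mainTheorem1 (h₀ : ℝ) (hh₀ : 0 < h₀) :
    (∃ C : ℝ, 0 < C ∧
      ∀ (d : ℕ) (hd : 1 ≤ d) (pdata : Measure (CMError.Space d)) [IsProbabilityMeasure pdata]
        (m₂ : ℝ) (Ls Lf : ℝ≥0) (s f : ℝ → CMError.Space d → CMError.Space d) (εsc εcm : ℝ)
        (t : ℕ → ℝ) (N N₁ : ℕ) (h δ T : ℝ),
        CMError.Assumptions pdata m₂ Ls Lf s f εsc εcm t N N₁ h δ T →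
        (Ls : ℝ)⁻¹ < T → h ≤ h₀ →
        CMError.W2 ((stdGaussian (CMError.Space d)).map (f T)) pdata ≤
          ENNReal.ofReal (C *
            (max √(d : ℝ) m₂ * Lf * Real.exp (-T)
              + T * (εcm + Lf * εsc + Lf * (Ls : ℝ) ^ ((3 : ℝ) / 2) * √(d : ℝ) * h)
              + max √(d : ℝ) m₂ * √δ))) ∧
    (∀ K : ℝ, 0 < K → ∃ C : ℝ, 0 < C ∧
      ∀ (d : ℕ) (hd : 1 ≤ d) (pdata : Measure (CMError.Space d)) [IsProbabilityMeasure pdata]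
        (m₂ : ℝ) (Ls Lf : ℝ≥0) (s f : ℝ → CMError.Space d → CMError.Space d) (εsc εcm : ℝ)
        (t : ℕ → ℝ) (N N₁ : ℕ) (h δ T : ℝ),
        CMError.Assumptions pdata m₂ Ls Lf s f εsc εcm t N N₁ h δ T →
        (Ls : ℝ)⁻¹ < T → h ≤ h₀ →
        ∀ ε : ℝ, 0 < ε →
          δ ≤ K * (ε ^ 2 / max (d : ℝ) (m₂ ^ 2)) →
          Real.log (Lf * max √(d : ℝ) m₂ / ε) ≤ T →
          h ≤ K * (ε / (T * Lf * (Ls : ℝ) ^ ((3 : ℝ) / 2) * √(d : ℝ))) →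
          εcm ≤ K * (ε / T) →
          εsc ≤ K * (ε / (Lf * T)) →
          CMError.W2 ((stdGaussian (CMError.Space d)).map (f T)) pdata ≤
            ENNReal.ofReal (C * ε)) := by
  refine ⟨⟨39 * Real.exp h₀, by positivity, fun d hd P _ m₂ Ls Lf s f εsc εcm t N N₁ h δ T H hT hh =>
    H.W2_le hd hT hh₀ hh⟩, fun K hK => ⟨39 * Real.exp h₀ * (1 + 3 * K + √K), by positivity, ?_⟩⟩
  intro d hd P _ m₂ Ls Lf s f εsc εcm t N N₁ h δ T H hT hh ε hε c1 c2 c3 c4 c5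
  refine (H.W2_le hd hT hh₀ hh).trans (ENNReal.ofReal_le_ofReal ?_)
  rw [mul_assoc (39 * Real.exp h₀) (1 + 3 * K + √K) ε]
  refine mul_le_mul_of_nonneg_left ?_ (by positivity)
  have hT0 := H.schedule.T_pos
  have hd0 : (0 : ℝ) < d := by exact_mod_cast hd
  have hsd := Real.sqrt_pos.2 hd0
  have hL0 : (0 : ℝ) < Ls := zero_lt_one.trans_le (NNReal.coe_le_coe.2 H.one_le_Ls)
  have hLf : (0 : ℝ) < Lf := zero_lt_one.trans (NNReal.coe_lt_coe.2 H.one_lt_Lf)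
  have hL3 : (0 : ℝ) < (Ls : ℝ) ^ ((3 : ℝ) / 2) := Real.rpow_pos_of_pos hL0 _
  set M := max √(d : ℝ) m₂ with hM
  have hM0 : 0 < M := lt_max_of_lt_left hsd
  have hM2 : max (d : ℝ) (m₂ ^ 2) = M ^ 2 := by
    rw [hM]
    rcases le_total √(d : ℝ) m₂ with h1 | h1
    · have h2 : (d : ℝ) ≤ m₂ ^ 2 := by
        rw [← Real.sq_sqrt hd0.le]
        gcongr
      rw [max_eq_right h1, max_eq_right h2]
    · have h2 : m₂ ^ 2 ≤ d := by
        rw [← Real.sq_sqrt hd0.le]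
        exact pow_le_pow_left₀ H.m₂_nonneg h1 2
      rw [max_eq_left h1, max_eq_left h2, Real.sq_sqrt hd0.le]
  have t1 : M * Lf * Real.exp (-T) ≤ ε := by
    rw [Real.log_le_iff_le_exp (by positivity), div_le_iff₀ hε] at c2
    calc M * Lf * Real.exp (-T) = (Lf * M) * Real.exp (-T) := by ring
      _ ≤ (Real.exp T * ε) * Real.exp (-T) := by gcongr
      _ = ε * (Real.exp T * Real.exp (-T)) := by ring
      _ = ε := by rw [← Real.exp_add]; simp
  have t2 : T * (εcm + Lf * εsc + Lf * (Ls : ℝ) ^ ((3 : ℝ) / 2) * √(d : ℝ) * h) ≤ 3 * K * ε := by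
    calc T * (εcm + Lf * εsc + Lf * (Ls : ℝ) ^ ((3 : ℝ) / 2) * √(d : ℝ) * h)
        ≤ T * (K * (ε / T) + Lf * (K * (ε / (Lf * T))) + Lf * (Ls : ℝ) ^ ((3 : ℝ) / 2) * √(d : ℝ) *
          (K * (ε / (T * Lf * (Ls : ℝ) ^ ((3 : ℝ) / 2) * √(d : ℝ))))) := by gcongr
      _ = 3 * K * ε := by
        field_simp
        ring
  have t3 : M * √δ ≤ √K * ε := by
    rw [hM2] at c1
    have h1 : √δ ≤ √K * (ε / M) := by
      refine (Real.sqrt_le_sqrt c1).trans (le_of_eq ?_)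
      rw [← div_pow, Real.sqrt_mul hK.le, Real.sqrt_sq (by positivity)]
    calc M * √δ ≤ M * (√K * (ε / M)) := by gcongr
      _ = √K * ε := by field_simp
  calc M * Lf * Real.exp (-T) +
      T * (εcm + Lf * εsc + Lf * (Ls : ℝ) ^ ((3 : ℝ) / 2) * √(d : ℝ) * h) + M * √δ
      ≤ ε + 3 * K * ε + √K * ε := add_le_add (add_le_add t1 t2) t3
    _ = _ := by ring
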